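/- Let $K$ be a field. A braided vector space $(V,c)$ is a $K$-vector space $V$ with a linear map $c:V\otimes V\to V\otimes V$ such that $c_1c_2c_1=c_2c_1c_2$, where $c_1=c\otimes V$, $c_2=V\otimes c$ (invertibility is not required). A braided bialgebra is a braided vector space which is also an algebra and a coalgebra, such that $m,u,\Delta,\varepsilon$ commute with the braiding, $\Delta m=(m\otimes m)(B\otimes c\otimes B)(\Delta\otimes\Delta)$, and $\Delta$ is unital and $\varepsilon$ is a unital algebra map; it is graded if it is a direct sum of subspaces indexed by $\mathbb N$ which are respected by all structure maps. $P(B)$ is the space of primitive elements. $T(V,c)$ is the tensor algebra with the braiding $c_T$ extending $c$ and with the comultiplication which is multiplicative into $T\otimes T$ with product $(m\otimes m)(T\otimes c_T\otimes T)$ and satisfies $\Delta(v)=v\otimes 1+1\otimes v$ for $v\in V$. A bracket $b=(b^{[n]})_{n\in\mathbb N}$ on $(V,c)$ consists of linear maps $b^{[n]}:P(U^{[n]})\to V$, where $U^{[0]}=T(V,c)$, $i^{[n]}:V\to U^{[n]}$ is the canonical map, $U^{[n+1]}$ is the quotient braided bialgebra of $U^{[n]}$ by the two-sided ideal generated by all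 $z-i^{[n]}b^{[n]}(z)$ with $z\in P(U^{[n]})$, and, with $V^{[n]}=i^{[n]}(V)$, $P^{[n]}=P(U^{[n]})$ and the restrictions of the braiding of $U^{[n]}$, $$c_{V^{[n]},V^{[n]}}(i^{[n]}b^{[n]}\otimes V^{[n]})=(V^{[n]}\otimes i^{[n]}b^{[n]})c_{P^{[n]},V^{[n]}},\qquad c_{V^{[n]},V^{[n]}}(V^{[n]}\otimes i^{[n]}b^{[n]})=(i^{[n]}b^{[n]}\otimes V^{[n]})c_{V^{[n]},P^{[n]}}.$$ $U=U(V,c,b)$ is the direct limit of the $U^{[n]}$, with projection $\pi_U:T(V,c)\to U$; $(V,c,b)$ is a braided Lie algebra if $\pi_U|_V$ is injective. The Nichols algebra $\mathcal B(V,c)$, with projection $\Omega:T(V,c)\to\mathcal B(V,c)$, is the direct limit of $S^{[n]}$, where $S^{[0]}=T(V,c)$ and $S^{[n+1]}$ is the quotient of $S^{[n]}$ by the ideal generated by its homogeneous primitive elements of degree at least two. Let $(V,c,b)$ be a braided Lie algebra and $U=U(V,c,b)$. Let $U_{(n)}=\pi_U\big(\bigoplus_{i\le n}V^{\otimes i}\big)$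 be the standard filtration, and $(U_n)_{n\in\mathbb N}$ the coradical filtration: $U_0$ is the sum of all simple subcoalgebras and $U_{n+1}=\Delta^{-1}(U\otimes U_n+U_0\otimes U)$. Then: (a) $(U_{(n)})$ and $(U_n)$ make $U$ a filtered braided bialgebra (exhaustive filtrations compatible with $m$, $\Delta$ and the braiding), $U_{(0)}=U_0=K1$ and $U_{(n)}\subseteq U_n$ for all $n$; $T(V,c)$, $\mathcal B(V,c)$ and, with the induced structures, the associated graded spaces $\mathfrak G(U)=\bigoplus_n U_{(n)}/U_{(n-1)}$ and $\mathrm{gr}\,U=\bigoplus_n U_n/U_{n-1}$ are graded braided bialgebras; the identity of $U$ induces a graded braided bialgebra homomorphism $\xi_U:\mathfrak G(U)\to\mathrm{gr}\,U$; and there is a unique graded braided bialgebra homomorphism $\vartheta_U:T(V,c)\to\mathfrak G(U)$ with $\vartheta_U(v)=\pi_U(v)+U_{(0)}\in U_{(1)}/U_{(0)}$ for $v\in V$, and it is surjective. (b) $\xi_U\vartheta_U:T(V,c)\to\mathrm{gr}\,U$ is the unique graded braided bialgebra homomorphism which lifts the map $V\to U_1/U_0$, $v\mapsto\pi_U(v)+U_0$.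 (c) There is an injective graded braided bialgebra homomorphism $\chi_U:\mathcal B(V,c)\to\mathrm{gr}\,U$ with $\chi_U\Omega=\xi_U\vartheta_U$. -/

import Mathlib

open scoped TensorProduct DirectSum

noncomputable section

namespace BraidedLie

universe u v w

/-! ### Linear algebra -/

section LinearAlgebra

variable {K : Type u} [Field K]

/-- `X ⊗ Y`, viewed inside the tensor product of the ambient spaces. -/
def tens {A : Type v} {B : Type w} [AddCommGroup A] [Module K A] [AddCommGroup B] [Module K B]
    (X : Submodule K A) (Y : Submodule K B) : Submodule K (A ⊗[K] B) :=
  LinearMap.range (TensorProduct.mapIncl X Y)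

/-- The map `Y → W` induced by `g : X → Z` along a surjection `f : X → Y` and an injection
`e : W → Z`: the unique `φ` with `e (φ (f x)) = g x`. -/
def induced {X Y Z W : Type*} [AddCommGroup X] [Module K X] [AddCommGroup Y] [Module K Y]
    [AddCommGroup Z] [Module K Z] [AddCommGroup W] [Module K W]
    (f : X →ₗ[K] Y) (g : X →ₗ[K] Z) (e : W →ₗ[K] Z)
    (hf : Function.Surjective f) (he : Function.Injective e)
    (hk : LinearMap.ker f ≤ LinearMap.ker g) (hr : LinearMap.range g ≤ LinearMap.range e) :
    Y →ₗ[K] W :=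
  (LinearEquiv.ofInjective e he).symm.toLinearMap ∘ₗ
    (((LinearMap.ker f).liftQ (g.codRestrict (LinearMap.range e)
        fun x => hr (LinearMap.mem_range_self g x))
      (fun x hx => by
        have h : g x = 0 := hk hx
        rw [LinearMap.mem_ker]
        exact Subtype.ext h)) ∘ₗ
      (f.quotKerEquivOfSurjective hf).symm.toLinearMap)

theorem induced_apply {X Y Z W : Type*} [AddCommGroup X] [Module K X] [AddCommGroup Y] [Module K Y]
    [AddCommGroup Z] [Module K Z] [AddCommGroup W] [Module K W]
    (f : X →ₗ[K] Y) (g : X →ₗ[K] Z) (e : W →ₗ[K] Z)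
    (hf : Function.Surjective f) (he : Function.Injective e)
    (hk : LinearMap.ker f ≤ LinearMap.ker g) (hr : LinearMap.range g ≤ LinearMap.range e) (x : X) :
    e (induced f g e hf he hk hr (f x)) = g x := by
  have h1 : (f.quotKerEquivOfSurjective hf).symm (f x) = Submodule.Quotient.mk x := by
    rw [LinearEquiv.symm_apply_eq]
    rfl
  have h2 : ∀ y : LinearMap.range e, e ((LinearEquiv.ofInjective e he).symm y) = y := fun y => by
    rw [← LinearEquiv.ofInjective_apply (f := e) (h := he), LinearEquiv.apply_symm_apply]
  simp only [induced, LinearMap.comp_apply, LinearEquiv.coe_coe, h1, h2]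
  rfl

theorem ker_map_mkQ_le {A B Z : Type*} [AddCommGroup A] [Module K A] [AddCommGroup B] [Module K B]
    [AddCommGroup Z] [Module K Z] (p : Submodule K A) (q : Submodule K B) (g : A ⊗[K] B →ₗ[K] Z)
    (h₁ : ∀ x ∈ p, ∀ y, g (x ⊗ₜ y) = 0) (h₂ : ∀ x, ∀ y ∈ q, g (x ⊗ₜ y) = 0) :
    LinearMap.ker (TensorProduct.map p.mkQ q.mkQ) ≤ LinearMap.ker g := by
  have key : TensorProduct.map p.mkQ q.mkQ
      = (TensorProduct.quotientTensorQuotientEquiv p q).symm.toLinearMap ∘ₗ Submodule.mkQ _ := by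
    ext x y
    rfl
  rw [key, LinearEquiv.ker_comp, Submodule.ker_mkQ, sup_le_iff]
  constructor
  · rintro _ ⟨t, rfl⟩
    induction t with
    | zero => simp
    | tmul x y => exact h₁ _ x.2 y
    | add a b ha hb => simpa using Submodule.add_mem _ ha hb
  · rintro _ ⟨t, rfl⟩
    induction t with
    | zero => simp
    | tmul x y => exact h₂ _ _ y.2
    | add a b ha hb => simpa using Submodule.add_mem _ ha hb

theorem ker_map_mkQ_eq {A : Type*} [AddCommGroup A] [Module K A] (p : Submodule K A) :
    LinearMap.ker (TensorProduct.map p.mkQ p.mkQ) = tens p ⊤ ⊔ tens ⊤ p := by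
  apply le_antisymm
  · have := ker_map_mkQ_le p p (tens p ⊤ ⊔ tens ⊤ p).mkQ
      (fun x hx y => by
        rw [Submodule.mkQ_apply, Submodule.Quotient.mk_eq_zero]
        exact Submodule.mem_sup_left ⟨⟨x, hx⟩ ⊗ₜ ⟨y, trivial⟩, rfl⟩)
      (fun x y hy => by
        rw [Submodule.mkQ_apply, Submodule.Quotient.mk_eq_zero]
        exact Submodule.mem_sup_right ⟨⟨x, trivial⟩ ⊗ₜ ⟨y, hy⟩, rfl⟩)
    rwa [Submodule.ker_mkQ] at this
  · rw [sup_le_iff]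
    constructor
    · rintro _ ⟨t, rfl⟩
      induction t with
      | zero => simp
      | tmul x y =>
        have hx : (Submodule.Quotient.mk (x : A) : A ⧸ p) = 0 :=
          (Submodule.Quotient.mk_eq_zero p).2 x.2
        simp [TensorProduct.mapIncl, hx]
      | add a b ha hb => simpa using Submodule.add_mem _ ha hb
    · rintro _ ⟨t, rfl⟩
      induction t with
      | zero => simp
      | tmul x y =>
        have hy : (Submodule.Quotient.mk (y : A) : A ⧸ p) = 0 :=
          (Submodule.Quotient.mk_eq_zero p).2 y.2
        simp [TensorProduct.mapIncl, hy]
      | add a b ha hb => simpa using Submodule.add_mem _ ha hb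

theorem map_mkQ_surjective {A B : Type*} [AddCommGroup A] [Module K A] [AddCommGroup B]
    [Module K B] (p : Submodule K A) (q : Submodule K B) :
    Function.Surjective (TensorProduct.map p.mkQ q.mkQ) :=
  TensorProduct.map_surjective (Submodule.mkQ_surjective p) (Submodule.mkQ_surjective q)

theorem tens_mono {A B : Type*} [AddCommGroup A] [Module K A] [AddCommGroup B] [Module K B]
    {X X' : Submodule K A} {Y Y' : Submodule K B} (h : X ≤ X') (h' : Y ≤ Y') :
    tens X Y ≤ tens X' Y' := by
  rintro _ ⟨t, rfl⟩
  induction t with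
  | zero => simp
  | tmul x y => exact ⟨⟨x, h x.2⟩ ⊗ₜ ⟨y, h' y.2⟩, rfl⟩
  | add a b ha hb => simpa using Submodule.add_mem _ ha hb

end LinearAlgebra

/-! ### Braidings and braided bialgebras -/

section Braided

variable {K : Type u} [Field K]

/-- `c₁ = c ⊗ A` on `A ⊗ A ⊗ A`. -/
def c₁ {A : Type v} [AddCommGroup A] [Module K A] (c : A ⊗[K] A →ₗ[K] A ⊗[K] A) :
    (A ⊗[K] A) ⊗[K] A →ₗ[K] (A ⊗[K] A) ⊗[K] A :=
  c.rTensor A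

/-- `c₂ = A ⊗ c` on `A ⊗ A ⊗ A`. -/
def c₂ {A : Type v} [AddCommGroup A] [Module K A] (c : A ⊗[K] A →ₗ[K] A ⊗[K] A) :
    (A ⊗[K] A) ⊗[K] A →ₗ[K] (A ⊗[K] A) ⊗[K] A :=
  (TensorProduct.assoc K A A A).symm.toLinearMap ∘ₗ c.lTensor A ∘ₗ
    (TensorProduct.assoc K A A A).toLinearMap

/-- The quantum Yang-Baxter equation; `(A, c)` is then a braided vector space. -/
def IsBraiding {A : Type v} [AddCommGroup A] [Module K A] (c : A ⊗[K] A →ₗ[K] A ⊗[K] A) : Prop :=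
  c₁ c ∘ₗ c₂ c ∘ₗ c₁ c = c₂ c ∘ₗ c₁ c ∘ₗ c₂ c

/-- `A ⊗ c ⊗ A` on `A ⊗ A ⊗ A ⊗ A`. -/
def cMid {A : Type v} [AddCommGroup A] [Module K A] (c : A ⊗[K] A →ₗ[K] A ⊗[K] A) :
    (A ⊗[K] A) ⊗[K] (A ⊗[K] A) →ₗ[K] (A ⊗[K] A) ⊗[K] (A ⊗[K] A) :=
  (TensorProduct.assoc K A A (A ⊗[K] A)).symm.toLinearMap ∘ₗ
    ((TensorProduct.assoc K A A A).toLinearMap ∘ₗ c.rTensor A ∘ₗ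
      (TensorProduct.assoc K A A A).symm.toLinearMap).lTensor A ∘ₗ
    (TensorProduct.assoc K A A (A ⊗[K] A)).toLinearMap

/-- The structure maps `(m, u, Δ, ε, c)` of a braided bialgebra on the vector space `A`, with the
unit map `u` given by the element `u(1)`. The axioms are `Data.IsBraidedBialgebra`. -/
structure Data (K : Type u) [Field K] (A : Type v) [AddCommGroup A] [Module K A] where
  mul : A ⊗[K] A →ₗ[K] A
  one : A
  comul : A →ₗ[K] A ⊗[K] A
  counit : A →ₗ[K] K
  braid : A ⊗[K] A →ₗ[K] A ⊗[K] A

namespace Data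

variable {A : Type v} [AddCommGroup A] [Module K A] (D : Data K A)

/-- Braided bialgebras: an associative unital algebra, a coassociative counital coalgebra and a
braiding, such that the braiding commutes with `m, u, Δ, ε`, and `Δ` and `ε` are multiplicative and
unital (where `A ⊗ A` has the multiplication `(m ⊗ m)(A ⊗ c ⊗ A)`). -/
structure IsBraidedBialgebra : Prop where
  mul_assoc : D.mul ∘ₗ D.mul.rTensor A
    = D.mul ∘ₗ D.mul.lTensor A ∘ₗ (TensorProduct.assoc K A A A).toLinearMap
  one_mul : ∀ x, D.mul (D.one ⊗ₜ x) = x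
  mul_one : ∀ x, D.mul (x ⊗ₜ D.one) = x
  coassoc : (TensorProduct.assoc K A A A).toLinearMap ∘ₗ D.comul.rTensor A ∘ₗ D.comul
    = D.comul.lTensor A ∘ₗ D.comul
  counit_comul : (TensorProduct.lid K A).toLinearMap ∘ₗ D.counit.rTensor A ∘ₗ D.comul
    = LinearMap.id
  comul_counit : (TensorProduct.rid K A).toLinearMap ∘ₗ D.counit.lTensor A ∘ₗ D.comul
    = LinearMap.id
  braiding : IsBraiding D.braid
  braid_mul_left : D.braid ∘ₗ D.mul.rTensor A
    = D.mul.lTensor A ∘ₗ (TensorProduct.assoc K A A A).toLinearMap ∘ₗ c₁ D.braid ∘ₗ c₂ D.braid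
  braid_mul_right : D.braid ∘ₗ D.mul.lTensor A ∘ₗ (TensorProduct.assoc K A A A).toLinearMap
    = D.mul.rTensor A ∘ₗ c₂ D.braid ∘ₗ c₁ D.braid
  braid_one_left : ∀ x, D.braid (D.one ⊗ₜ x) = x ⊗ₜ D.one
  braid_one_right : ∀ x, D.braid (x ⊗ₜ D.one) = D.one ⊗ₜ x
  comul_braid_left : D.comul.rTensor A ∘ₗ D.braid
    = c₂ D.braid ∘ₗ c₁ D.braid ∘ₗ (TensorProduct.assoc K A A A).symm.toLinearMap ∘ₗ
      D.comul.lTensor A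
  comul_braid_right :
    (TensorProduct.assoc K A A A).symm.toLinearMap ∘ₗ D.comul.lTensor A ∘ₗ D.braid
      = c₁ D.braid ∘ₗ c₂ D.braid ∘ₗ D.comul.rTensor A
  counit_braid_left : (TensorProduct.lid K A).toLinearMap ∘ₗ D.counit.rTensor A ∘ₗ D.braid
    = (TensorProduct.rid K A).toLinearMap ∘ₗ D.counit.lTensor A
  counit_braid_right : (TensorProduct.rid K A).toLinearMap ∘ₗ D.counit.lTensor A ∘ₗ D.braid
    = (TensorProduct.lid K A).toLinearMap ∘ₗ D.counit.rTensor A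
  comul_mul : D.comul ∘ₗ D.mul
    = TensorProduct.map D.mul D.mul ∘ₗ cMid D.braid ∘ₗ TensorProduct.map D.comul D.comul
  comul_one : D.comul D.one = D.one ⊗ₜ D.one
  counit_mul : ∀ x y, D.counit (D.mul (x ⊗ₜ y)) = D.counit x * D.counit y
  counit_one : D.counit D.one = 1

/-- Graded braided bialgebras: `A = ⨁ 𝒜 n`, and all the structure maps are graded. -/
structure IsGradedBraidedBialgebra (𝒜 : ℕ → Submodule K A) : Prop where
  isBraidedBialgebra : D.IsBraidedBialgebra
  isInternal : DirectSum.IsInternal 𝒜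
  mul_mem : ∀ i j, tens (𝒜 i) (𝒜 j) ≤ (𝒜 (i + j)).comap D.mul
  one_mem : D.one ∈ 𝒜 0
  comul_mem : ∀ n, 𝒜 n ≤
    (⨆ (p : ℕ × ℕ) (_ : p.1 + p.2 = n), tens (𝒜 p.1) (𝒜 p.2)).comap D.comul
  counit_eq_zero : ∀ n, n ≠ 0 → 𝒜 n ≤ LinearMap.ker D.counit
  braid_mem : ∀ i j, tens (𝒜 i) (𝒜 j) ≤ (tens (𝒜 j) (𝒜 i)).comap D.braid

/-- The linear map `f` is a morphism for all the structure maps. -/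
structure IsHom {B : Type w} [AddCommGroup B] [Module K B] (D : Data K A) (E : Data K B)
    (f : A →ₗ[K] B) : Prop where
  map_mul : f ∘ₗ D.mul = E.mul ∘ₗ TensorProduct.map f f
  map_one : f D.one = E.one
  map_comul : TensorProduct.map f f ∘ₗ D.comul = E.comul ∘ₗ f
  map_counit : E.counit ∘ₗ f = D.counit
  map_braid : TensorProduct.map f f ∘ₗ D.braid = E.braid ∘ₗ TensorProduct.map f f

/-- Morphisms of graded braided bialgebras. -/
structure IsGradedHom {B : Type w} [AddCommGroup B] [Module K B] (D : Data K A)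
    (𝒜 : ℕ → Submodule K A) (E : Data K B) (ℬ : ℕ → Submodule K B) (f : A →ₗ[K] B) : Prop where
  isHom : D.IsHom E f
  map_mem : ∀ n, 𝒜 n ≤ (ℬ n).comap f

/-- The space of primitive elements. -/
def primitives : Submodule K A :=
  LinearMap.eqLocus D.comul
    ((TensorProduct.mk K A A).flip D.one + TensorProduct.mk K A A D.one)

/-- The two-sided ideal generated by a set. -/
def idealSpan (S : Set A) : Submodule K A :=
  sInf {I | S ⊆ I ∧ ∀ a, ∀ x ∈ I, D.mul (a ⊗ₜ x) ∈ I ∧ D.mul (x ⊗ₜ a) ∈ I}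

/-- The subspaces `I` such that all the structure maps descend to `A ⧸ I`. -/
structure IsBiideal (I : Submodule K A) : Prop where
  mul_mem : tens I ⊤ ⊔ tens ⊤ I ≤ I.comap D.mul
  comul_mem : I ≤ (tens I ⊤ ⊔ tens ⊤ I).comap D.comul
  counit_mem : I ≤ LinearMap.ker D.counit
  braid_mem : tens I ⊤ ⊔ tens ⊤ I ≤ (tens I ⊤ ⊔ tens ⊤ I).comap D.braid

variable {D} in
/-- The structure induced on the quotient `A ⧸ I`. -/
def quot {I : Submodule K A} (h : D.IsBiideal I) : Data K (A ⧸ I) where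
  mul := induced (TensorProduct.map I.mkQ I.mkQ) (I.mkQ ∘ₗ D.mul) LinearMap.id
    (map_mkQ_surjective I I) Function.injective_id
    (by rw [ker_map_mkQ_eq, LinearMap.ker_comp, Submodule.ker_mkQ]; exact h.mul_mem)
    (by rw [LinearMap.range_id]; exact le_top)
  one := I.mkQ D.one
  comul := induced I.mkQ (TensorProduct.map I.mkQ I.mkQ ∘ₗ D.comul) LinearMap.id
    I.mkQ_surjective Function.injective_id
    (by rw [LinearMap.ker_comp, Submodule.ker_mkQ, ker_map_mkQ_eq]; exact h.comul_mem)
    (by rw [LinearMap.range_id]; exact le_top)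
  counit := I.liftQ D.counit h.counit_mem
  braid := induced (TensorProduct.map I.mkQ I.mkQ) (TensorProduct.map I.mkQ I.mkQ ∘ₗ D.braid)
    LinearMap.id (map_mkQ_surjective I I) Function.injective_id
    (by rw [LinearMap.ker_comp, ker_map_mkQ_eq]; exact h.braid_mem)
    (by rw [LinearMap.range_id]; exact le_top)

/-! ### The coradical filtration -/

/-- Subcoalgebras. -/
def IsSubcoalgebra (X : Submodule K A) : Prop := X ≤ (tens X X).comap D.comul

/-- Simple subcoalgebras. -/
def IsSimpleSubcoalgebra (X : Submodule K A) : Prop :=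
  D.IsSubcoalgebra X ∧ X ≠ ⊥ ∧ ∀ Y, D.IsSubcoalgebra Y → Y ≤ X → Y = ⊥ ∨ Y = X

/-- The coradical: the sum of all simple subcoalgebras. -/
def coradical : Submodule K A := sSup {X | D.IsSimpleSubcoalgebra X}

/-- The coradical filtration: `A₀` is the coradical, `Aₙ₊₁ = Δ⁻¹(A ⊗ Aₙ + A₀ ⊗ A)`. -/
def coradFil : ℕ → Submodule K A
  | 0 => D.coradical
  | n + 1 => (tens ⊤ (coradFil n) ⊔ tens D.coradical ⊤).comap D.comul

end Data

end Braided

/-! ### The graded braided bialgebra of a filtered braided bialgebra -/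

section Graded

variable {K : Type u} [Field K] {A : Type v} [AddCommGroup A] [Module K A]

/-- `F (n - 1)`, with `F (-1) = 0`. -/
def below (F : ℕ → Submodule K A) : ℕ → Submodule K A
  | 0 => ⊥
  | n + 1 => F n

/-- `F n / F (n - 1)`. -/
abbrev GrPiece (F : ℕ → Submodule K A) (n : ℕ) : Type v :=
  F n ⧸ (below F n).submoduleOf (F n)

/-- The associated graded space `⨁ n, F n / F (n - 1)`. -/
abbrev Gr (F : ℕ → Submodule K A) : Type v := ⨁ n, GrPiece F n

/-- The `n`-th graded component of the associated graded space. -/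
def grading (F : ℕ → Submodule K A) (n : ℕ) : Submodule K (Gr F) :=
  LinearMap.range (DirectSum.lof K ℕ (GrPiece F) n)

/-- The class in degree `n` of an element of `F n`. -/
def cls (F : ℕ → Submodule K A) (n : ℕ) : F n →ₗ[K] Gr F :=
  DirectSum.lof K ℕ (GrPiece F) n ∘ₗ Submodule.mkQ _

/-- The inclusion `F n / F (n - 1) → A / F (n - 1)`. -/
def toQ (F : ℕ → Submodule K A) (n : ℕ) : GrPiece F n →ₗ[K] A ⧸ below F n :=
  Submodule.mapQ _ _ (F n).subtype le_rfl

theorem toQ_injective (F : ℕ → Submodule K A) (n : ℕ) : Function.Injective (toQ F n) := by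
  rw [← LinearMap.ker_eq_bot]
  refine Submodule.ker_liftQ_eq_bot _ _ _ ?_
  rw [LinearMap.ker_comp, Submodule.ker_mkQ]
  rfl

theorem toQ_map_injective (F : ℕ → Submodule K A) (i j : ℕ) :
    Function.Injective (TensorProduct.map (toQ F i) (toQ F j)) :=
  TensorProduct.map_injective_of_flat_flat _ _ (toQ_injective F i) (toQ_injective F j)

theorem below_mono {F : ℕ → Submodule K A} (hF : Monotone F) {i n : ℕ} (h : i < n) :
    F i ≤ below F n := by
  cases n with
  | zero => omega
  | succ n => exact hF (by omega)

theorem map_mkQ_tens_le (F : ℕ → Submodule K A) (i j : ℕ) :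
    tens (F i) (F j) ≤ (LinearMap.range (TensorProduct.map (toQ F i) (toQ F j))).comap
      (TensorProduct.map (below F i).mkQ (below F j).mkQ) := by
  rintro _ ⟨t, rfl⟩
  induction t with
  | zero => simp
  | tmul x y => exact ⟨Submodule.Quotient.mk x ⊗ₜ Submodule.Quotient.mk y, rfl⟩
  | add a b ha hb => simpa only [map_add] using Submodule.add_mem _ ha hb

theorem map_mkQ_tens_eq_zero (F : ℕ → Submodule K A) (i j : ℕ) (X Y : Submodule K A)
    (h : X ≤ below F i ∨ Y ≤ below F j) :
    tens X Y ≤ LinearMap.ker (TensorProduct.map (below F i).mkQ (below F j).mkQ) := by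
  rintro _ ⟨t, rfl⟩
  induction t with
  | zero => simp
  | tmul x y =>
    rcases h with h | h
    · have hx := (Submodule.Quotient.mk_eq_zero (below F i)).2 (h x.2)
      simp [TensorProduct.mapIncl, hx]
    · have hy := (Submodule.Quotient.mk_eq_zero (below F j)).2 (h y.2)
      simp [TensorProduct.mapIncl, hy]
  | add a b ha hb => simpa using Submodule.add_mem _ ha hb

/-- `F` makes `(A, D)` into a filtered braided bialgebra with `F 0 = K`. -/
structure IsConnectedFiltered (D : Data K A) (F : ℕ → Submodule K A) : Prop where
  isBraidedBialgebra : D.IsBraidedBialgebra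
  mono : Monotone F
  exhaustive : ⨆ n, F n = ⊤
  zero_eq : F 0 = K ∙ D.one
  mul_mem : ∀ i j, tens (F i) (F j) ≤ (F (i + j)).comap D.mul
  comul_mem : ∀ n, F n ≤ (⨆ (p : ℕ × ℕ) (_ : p.1 + p.2 = n), tens (F p.1) (F p.2)).comap D.comul
  braid_mem : ∀ i j, tens (F i) (F j) ≤ (tens (F j) (F i)).comap D.braid

namespace IsConnectedFiltered

variable {D : Data K A} {F : ℕ → Submodule K A}

theorem one_mem (h : IsConnectedFiltered D F) : D.one ∈ F 0 := by
  rw [h.zero_eq]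
  exact Submodule.mem_span_singleton_self _

theorem mul_tmul_mem (h : IsConnectedFiltered D F) {i j : ℕ} {x y : A} (hx : x ∈ F i) (hy : y ∈ F j) :
    D.mul (x ⊗ₜ y) ∈ F (i + j) :=
  h.mul_mem i j ⟨⟨x, hx⟩ ⊗ₜ ⟨y, hy⟩, rfl⟩

theorem braid_tmul_mem (h : IsConnectedFiltered D F) {i j : ℕ} {x y : A} (hx : x ∈ F i) (hy : y ∈ F j) :
    D.braid (x ⊗ₜ y) ∈ tens (F j) (F i) :=
  h.braid_mem i j ⟨⟨x, hx⟩ ⊗ₜ ⟨y, hy⟩, rfl⟩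

theorem mul_below_left (h : IsConnectedFiltered D F) {i j : ℕ} {x y : A} (hx : x ∈ below F i) (hy : y ∈ F j) :
    D.mul (x ⊗ₜ y) ∈ below F (i + j) := by
  cases i with
  | zero =>
    have : x = 0 := hx
    simp [this]
  | succ i => exact below_mono h.mono (by omega) (h.mul_tmul_mem (i := i) hx hy)

theorem mul_below_right (h : IsConnectedFiltered D F) {i j : ℕ} {x y : A} (hx : x ∈ F i) (hy : y ∈ below F j) :
    D.mul (x ⊗ₜ y) ∈ below F (i + j) := by
  cases j with
  | zero =>
    have : y = 0 := hy
    simp [this]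
  | succ j => exact below_mono h.mono (by omega) (h.mul_tmul_mem (j := j) hx hy)

theorem braid_below_left (h : IsConnectedFiltered D F) {i j : ℕ} {x y : A} (hx : x ∈ below F i) (hy : y ∈ F j) :
    TensorProduct.map (below F j).mkQ (below F i).mkQ (D.braid (x ⊗ₜ y)) = 0 := by
  cases i with
  | zero =>
    have : x = 0 := hx
    simp [this]
  | succ i => exact map_mkQ_tens_eq_zero F j (i + 1) _ _ (Or.inr le_rfl) (h.braid_tmul_mem hx hy)

theorem braid_below_right (h : IsConnectedFiltered D F) {i j : ℕ} {x y : A} (hx : x ∈ F i) (hy : y ∈ below F j) :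
    TensorProduct.map (below F j).mkQ (below F i).mkQ (D.braid (x ⊗ₜ y)) = 0 := by
  cases j with
  | zero =>
    have : y = 0 := hy
    simp [this]
  | succ j => exact map_mkQ_tens_eq_zero F (j + 1) i _ _ (Or.inl le_rfl) (h.braid_tmul_mem hx hy)

theorem comul_range (h : IsConnectedFiltered D F) {i j n : ℕ} (hn : i + j = n) {x : A} (hx : x ∈ F n) :
    TensorProduct.map (below F i).mkQ (below F j).mkQ (D.comul x)
      ∈ LinearMap.range (TensorProduct.map (toQ F i) (toQ F j)) := by
  refine (iSup₂_le ?_ : _ ≤ (LinearMap.range (TensorProduct.map (toQ F i) (toQ F j))).comap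
    (TensorProduct.map (below F i).mkQ (below F j).mkQ)) (h.comul_mem n hx)
  rintro ⟨a, b⟩ hab
  simp only at hab
  rcases lt_trichotomy a i with ha | ha | ha
  · exact (map_mkQ_tens_eq_zero F i j _ _ (Or.inl (below_mono h.mono ha))).trans
      (fun z hz => by
        rw [Submodule.mem_comap, LinearMap.mem_ker.1 hz]
        exact Submodule.zero_mem _)
  · obtain rfl := ha
    obtain rfl : b = j := by omega
    exact map_mkQ_tens_le F a b
  · exact (map_mkQ_tens_eq_zero F i j _ _ (Or.inr (below_mono h.mono (by omega)))).trans
      (fun z hz => by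
        rw [Submodule.mem_comap, LinearMap.mem_ker.1 hz]
        exact Submodule.zero_mem _)

theorem comul_below (h : IsConnectedFiltered D F) {i j n : ℕ} (hn : i + j = n) {x : A} (hx : x ∈ below F n) :
    TensorProduct.map (below F i).mkQ (below F j).mkQ (D.comul x) = 0 := by
  cases n with
  | zero =>
    have : x = 0 := hx
    simp [this]
  | succ n =>
    refine (iSup₂_le ?_ : _ ≤ LinearMap.ker
      (TensorProduct.map (below F i).mkQ (below F j).mkQ)) (h.comul_mem n hx)
    rintro ⟨a, b⟩ hab
    simp only at hab
    refine map_mkQ_tens_eq_zero F i j _ _ ?_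
    rcases lt_or_ge a i with ha | ha
    · exact Or.inl (below_mono h.mono ha)
    · exact Or.inr (below_mono h.mono (by omega))

/-- `Gⁱ ⊗ Gʲ → Gⁱ⁺ʲ`, induced by the multiplication. -/
def grMul (h : IsConnectedFiltered D F) (i j : ℕ) : GrPiece F i ⊗[K] GrPiece F j →ₗ[K] GrPiece F (i + j) :=
  induced (TensorProduct.map ((below F i).submoduleOf (F i)).mkQ
      ((below F j).submoduleOf (F j)).mkQ)
    ((below F (i + j)).mkQ ∘ₗ D.mul ∘ₗ TensorProduct.mapIncl (F i) (F j)) (toQ F (i + j))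
    (map_mkQ_surjective _ _) (toQ_injective F _)
    (ker_map_mkQ_le _ _ _
      (fun _ hx y => (Submodule.Quotient.mk_eq_zero _).2 (h.mul_below_left hx y.2))
      (fun x _ hy => (Submodule.Quotient.mk_eq_zero _).2 (h.mul_below_right x.2 hy)))
    (by
      rintro _ ⟨t, rfl⟩
      exact ⟨Submodule.Quotient.mk ⟨_, h.mul_mem i j ⟨t, rfl⟩⟩, rfl⟩)

theorem braid_ker (h : IsConnectedFiltered D F) (i j : ℕ) :
    LinearMap.ker (TensorProduct.map ((below F i).submoduleOf (F i)).mkQ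
      ((below F j).submoduleOf (F j)).mkQ) ≤
    LinearMap.ker (TensorProduct.map (below F j).mkQ (below F i).mkQ ∘ₗ D.braid ∘ₗ
      TensorProduct.mapIncl (F i) (F j)) := by
  apply ker_map_mkQ_le
  · intro x hx y
    rw [LinearMap.comp_apply, LinearMap.comp_apply, TensorProduct.mapIncl,
      TensorProduct.map_tmul]
    exact h.braid_below_left hx y.2
  · intro x y hy
    rw [LinearMap.comp_apply, LinearMap.comp_apply, TensorProduct.mapIncl,
      TensorProduct.map_tmul]
    exact h.braid_below_right x.2 hy

theorem braid_range (h : IsConnectedFiltered D F) (i j : ℕ) :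
    LinearMap.range (TensorProduct.map (below F j).mkQ (below F i).mkQ ∘ₗ D.braid ∘ₗ
      TensorProduct.mapIncl (F i) (F j)) ≤
    LinearMap.range (TensorProduct.map (toQ F j) (toQ F i)) := by
  rintro _ ⟨t, rfl⟩
  exact map_mkQ_tens_le F j i (h.braid_mem i j (LinearMap.mem_range_self _ t))

/-- `Gⁱ ⊗ Gʲ → Gʲ ⊗ Gⁱ`, induced by the braiding. -/
def grBraid (h : IsConnectedFiltered D F) (i j : ℕ) : GrPiece F i ⊗[K] GrPiece F j →ₗ[K] GrPiece F j ⊗[K] GrPiece F i :=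
  induced (TensorProduct.map ((below F i).submoduleOf (F i)).mkQ
      ((below F j).submoduleOf (F j)).mkQ)
    (TensorProduct.map (below F j).mkQ (below F i).mkQ ∘ₗ D.braid ∘ₗ
      TensorProduct.mapIncl (F i) (F j))
    (TensorProduct.map (toQ F j) (toQ F i))
    (map_mkQ_surjective _ _) (toQ_map_injective F _ _)
    (h.braid_ker i j)
    (h.braid_range i j)

/-- `Gⁿ → Gⁱ ⊗ Gʲ` for `i + j = n`, induced by the comultiplication. -/
def grComul (h : IsConnectedFiltered D F) {i j n : ℕ} (hn : i + j = n) :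
    GrPiece F n →ₗ[K] GrPiece F i ⊗[K] GrPiece F j :=
  induced (Submodule.mkQ _)
    (TensorProduct.map (below F i).mkQ (below F j).mkQ ∘ₗ D.comul ∘ₗ (F n).subtype)
    (TensorProduct.map (toQ F i) (toQ F j))
    (Submodule.mkQ_surjective _) (toQ_map_injective F _ _)
    (by
      intro x hx
      rw [Submodule.ker_mkQ] at hx
      exact h.comul_below hn hx)
    (by
      rintro _ ⟨x, rfl⟩
      exact h.comul_range hn x.2)

/-- The structure maps induced by those of `A` on the associated graded space. -/
def gr (h : IsConnectedFiltered D F) : Data K (Gr F) where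
  mul := TensorProduct.lift (DirectSum.toModule K ℕ _ fun i => LinearMap.flip
    (DirectSum.toModule K ℕ _ fun j => LinearMap.flip
      (TensorProduct.curry (DirectSum.lof K ℕ (GrPiece F) (i + j) ∘ₗ h.grMul i j))))
  one := cls F 0 ⟨D.one, h.one_mem⟩
  comul := DirectSum.toModule K ℕ _ fun n =>
    ∑ p ∈ (Finset.HasAntidiagonal.antidiagonal n).attach,
      TensorProduct.map (DirectSum.lof K ℕ (GrPiece F) p.1.1)
        (DirectSum.lof K ℕ (GrPiece F) p.1.2) ∘ₗ
        h.grComul (Finset.HasAntidiagonal.mem_antidiagonal.1 p.2)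
  counit := D.counit ∘ₗ (F 0).subtype ∘ₗ
    (Submodule.quotEquivOfEqBot ((below F 0).submoduleOf (F 0))
      (by rw [Submodule.submoduleOf, below, ← LinearMap.ker, Submodule.ker_subtype])).toLinearMap ∘ₗ
    DirectSum.component K ℕ (GrPiece F) 0
  braid := TensorProduct.lift (DirectSum.toModule K ℕ _ fun i => LinearMap.flip
    (DirectSum.toModule K ℕ _ fun j => LinearMap.flip
      (TensorProduct.curry (TensorProduct.map (DirectSum.lof K ℕ (GrPiece F) j)
        (DirectSum.lof K ℕ (GrPiece F) i) ∘ₗ h.grBraid i j))))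

end IsConnectedFiltered

/-- For filtrations `F ≤ F'` of `A`, the map of associated graded spaces induced by the
identity of `A`. -/
def grOfLE {F F' : ℕ → Submodule K A} (h : ∀ n, F n ≤ F' n) : Gr F →ₗ[K] Gr F' :=
  DirectSum.lmap fun n => Submodule.mapQ _ _ (Submodule.inclusion (h n)) (by
    intro x hx
    cases n with
    | zero => exact hx
    | succ n => exact h n hx)

end Graded

/-! ### The braided tensor algebra -/

section Tensor

variable {K : Type u} [Field K] {V : Type v} [AddCommGroup V] [Module K V]

/-- `V^{⊗ n}` inside the tensor algebra. -/
def tPow (K : Type u) [Field K] (V : Type v) [AddCommGroup V] [Module K V] (n : ℕ) :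
    Submodule K (TensorAlgebra K V) :=
  LinearMap.range (TensorAlgebra.ι K : V →ₗ[K] TensorAlgebra K V) ^ n

variable (c : V ⊗[K] V →ₗ[K] V ⊗[K] V)

/-- The right action of `T(V)` on `T(V) ⊗ V` for which
`(t ⊗ v) · w = ∑ t w' ⊗ v'` if `c (v ⊗ w) = ∑ w' ⊗ v'`. -/
def braidAct : TensorAlgebra K V →ₐ[K] (Module.End K (TensorAlgebra K V ⊗[K] V))ᵐᵒᵖ :=
  TensorAlgebra.lift K ((MulOpposite.opLinearEquiv K).toLinearMap ∘ₗ
    (TensorProduct.curry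
      ((LinearMap.mul' K (TensorAlgebra K V) ∘ₗ (TensorAlgebra.ι K).lTensor _).rTensor V ∘ₗ
        (TensorProduct.assoc K (TensorAlgebra K V) V V).symm.toLinearMap ∘ₗ
        c.lTensor (TensorAlgebra K V) ∘ₗ
        (TensorProduct.assoc K (TensorAlgebra K V) V V).toLinearMap)).flip)

/-- The component `V ⊗ T(V) → T(V) ⊗ V` of the braiding of `T(V)`: the vector `v` passes all the
factors of a tensor by means of `c`, from left to right. -/
def braidVT : V ⊗[K] TensorAlgebra K V →ₗ[K] TensorAlgebra K V ⊗[K] V :=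
  TensorProduct.lift (LinearMap.flip
    (LinearMap.lcomp K (TensorAlgebra K V ⊗[K] V) (TensorProduct.mk K (TensorAlgebra K V) V 1) ∘ₗ
      (MulOpposite.opLinearEquiv K).symm.toLinearMap ∘ₗ (braidAct c).toLinearMap))

/-- The left action of `T(V)` on `T(V) ⊗ T(V)` for which
`v · (z ⊗ t) = ∑ z' ⊗ v' t` if `v ⊗ z` is mapped to `∑ z' ⊗ v'` by `braidVT`. -/
def braidAct' : TensorAlgebra K V →ₐ[K]
    Module.End K (TensorAlgebra K V ⊗[K] TensorAlgebra K V) :=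
  TensorAlgebra.lift K (TensorProduct.curry
    ((LinearMap.mul' K (TensorAlgebra K V) ∘ₗ (TensorAlgebra.ι K).rTensor _).lTensor
        (TensorAlgebra K V) ∘ₗ
      (TensorProduct.assoc K (TensorAlgebra K V) V (TensorAlgebra K V)).toLinearMap ∘ₗ
      (braidVT c).rTensor (TensorAlgebra K V) ∘ₗ
      (TensorProduct.assoc K V (TensorAlgebra K V) (TensorAlgebra K V)).symm.toLinearMap))

/-- The braiding of `T(V)`: in `x ⊗ z`, each factor of `x`, beginning with the last one, passes
all the factors of `z` by means of `c`. -/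
def braidT : TensorAlgebra K V ⊗[K] TensorAlgebra K V →ₗ[K]
    TensorAlgebra K V ⊗[K] TensorAlgebra K V :=
  TensorProduct.lift ((braidAct' c).toLinearMap.compl₂
    ((TensorProduct.mk K (TensorAlgebra K V) (TensorAlgebra K V)).flip 1))

/-- The multiplication `(m ⊗ m)(T ⊗ c_T ⊗ T)` of `T(V) ⊗ T(V)`. -/
def mulTT : (TensorAlgebra K V ⊗[K] TensorAlgebra K V) ⊗[K]
      (TensorAlgebra K V ⊗[K] TensorAlgebra K V) →ₗ[K]
    TensorAlgebra K V ⊗[K] TensorAlgebra K V :=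
  TensorProduct.map (LinearMap.mul' K _) (LinearMap.mul' K _) ∘ₗ cMid (braidT c)

/-- The comultiplication of `T(V)`: the unital map, multiplicative for `mulTT`, with
`v ↦ v ⊗ 1 + 1 ⊗ v` on `V`; it is written through the left multiplications
by the elements `v ⊗ 1 + 1 ⊗ v`. -/
def comulT : TensorAlgebra K V →ₗ[K] TensorAlgebra K V ⊗[K] TensorAlgebra K V :=
  (TensorAlgebra.lift K (TensorProduct.curry (mulTT c) ∘ₗ
      ((TensorProduct.mk K (TensorAlgebra K V) (TensorAlgebra K V)).flip 1 +
        TensorProduct.mk K (TensorAlgebra K V) (TensorAlgebra K V) 1) ∘ₗ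
      TensorAlgebra.ι K) :
    TensorAlgebra K V →ₐ[K]
      Module.End K (TensorAlgebra K V ⊗[K] TensorAlgebra K V)).toLinearMap.flip (1 ⊗ₜ 1)

/-- The braided tensor algebra `T(V, c)`. -/
def tensorData : Data K (TensorAlgebra K V) where
  mul := LinearMap.mul' K _
  one := 1
  comul := comulT c
  counit := (TensorAlgebra.lift K (0 : V →ₗ[K] K)).toLinearMap
  braid := braidT c

/-! ### The Nichols algebra -/

/-- The kernel of `T(V, c) → S^{[n]}`. One has `S^{[0]} = T(V, c)`, and `S^{[n+1]}` is the quotient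
of `S^{[n]}` by the ideal generated by the homogeneous primitive elements of degree at least two:
these are the classes in `S^{[n]}` of the `z` below, since the comultiplication of `S^{[n]}` is
induced by that of `T(V, c)`. -/
def symIdeal : ℕ → Submodule K (TensorAlgebra K V)
  | 0 => ⊥
  | n + 1 => (tensorData c).idealSpan (symIdeal n ∪
      {z | ∃ k, 2 ≤ k ∧ z ∈ tPow K V k ∧
        TensorProduct.map (symIdeal n).mkQ (symIdeal n).mkQ ((tensorData c).comul z)
          = (symIdeal n).mkQ z ⊗ₜ (symIdeal n).mkQ 1 + (symIdeal n).mkQ 1 ⊗ₜ (symIdeal n).mkQ z})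

/-- The kernel of the projection `Ω` of `T(V, c)` onto the Nichols algebra, the limit of the
`S^{[n]}`. -/
def nicholsIdeal : Submodule K (TensorAlgebra K V) := ⨆ n, symIdeal c n

/-- The canonical projection `Ω` of `T(V, c)` onto the Nichols algebra `ℬ(V, c)`. -/
def omega : TensorAlgebra K V →ₗ[K] TensorAlgebra K V ⧸ nicholsIdeal c := (nicholsIdeal c).mkQ

/-- The grading of the Nichols algebra. -/
def nicholsGrading (n : ℕ) : Submodule K (TensorAlgebra K V ⧸ nicholsIdeal c) :=
  (tPow K V n).map (omega c)

/-- For a filtration `F` of `A` and `p : T(V) → A`, the map `f : T(V) → ⨁ F n / F (n - 1)` lifts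
the map `v ↦ p v + F 0` from `V` to `F 1 / F 0`. -/
def Lifts {A : Type w} [AddCommGroup A] [Module K A] (F : ℕ → Submodule K A)
    (p : TensorAlgebra K V →ₗ[K] A) (f : TensorAlgebra K V →ₗ[K] Gr F) : Prop :=
  ∀ v, ∃ hv : p (TensorAlgebra.ι K v) ∈ F 1,
    f (TensorAlgebra.ι K v) = cls F 1 ⟨p (TensorAlgebra.ι K v), hv⟩

/-! ### Brackets and universal enveloping algebras -/

/-- `r : X ⊗ Y → Y ⊗ X` is the restriction of the braiding `c`. -/
def IsRestriction {A : Type w} [AddCommGroup A] [Module K A] (c : A ⊗[K] A →ₗ[K] A ⊗[K] A)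
    (X Y : Submodule K A) (r : X ⊗[K] Y →ₗ[K] Y ⊗[K] X) : Prop :=
  TensorProduct.mapIncl Y X ∘ₗ r = c ∘ₗ TensorProduct.mapIncl X Y

/-- The canonical map `V → T(V) / I`. -/
def iota (I : Submodule K (TensorAlgebra K V)) : V →ₗ[K] TensorAlgebra K V ⧸ I :=
  I.mkQ ∘ₗ TensorAlgebra.ι K

/-- A bracket for `(V, c)`. The braided bialgebra `U^{[n]}` is the quotient of `T(V, c)` by
`ideal n`, and `i^{[n]} : V → U^{[n]}` is `iota (ideal n)`, with image `V^{[n]}`. -/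
structure BraidedBracket where
  /-- The kernel of `T(V, c) → U^{[n]}`. -/
  ideal : ℕ → Submodule K (TensorAlgebra K V)
  isBiideal : ∀ n, (tensorData c).IsBiideal (ideal n)
  /-- The map `b^{[n]} : P(U^{[n]}) → V`. -/
  b : ∀ n, (Data.quot (isBiideal n)).primitives →ₗ[K] V
  ideal_zero : ideal 0 = ⊥
  bracket_left : ∀ n, ∃ cVV cPV,
    IsRestriction (Data.quot (isBiideal n)).braid
      (LinearMap.range (iota (ideal n))) (LinearMap.range (iota (ideal n))) cVV ∧
    IsRestriction (Data.quot (isBiideal n)).braid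
      (Data.quot (isBiideal n)).primitives (LinearMap.range (iota (ideal n))) cPV ∧
    cVV ∘ₗ ((iota (ideal n)).rangeRestrict ∘ₗ b n).rTensor _
      = ((iota (ideal n)).rangeRestrict ∘ₗ b n).lTensor _ ∘ₗ cPV
  bracket_right : ∀ n, ∃ cVV cVP,
    IsRestriction (Data.quot (isBiideal n)).braid
      (LinearMap.range (iota (ideal n))) (LinearMap.range (iota (ideal n))) cVV ∧
    IsRestriction (Data.quot (isBiideal n)).braid
      (LinearMap.range (iota (ideal n))) (Data.quot (isBiideal n)).primitives cVP ∧
    cVV ∘ₗ ((iota (ideal n)).rangeRestrict ∘ₗ b n).lTensor _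
      = ((iota (ideal n)).rangeRestrict ∘ₗ b n).rTensor _ ∘ₗ cVP
  /-- `U^{[n+1]}` is the quotient of `U^{[n]}` by the ideal generated by the elements
  `z - i^{[n]} (b^{[n]} z)`, where `z` runs over the primitive elements of `U^{[n]}`. -/
  ideal_succ : ∀ n, ideal (n + 1) = Submodule.comap (ideal n).mkQ
    ((Data.quot (isBiideal n)).idealSpan
      {y | ∃ z : (Data.quot (isBiideal n)).primitives, y = z - iota (ideal n) (b n z)})

end Tensor

namespace BraidedBracket

variable {K : Type u} [Field K] {V : Type v} [AddCommGroup V] [Module K V]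
  {c : V ⊗[K] V →ₗ[K] V ⊗[K] V} (b : BraidedBracket c)

/-- The kernel of `π_U : T(V, c) → U(V, c, b)`. -/
def limIdeal : Submodule K (TensorAlgebra K V) := ⨆ n, b.ideal n

theorem isBiideal_limIdeal : (tensorData c).IsBiideal b.limIdeal := by
  have hle : ∀ n, b.ideal n ≤ b.limIdeal := fun n => le_iSup b.ideal n
  have hN : ∀ n, tens (b.ideal n) ⊤ ⊔ tens ⊤ (b.ideal n) ≤
      tens b.limIdeal ⊤ ⊔ tens ⊤ b.limIdeal := fun n =>
    sup_le_sup (tens_mono (hle n) le_rfl) (tens_mono le_rfl (hle n))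
  have key : ∀ W : Submodule K (TensorAlgebra K V ⊗[K] TensorAlgebra K V),
      (∀ n, tens (b.ideal n) ⊤ ⊔ tens ⊤ (b.ideal n) ≤ W) →
      tens b.limIdeal ⊤ ⊔ tens ⊤ b.limIdeal ≤ W := by
    intro W hW
    have h1 : ∀ y, b.limIdeal ≤ W.comap ((TensorProduct.mk K _ _).flip y) := fun y =>
      iSup_le fun n x hx => hW n (Submodule.mem_sup_left ⟨⟨x, hx⟩ ⊗ₜ ⟨y, trivial⟩, rfl⟩)
    have h2 : ∀ y, b.limIdeal ≤ W.comap (TensorProduct.mk K _ _ y) := fun y =>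
      iSup_le fun n x hx => hW n (Submodule.mem_sup_right ⟨⟨y, trivial⟩ ⊗ₜ ⟨x, hx⟩, rfl⟩)
    rw [sup_le_iff]
    constructor
    · rintro _ ⟨t, rfl⟩
      induction t with
      | zero => simp
      | tmul x y => exact h1 _ x.2
      | add a b ha hb => simpa using Submodule.add_mem _ ha hb
    · rintro _ ⟨t, rfl⟩
      induction t with
      | zero => simp
      | tmul x y => exact h2 _ y.2
      | add a b ha hb => simpa using Submodule.add_mem _ ha hb
  refine ⟨key _ fun n => ?_, iSup_le fun n => ?_, iSup_le fun n => ?_, key _ fun n => ?_⟩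
  · exact (b.isBiideal n).mul_mem.trans (Submodule.comap_mono (hle n))
  · exact (b.isBiideal n).comul_mem.trans (Submodule.comap_mono (hN n))
  · exact (b.isBiideal n).counit_mem
  · exact (b.isBiideal n).braid_mem.trans (Submodule.comap_mono (hN n))

/-- The underlying space of the universal enveloping algebra `U(V, c, b)`, the limit of the
successive quotients `U^{[n]}` of `T(V, c)`. -/
def U : Type (max u v) := TensorAlgebra K V ⧸ b.limIdeal

instance : AddCommGroup b.U := inferInstanceAs (AddCommGroup (TensorAlgebra K V ⧸ b.limIdeal))

instance : Module K b.U := inferInstanceAs (Module K (TensorAlgebra K V ⧸ b.limIdeal))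

/-- The structure maps of `U(V, c, b)`. -/
def dataU : Data K b.U := Data.quot b.isBiideal_limIdeal

/-- The canonical projection `π_U : T(V, c) → U(V, c, b)`. -/
def piU : TensorAlgebra K V →ₗ[K] b.U := b.limIdeal.mkQ

/-- The canonical map `i_U : V → U(V, c, b)`. -/
def iU : V →ₗ[K] b.U := iota b.limIdeal

/-- The standard filtration: `U_(n)` is the image of the sum of the `V^{⊗ i}` with `i ≤ n`. -/
def stdFil (n : ℕ) : Submodule K b.U := (⨆ (i : ℕ) (_ : i ≤ n), tPow K V i).map b.piU

/-- The coradical filtration `U_n`. -/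
def coradFil : ℕ → Submodule K b.U := b.dataU.coradFil

/-- `(V, c, b)` is a braided Lie algebra. -/
structure IsBraidedLieAlgebra : Prop where
  isBraiding : IsBraiding c
  injective : Function.Injective b.iU

end BraidedBracket

end BraidedLie

end

open BraidedLie

open scoped TensorProduct DirectSum

noncomputable section

namespace BraidedLie

universe u v

/-! Let p be π_U. For a filtration F of U compatible with the structure maps, a tensor x of degree n
with p(x) in F n has a symbol, the class of p(x) in F n / F (n - 1). Taking symbols is a morphism of
graded braided bialgebras from T(V, c) to the associated graded space (`symbolMap`,
`isGradedHom_symbolMap`). For the standard filtration this is ϑ_U, for the coradical filtration it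
is ξ_U ϑ_U. Uniqueness holds because V generates T(V, c).

Part (c) is the equality of the kernels of ξ_U ϑ_U and Ω (`ker_symbolMap_coradFil`). In gr U no
nonzero homogeneous element of degree at least two is primitive: the component of its coproduct in
bidegree (1, n - 1) already detects whether an element of U_n lies in U_{n-1}, by the definition of
the coradical filtration (`cls_eq_zero_of_primitive`). Hence every stage of the Nichols construction
is killed. Conversely, ξ_U ϑ_U is injective on V, since π_U is injective there and V meets the
coradical trivially because the counit vanishes on V. By induction on the degree, the reduced
coproduct of a homogeneous element of the kernel vanishes modulo the Nichols ideal, so the element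
is primitive at some finite stage and dies at the next (`ker_le_nicholsIdeal`). The equality also
yields that ker Ω is a biideal and that the Nichols algebra is graded, as it embeds into gr U.

Three ingredients support this. The axioms pass to quotients and associated graded spaces by one
principle: both sides of an axiom on A have symbols, and the symbols span and are well defined, so
the axiom holds for them (`Compat.unique`, `Data.Symbol.isBraidedBialgebra`). That T(V, c) is a
braided bialgebra is proved by a strand calculus, with induction on one tensor factor at a time
(`isBraidedBialgebra_tensorData`). Finally, since the standard filtration starts with K, every
nonzero subcoalgebra of U contains 1; so the coradical is K, and coassociativity, the compatibility
of Δ with the braiding, and the multiplicativity of Δ make the coradical filtration compatible with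
everything (`IsConnectedFiltered.isConnectedFiltered_coradFil`). -/

/-! ### Symbol relations -/

section Symbols

variable {K : Type u} [Field K]
variable {A B C A' B' C' G H L G' H' L' : Type*}
  [AddCommGroup A] [Module K A] [AddCommGroup B] [Module K B] [AddCommGroup C] [Module K C]
  [AddCommGroup A'] [Module K A'] [AddCommGroup B'] [Module K B'] [AddCommGroup C'] [Module K C']
  [AddCommGroup G] [Module K G] [AddCommGroup H] [Module K H] [AddCommGroup L] [Module K L]
  [AddCommGroup G'] [Module K G'] [AddCommGroup H'] [Module K H'] [AddCommGroup L'] [Module K L']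

/-- A symbol relation between `A` and `G`: in each degree `n`, a linear relation between elements
of `A` and their symbols of degree `n` in `G`. -/
abbrev SymRel (K A G : Type*) [Field K] [AddCommGroup A] [Module K A] [AddCommGroup G]
    [Module K G] := ℕ → Submodule K (A × G)

namespace SymRel

/-- The symbol relation on a tensor product. -/
def tensor (S : SymRel K A G) (S' : SymRel K B H) : SymRel K (A ⊗[K] B) (G ⊗[K] H) := fun n =>
  Submodule.span K {p | ∃ i j x s y t, i + j = n ∧ (x, s) ∈ S i ∧ (y, t) ∈ S' j ∧
    p = (x ⊗ₜ[K] y, s ⊗ₜ[K] t)}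

/-- The symbol relation concentrated in degree zero given by the graph of a linear map. -/
def ofMap (p : A →ₗ[K] G) : SymRel K A G
  | 0 => LinearMap.range (LinearMap.id.prod p)
  | _ + 1 => LinearMap.range (LinearMap.id.prod 0)

/-- The symbol relation on the ground field. -/
abbrev scalar (K : Type*) [Field K] : SymRel K K K := ofMap LinearMap.id

/-- The maps `f` and `g` are compatible with the symbol relations. -/
def Compat (f : A →ₗ[K] B) (g : G →ₗ[K] H) (S : SymRel K A G) (S' : SymRel K B H) : Prop :=
  ∀ n x s, (x, s) ∈ S n → (f x, g s) ∈ S' n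

/-- The symbols of degree `n` are given by a linear map which vanishes in lower degrees. -/
def Good (S : SymRel K A G) : Prop :=
  ∃ σ : ℕ → A →ₗ[K] G, ∀ n x s, (x, s) ∈ S n → σ n x = s ∧ ∀ m, n < m → σ m x = 0

/-- The symbols span the target. -/
def Spans (S : SymRel K A G) : Prop :=
  Submodule.span K {s | ∃ n x, (x, s) ∈ S n} = ⊤

/-- Elements having a symbol have symbol zero in higher degrees. -/
def Mono (S : SymRel K A G) : Prop :=
  ∀ n m x s, n < m → (x, s) ∈ S n → (x, (0 : G)) ∈ S m

theorem tmul_mem {S : SymRel K A G} {S' : SymRel K B H} {i j n : ℕ} (hn : i + j = n)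
    {x : A} {s : G} {y : B} {t : H} (hx : (x, s) ∈ S i) (hy : (y, t) ∈ S' j) :
    (x ⊗ₜ[K] y, s ⊗ₜ[K] t) ∈ tensor S S' n :=
  Submodule.subset_span ⟨i, j, x, s, y, t, hn, hx, hy, rfl⟩

theorem Compat.of_tensor {S : SymRel K A G} {S' : SymRel K B H} {T : SymRel K C L}
    {f : A ⊗[K] B →ₗ[K] C} {g : G ⊗[K] H →ₗ[K] L}
    (h : ∀ i j x s y t, (x, s) ∈ S i → (y, t) ∈ S' j →
      (f (x ⊗ₜ y), g (s ⊗ₜ t)) ∈ T (i + j)) :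
    Compat f g (tensor S S') T := by
  intro n x s hx
  have h1 : tensor S S' n ≤ (T n).comap (f.prodMap g) := by
    refine Submodule.span_le.2 ?_
    rintro _ ⟨i, j, x, s, y, t, rfl, hx, hy, rfl⟩
    exact h i j x s y t hx hy
  exact h1 hx

theorem Compat.id (S : SymRel K A G) : Compat LinearMap.id LinearMap.id S S :=
  fun _ _ _ h => h

theorem Compat.comp {S : SymRel K A G} {S' : SymRel K B H} {S'' : SymRel K C L}
    {f : A →ₗ[K] B} {g : G →ₗ[K] H} {f' : B →ₗ[K] C} {g' : H →ₗ[K] L}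
    (h' : Compat f' g' S' S'') (h : Compat f g S S') :
    Compat (f' ∘ₗ f) (g' ∘ₗ g) S S'' :=
  fun n _ _ hx => h' n _ _ (h n _ _ hx)

theorem Compat.map {S : SymRel K A G} {S' : SymRel K B H} {T : SymRel K A' G'}
    {T' : SymRel K B' H'} {f : A →ₗ[K] A'} {g : G →ₗ[K] G'} {f' : B →ₗ[K] B'} {g' : H →ₗ[K] H'}
    (h : Compat f g S T) (h' : Compat f' g' S' T') :
    Compat (TensorProduct.map f f') (TensorProduct.map g g') (tensor S S') (tensor T T') :=
  Compat.of_tensor fun _ _ _ _ _ _ hx hy => tmul_mem rfl (h _ _ _ hx) (h' _ _ _ hy)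

theorem Compat.rTensor {S : SymRel K A G} {S' : SymRel K B H} {T : SymRel K A' G'}
    {f : A →ₗ[K] A'} {g : G →ₗ[K] G'} (h : Compat f g S T) :
    Compat (f.rTensor B) (g.rTensor H) (tensor S S') (tensor T S') :=
  h.map (Compat.id S')

theorem Compat.lTensor {S : SymRel K A G} {S' : SymRel K B H} {T' : SymRel K B' H'}
    {f' : B →ₗ[K] B'} {g' : H →ₗ[K] H'} (h : Compat f' g' S' T') :
    Compat (f'.lTensor A) (g'.lTensor G) (tensor S S') (tensor S T') :=
  (Compat.id S).map h

theorem Compat.assoc (S : SymRel K A G) (S' : SymRel K B H) (S'' : SymRel K C L) :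
    Compat (TensorProduct.assoc K A B C).toLinearMap (TensorProduct.assoc K G H L).toLinearMap
      (tensor (tensor S S') S'') (tensor S (tensor S' S'')) := by
  refine Compat.of_tensor fun i j x s z r hx hz => ?_
  have h1 : tensor S S' i ≤ (tensor S (tensor S' S'') (i + j)).comap
      (((TensorProduct.assoc K A B C).toLinearMap ∘ₗ (TensorProduct.mk K _ C).flip z).prodMap
        ((TensorProduct.assoc K G H L).toLinearMap ∘ₗ (TensorProduct.mk K _ L).flip r)) := by
    refine Submodule.span_le.2 ?_
    rintro _ ⟨a, b, x, s, y, t, rfl, hx, hy, rfl⟩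
    exact tmul_mem (by omega) hx (tmul_mem rfl hy hz)
  exact h1 hx

theorem Compat.assoc_symm (S : SymRel K A G) (S' : SymRel K B H) (S'' : SymRel K C L) :
    Compat (TensorProduct.assoc K A B C).symm.toLinearMap
      (TensorProduct.assoc K G H L).symm.toLinearMap
      (tensor S (tensor S' S'')) (tensor (tensor S S') S'') := by
  refine Compat.of_tensor fun i j z r x s hz hx => ?_
  have h1 : tensor S' S'' j ≤ (tensor (tensor S S') S'' (i + j)).comap
      (((TensorProduct.assoc K A B C).symm.toLinearMap ∘ₗ TensorProduct.mk K A _ z).prodMap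
        ((TensorProduct.assoc K G H L).symm.toLinearMap ∘ₗ TensorProduct.mk K G _ r)) := by
    refine Submodule.span_le.2 ?_
    rintro _ ⟨a, b, x, s, y, t, rfl, hx, hy, rfl⟩
    exact tmul_mem (by omega) (tmul_mem rfl hz hx) hy
  exact h1 hx

/-- `Mono` is needed because a scalar has symbol 0 in positive degree: multiplying an element by it
must then give symbol 0 in the raised degree. -/
theorem Compat.lid {S : SymRel K A G} (hS : Mono S) :
    Compat (TensorProduct.lid K A).toLinearMap (TensorProduct.lid K G).toLinearMap
      (tensor (scalar K) S) S := by
  refine Compat.of_tensor fun i j x s y t hx hy => ?_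
  cases i with
  | zero =>
    obtain ⟨a, ha⟩ := hx
    obtain ⟨rfl, rfl⟩ := Prod.mk.inj ha
    simpa using (S j).smul_mem a hy
  | succ i =>
    obtain ⟨a, ha⟩ := hx
    obtain ⟨rfl, rfl⟩ := Prod.mk.inj ha
    simpa using (S (i + 1 + j)).smul_mem a (hS j _ y t (by omega) hy)

theorem Compat.rid {S : SymRel K A G} (hS : Mono S) :
    Compat (TensorProduct.rid K A).toLinearMap (TensorProduct.rid K G).toLinearMap
      (tensor S (scalar K)) S := by
  refine Compat.of_tensor fun i j x s y t hx hy => ?_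
  cases j with
  | zero =>
    obtain ⟨a, ha⟩ := hy
    obtain ⟨rfl, rfl⟩ := Prod.mk.inj ha
    simpa using (S i).smul_mem a hx
  | succ j =>
    obtain ⟨a, ha⟩ := hy
    obtain ⟨rfl, rfl⟩ := Prod.mk.inj ha
    simpa using (S (i + (j + 1))).smul_mem a (hS i _ x s (by omega) hx)

theorem Compat.mk_left {S : SymRel K A G} {S' : SymRel K B H} {x : A} {s : G}
    (h : (x, s) ∈ S 0) :
    Compat (TensorProduct.mk K A B x) (TensorProduct.mk K G H s) S' (tensor S S') :=
  fun _ _ _ hy => tmul_mem (by omega) h hy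

theorem Compat.mk_right {S : SymRel K A G} {S' : SymRel K B H} {y : B} {t : H}
    (h : (y, t) ∈ S' 0) :
    Compat ((TensorProduct.mk K A B).flip y) ((TensorProduct.mk K G H).flip t) S (tensor S S') :=
  fun _ _ _ hx => tmul_mem (by omega) hx h

/-- The symbol map in degree m is the sum of σ_a ⊗ τ_b over a + b = m. On x ⊗ y of degrees i and j
with i + j ≤ m, every other pair (a, b) has a > i or b > j, so only (i, j) can contribute. This is
why `Good` asks for globally defined maps that vanish in lower degrees. -/
theorem Good.tensor {S : SymRel K A G} {S' : SymRel K B H} (h : Good S) (h' : Good S') :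
    Good (tensor S S') := by
  obtain ⟨σ, hσ⟩ := h
  obtain ⟨τ, hτ⟩ := h'
  refine ⟨fun n => ∑ p ∈ Finset.HasAntidiagonal.antidiagonal n, TensorProduct.map (σ p.1) (τ p.2), ?_⟩
  suffices key : ∀ n m, n ≤ m → SymRel.tensor S S' n ≤ LinearMap.eqLocus
      ((∑ p ∈ Finset.HasAntidiagonal.antidiagonal m, TensorProduct.map (σ p.1) (τ p.2)) ∘ₗ LinearMap.fst K _ _)
      (if n = m then LinearMap.snd K _ _ else 0) by
    intro n x s hx
    refine ⟨by simpa using key n n le_rfl hx, fun m hm => ?_⟩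
    simpa [hm.ne] using key n m hm.le hx
  intro n m hnm
  refine Submodule.span_le.2 ?_
  rintro _ ⟨i, j, x, s, y, t, rfl, hx, hy, rfl⟩
  have h0 : ∀ p ∈ Finset.HasAntidiagonal.antidiagonal m, p ≠ (i, j) → σ p.1 x ⊗ₜ[K] τ p.2 y = 0 := by
    rintro ⟨a, b⟩ hp hne
    have hab := Finset.HasAntidiagonal.mem_antidiagonal.1 hp
    simp only at hab
    by_cases hia : i < a
    · simp [(hσ i x s hx).2 a hia]
    · have hjb : j < b := by
        by_contra hjb
        exact hne (Prod.ext (by simp; omega) (by simp; omega))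
      simp [(hτ j y t hy).2 b hjb]
  simp only [SetLike.mem_coe, LinearMap.mem_eqLocus, LinearMap.comp_apply, LinearMap.fst_apply,
    LinearMap.sum_apply, TensorProduct.map_tmul]
  split_ifs with hm
  · rw [Finset.sum_eq_single_of_mem (i, j) (Finset.HasAntidiagonal.mem_antidiagonal.2 hm) h0,
      (hσ i x s hx).1, (hτ j y t hy).1]
    rfl
  · refine Finset.sum_eq_zero fun p hp => h0 p hp ?_
    rintro rfl
    exact hm (Finset.HasAntidiagonal.mem_antidiagonal.1 hp)

theorem Spans.tensor {S : SymRel K A G} {S' : SymRel K B H} (h : Spans S) (h' : Spans S') :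
    Spans (tensor S S') := by
  rw [Spans, eq_top_iff, ← TensorProduct.map₂_mk_top_top_eq_top, ← h, ← h',
    Submodule.map₂_span_span, Submodule.span_le]
  rintro _ ⟨s, ⟨i, x, hx⟩, t, ⟨j, y, hy⟩, rfl⟩
  exact Submodule.subset_span ⟨i + j, x ⊗ₜ y, tmul_mem rfl hx hy⟩

theorem Good.eq {S : SymRel K A G} (h : Good S) {n : ℕ} {x : A} {s t : G} (hs : (x, s) ∈ S n)
    (ht : (x, t) ∈ S n) : s = t := by
  obtain ⟨σ, hσ⟩ := h
  rw [← (hσ n x s hs).1, ← (hσ n x t ht).1]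

/-- The transfer principle: the maps on the symbol side are determined by the maps on A, because
they agree on the spanning set of symbols. An identity between composites of structure maps
therefore passes from A to G. -/
theorem Compat.unique {S : SymRel K A G} {S' : SymRel K B H} (hS : Spans S) (hS' : Good S')
    {f f' : A →ₗ[K] B} {g g' : G →ₗ[K] H} (h : Compat f g S S') (h' : Compat f' g' S S')
    (hf : f = f') : g = g' := by
  subst hf
  refine LinearMap.ext_on hS ?_
  rintro s ⟨n, x, hx⟩
  exact hS'.eq (h n x s hx) (h' n x s hx)

theorem good_ofMap (p : A →ₗ[K] G) : Good (ofMap p) := by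
  refine ⟨fun n => if n = 0 then p else 0, fun n x s hx => ?_⟩
  cases n with
  | zero =>
    obtain ⟨a, ha⟩ := hx
    obtain ⟨rfl, rfl⟩ := Prod.mk.inj ha
    exact ⟨by simp, fun m hm => by simp [hm.ne']⟩
  | succ n =>
    obtain ⟨a, ha⟩ := hx
    obtain ⟨rfl, rfl⟩ := Prod.mk.inj ha
    exact ⟨by simp, fun m hm => by simp [show m ≠ 0 by omega]⟩

theorem mono_ofMap (p : A →ₗ[K] G) : Mono (ofMap p) := by
  intro n m x s hnm _
  obtain ⟨m, rfl⟩ : ∃ k, m = k + 1 := ⟨m - 1, by omega⟩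
  exact ⟨x, rfl⟩

theorem mem_ofMap (p : A →ₗ[K] G) (x : A) : (x, p x) ∈ ofMap p 0 := ⟨x, rfl⟩

theorem spans_ofMap {p : A →ₗ[K] G} (hp : Function.Surjective p) : Spans (ofMap p) := by
  rw [Spans, eq_top_iff]
  intro y _
  obtain ⟨x, rfl⟩ := hp y
  exact Submodule.subset_span ⟨0, x, mem_ofMap p x⟩

theorem mem_tensor_ofMap (p : A →ₗ[K] G) (q : B →ₗ[K] H) (z : A ⊗[K] B) :
    (z, TensorProduct.map p q z) ∈ tensor (ofMap p) (ofMap q) 0 := by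
  have h : ⊤ ≤ (tensor (ofMap p) (ofMap q) 0).comap
      (LinearMap.id.prod (TensorProduct.map p q)) := by
    rw [← TensorProduct.span_tmul_eq_top, Submodule.span_le]
    rintro _ ⟨x, y, rfl⟩
    exact tmul_mem rfl (mem_ofMap p x) (mem_ofMap q y)
  exact h (Submodule.mem_top (x := z))

theorem mem_tensor_ofMap_succ (p : A →ₗ[K] G) (q : B →ₗ[K] H) (n : ℕ) (z : A ⊗[K] B) :
    (z, (0 : G ⊗[K] H)) ∈ tensor (ofMap p) (ofMap q) (n + 1) := by
  have h : ⊤ ≤ (tensor (ofMap p) (ofMap q) (n + 1)).comap (LinearMap.id.prod 0) := by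
    rw [← TensorProduct.span_tmul_eq_top, Submodule.span_le]
    rintro _ ⟨x, y, rfl⟩
    have h : ((x, 0) : A × G) ∈ ofMap p (n + 1) := ⟨x, rfl⟩
    simpa using tmul_mem (S := ofMap p) rfl h (mem_ofMap q y)
  exact h (Submodule.mem_top (x := z))

end SymRel

end Symbols

/-! ### Transfer of structures along symbol relations -/

section Transfer

variable {K : Type u} [Field K]

open SymRel

variable {A B G H : Type*} [AddCommGroup A] [Module K A] [AddCommGroup B] [Module K B]
  [AddCommGroup G] [Module K G] [AddCommGroup H] [Module K H]

/-- The structure `E` on `G` consists of the symbols of the structure `D` on `A`. -/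
structure Data.Symbol (D : Data K A) (E : Data K G) (S : SymRel K A G) : Prop where
  mul : Compat D.mul E.mul (S.tensor S) S
  one : (D.one, E.one) ∈ S 0
  comul : Compat D.comul E.comul S (S.tensor S)
  counit : Compat D.counit E.counit S (scalar K)
  braid : Compat D.braid E.braid (S.tensor S) (S.tensor S)

namespace Data.Symbol

variable {D : Data K A} {E : Data K G} {S : SymRel K A G}

-- Both sides of each axiom are composites of structure maps, associators, unitors and tensor
-- products, all compatible with symbols, so `Compat.unique` applies axiom by axiom. Quotients and
-- associated graded spaces are both instances.
set_option maxHeartbeats 1000000 in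
theorem isBraidedBialgebra (h : D.Symbol E S) (hD : D.IsBraidedBialgebra) (hs : Spans S)
    (hg : Good S) (hm : Mono S) : E.IsBraidedBialgebra := by
  have hs2 := hs.tensor hs
  have hg2 := hg.tensor hg
  have as := Compat.assoc S S S
  have as' := Compat.assoc_symm S S S
  have hc1 : Compat (c₁ D.braid) (c₁ E.braid) ((S.tensor S).tensor S) ((S.tensor S).tensor S) :=
    h.braid.rTensor
  have hc2 : Compat (c₂ D.braid) (c₂ E.braid) ((S.tensor S).tensor S) ((S.tensor S).tensor S) :=
    as'.comp (h.braid.lTensor.comp as)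
  have hcM : Compat (cMid D.braid) (cMid E.braid) ((S.tensor S).tensor (S.tensor S))
      ((S.tensor S).tensor (S.tensor S)) :=
    (Compat.assoc_symm _ _ _).comp
      ((Compat.lTensor (as.comp (h.braid.rTensor.comp as'))).comp (Compat.assoc _ _ _))
  have hl := Compat.lid hm
  have hr := Compat.rid hm
  constructor
  · exact Compat.unique (hs2.tensor hs) hg (h.mul.comp h.mul.rTensor)
      (h.mul.comp (h.mul.lTensor.comp as)) hD.mul_assoc
  · exact LinearMap.congr_fun (Compat.unique hs hg (h.mul.comp (Compat.mk_left h.one))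
      (Compat.id S) (LinearMap.ext hD.one_mul))
  · exact LinearMap.congr_fun (Compat.unique hs hg (h.mul.comp (Compat.mk_right h.one))
      (Compat.id S) (LinearMap.ext hD.mul_one))
  · exact Compat.unique hs (hg.tensor hg2) (as.comp (h.comul.rTensor.comp h.comul))
      (h.comul.lTensor.comp h.comul) hD.coassoc
  · exact Compat.unique hs hg (hl.comp (h.counit.rTensor.comp h.comul)) (Compat.id S)
      hD.counit_comul
  · exact Compat.unique hs hg (hr.comp (h.counit.lTensor.comp h.comul)) (Compat.id S)
      hD.comul_counit
  · exact Compat.unique (hs2.tensor hs) (hg2.tensor hg) (hc1.comp (hc2.comp hc1))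
      (hc2.comp (hc1.comp hc2)) hD.braiding
  · exact Compat.unique (hs2.tensor hs) hg2 (h.braid.comp h.mul.rTensor)
      (h.mul.lTensor.comp (as.comp (hc1.comp hc2))) hD.braid_mul_left
  · exact Compat.unique (hs2.tensor hs) hg2 (h.braid.comp (h.mul.lTensor.comp as))
      (h.mul.rTensor.comp (hc2.comp hc1)) hD.braid_mul_right
  · exact LinearMap.congr_fun (Compat.unique hs hg2
      (h.braid.comp (Compat.mk_left h.one)) (Compat.mk_right h.one)
      (LinearMap.ext hD.braid_one_left))
  · exact LinearMap.congr_fun (Compat.unique hs hg2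
      (h.braid.comp (Compat.mk_right h.one)) (Compat.mk_left h.one)
      (LinearMap.ext hD.braid_one_right))
  · exact Compat.unique hs2 (hg2.tensor hg) (h.comul.rTensor.comp h.braid)
      (hc2.comp (hc1.comp (as'.comp h.comul.lTensor))) hD.comul_braid_left
  · exact Compat.unique hs2 (hg2.tensor hg)
      (as'.comp (h.comul.lTensor.comp h.braid)) (hc1.comp (hc2.comp h.comul.rTensor))
      hD.comul_braid_right
  · exact Compat.unique hs2 hg (hl.comp (h.counit.rTensor.comp h.braid))
      (hr.comp h.counit.lTensor) hD.counit_braid_left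
  · exact Compat.unique hs2 hg (hr.comp (h.counit.lTensor.comp h.braid))
      (hl.comp h.counit.rTensor) hD.counit_braid_right
  · exact Compat.unique hs2 hg2 (h.comul.comp h.mul)
      ((h.mul.map h.mul).comp (hcM.comp (h.comul.map h.comul))) hD.comul_mul
  · have h1 := h.comul 0 _ _ h.one
    rw [hD.comul_one] at h1
    have h2 : (D.one ⊗ₜ[K] D.one, E.one ⊗ₜ[K] E.one) ∈ S.tensor S 0 :=
      tmul_mem (zero_add 0) h.one h.one
    exact hg2.eq h1 h2
  · have h1 : Compat (D.counit ∘ₗ D.mul) (E.counit ∘ₗ E.mul) _ _ := h.counit.comp h.mul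
    have hsc : Mono (scalar K) := mono_ofMap _
    have h2 := (Compat.lid hsc).comp (h.counit.map h.counit)
    have h3 := Compat.unique hs2 (good_ofMap _) h1 h2 (by
      ext x y
      simp [hD.counit_mul])
    intro x y
    simpa using LinearMap.congr_fun h3 (x ⊗ₜ y)
  · have h1 := h.counit 0 _ _ h.one
    rw [hD.counit_one] at h1
    have h2 : ((1 : K), (1 : K)) ∈ scalar K 0 := mem_ofMap LinearMap.id 1
    have h3 : Good (scalar K) := good_ofMap LinearMap.id
    exact h3.eq h1 h2

theorem isHom {D' : Data K B} {E' : Data K H} {S' : SymRel K B H} (h : D.Symbol E S)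
    (h' : D'.Symbol E' S') (hs : Spans S) (hg' : Good S') {f : A →ₗ[K] B} {g : G →ₗ[K] H}
    (hf : D.IsHom D' f) (hfg : Compat f g S S') : E.IsHom E' g where
  map_mul := Compat.unique (hs.tensor hs) hg' (hfg.comp h.mul) (h'.mul.comp (hfg.map hfg))
    hf.map_mul
  map_one := by
    have h1 := hfg 0 _ _ h.one
    rw [hf.map_one] at h1
    exact hg'.eq h1 h'.one
  map_comul := Compat.unique hs (hg'.tensor hg') ((hfg.map hfg).comp h.comul)
    (h'.comul.comp hfg) hf.map_comul
  map_counit := Compat.unique hs (good_ofMap _) (h'.counit.comp hfg) h.counit hf.map_counit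
  map_braid := Compat.unique (hs.tensor hs) (hg'.tensor hg') ((hfg.map hfg).comp h.braid)
    (h'.braid.comp (hfg.map hfg)) hf.map_braid

end Data.Symbol

/-- A morphism is the case of symbols concentrated in degree zero, so the same transfer principle
serves quotients and factorizations of morphisms. -/
theorem Data.IsHom.symbol {D : Data K A} {E : Data K G} {p : A →ₗ[K] G} (h : D.IsHom E p) :
    D.Symbol E (ofMap p) where
  mul := Compat.of_tensor fun i j x s y t hx hy => by
    cases i <;> cases j <;> obtain ⟨a, ha⟩ := hx <;> obtain ⟨rfl, rfl⟩ := Prod.mk.inj ha <;>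
      obtain ⟨b, hb⟩ := hy <;> obtain ⟨rfl, rfl⟩ := Prod.mk.inj hb
    · exact ⟨D.mul (a ⊗ₜ b), Prod.ext rfl (LinearMap.congr_fun h.map_mul (a ⊗ₜ b))⟩
    all_goals exact ⟨D.mul (a ⊗ₜ b), Prod.ext rfl (by simp)⟩
  one := ⟨D.one, Prod.ext rfl h.map_one⟩
  comul := by
    intro n x s hx
    cases n <;> obtain ⟨a, ha⟩ := hx <;> obtain ⟨rfl, rfl⟩ := Prod.mk.inj ha
    · have := LinearMap.congr_fun h.map_comul a
      rw [LinearMap.comp_apply, LinearMap.comp_apply] at this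
      rw [← this]
      exact mem_tensor_ofMap p p (D.comul a)
    · simpa using mem_tensor_ofMap_succ p p _ (D.comul a)
  counit := by
    intro n x s hx
    cases n <;> obtain ⟨a, ha⟩ := hx <;> obtain ⟨rfl, rfl⟩ := Prod.mk.inj ha
    · exact ⟨D.counit a, Prod.ext rfl (LinearMap.congr_fun h.map_counit a).symm⟩
    · exact ⟨D.counit a, Prod.ext rfl (by simp)⟩
  braid := Compat.of_tensor fun i j x s y t hx hy => by
    cases i <;> cases j <;> obtain ⟨a, ha⟩ := hx <;> obtain ⟨rfl, rfl⟩ := Prod.mk.inj ha <;>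
      obtain ⟨b, hb⟩ := hy <;> obtain ⟨rfl, rfl⟩ := Prod.mk.inj hb
    · have := LinearMap.congr_fun h.map_braid (a ⊗ₜ b)
      rw [LinearMap.comp_apply, LinearMap.comp_apply, TensorProduct.map_tmul] at this
      exact this ▸ mem_tensor_ofMap p p (D.braid (a ⊗ₜ b))
    · simpa using mem_tensor_ofMap_succ p p (0 + _) (D.braid (a ⊗ₜ b))
    · simpa using mem_tensor_ofMap_succ p p (_ + 0) (D.braid (a ⊗ₜ b))
    · simpa using! mem_tensor_ofMap_succ p p ((_ + 1) + _) (D.braid (a ⊗ₜ b))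

theorem Data.IsHom.id (D : Data K A) : D.IsHom D LinearMap.id := by
  constructor <;> simp [TensorProduct.map_id]

/-- A map through which a morphism factors after a surjective morphism is a morphism. -/
theorem Data.IsHom.of_comp_surjective {D : Data K A} {E : Data K B} {F : Data K G}
    {p : A →ₗ[K] B} {g : B →ₗ[K] G} (hp : D.IsHom E p) (hsurj : Function.Surjective p)
    (hgp : D.IsHom F (g ∘ₗ p)) : E.IsHom F g :=
  hp.symbol.isHom (Data.IsHom.id F).symbol (spans_ofMap hsurj) (good_ofMap _) hgp (by
    intro n x s hx
    cases n <;> obtain ⟨a, ha⟩ := hx <;> obtain ⟨rfl, rfl⟩ := Prod.mk.inj ha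
    · exact ⟨g (p a), rfl⟩
    · exact ⟨g (p a), Prod.ext rfl (by simp)⟩)

theorem Data.isHom_mkQ {D : Data K A} {I : Submodule K A} (h : D.IsBiideal I) :
    D.IsHom (Data.quot h) I.mkQ where
  map_mul := LinearMap.ext fun x => by
    simpa [Data.quot] using (induced_apply (TensorProduct.map I.mkQ I.mkQ) (I.mkQ ∘ₗ D.mul)
      LinearMap.id _ _ _ _ x).symm
  map_one := rfl
  map_comul := LinearMap.ext fun x => by
    simpa [Data.quot] using (induced_apply I.mkQ (TensorProduct.map I.mkQ I.mkQ ∘ₗ D.comul)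
      LinearMap.id _ _ _ _ x).symm
  map_counit := LinearMap.ext fun x => rfl
  map_braid := LinearMap.ext fun x => by
    simpa [Data.quot] using (induced_apply (TensorProduct.map I.mkQ I.mkQ)
      (TensorProduct.map I.mkQ I.mkQ ∘ₗ D.braid) LinearMap.id _ _ _ _ x).symm

theorem Data.isBraidedBialgebra_quot {D : Data K A} {I : Submodule K A} (h : D.IsBiideal I)
    (hD : D.IsBraidedBialgebra) : (Data.quot h).IsBraidedBialgebra :=
  (Data.isHom_mkQ h).symbol.isBraidedBialgebra hD (spans_ofMap I.mkQ_surjective) (good_ofMap _)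
    (mono_ofMap _)

end Transfer

/-! ### The associated graded braided bialgebra -/

section AssociatedGraded

variable {K : Type u} [Field K]

open SymRel

variable {A : Type*} [AddCommGroup A] [Module K A] {F : ℕ → Submodule K A}

theorem tmul_mem_tens {A B : Type*} [AddCommGroup A] [Module K A] [AddCommGroup B] [Module K B]
    {X : Submodule K A} {Y : Submodule K B} {x : A} {y : B} (hx : x ∈ X) (hy : y ∈ Y) :
    x ⊗ₜ[K] y ∈ tens X Y :=
  ⟨⟨x, hx⟩ ⊗ₜ ⟨y, hy⟩, rfl⟩

theorem tens_le {A B : Type*} [AddCommGroup A] [Module K A] [AddCommGroup B] [Module K B]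
    {X : Submodule K A} {Y : Submodule K B} {W : Submodule K (A ⊗[K] B)}
    (h : ∀ x ∈ X, ∀ y ∈ Y, x ⊗ₜ[K] y ∈ W) : tens X Y ≤ W := by
  rintro _ ⟨t, rfl⟩
  induction t with
  | zero => rw [map_zero]; exact Submodule.zero_mem _
  | tmul x y => exact h _ x.2 _ y.2
  | add a b ha hb => rw [map_add]; exact Submodule.add_mem _ ha hb

theorem SymRel.Compat.of_tensor_tensor {A B G H : Type*} [AddCommGroup A] [Module K A]
    [AddCommGroup B] [Module K B] [AddCommGroup G] [Module K G] [AddCommGroup H] [Module K H]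
    {S : SymRel K A G} {S' : SymRel K B H} {f : A ⊗[K] A →ₗ[K] B ⊗[K] B}
    {g : G ⊗[K] G →ₗ[K] H ⊗[K] H}
    (h : ∀ i j x s y t, (x, s) ∈ S i → (y, t) ∈ S j →
      (f (x ⊗ₜ y), g (s ⊗ₜ t)) ∈ S'.tensor S' (i + j)) :
    Compat f g (S.tensor S) (S'.tensor S') :=
  Compat.of_tensor h

/-- Elements of a sum of submodules are sums of elements. -/
theorem exists_sum_antidiagonal {M : Type*} [AddCommGroup M] [Module K M]
    {X : ℕ × ℕ → Submodule K M} {n : ℕ} {z : M}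
    (hz : z ∈ ⨆ (p : ℕ × ℕ) (_ : p.1 + p.2 = n), X p) :
    ∃ t : ∀ p, X p, z = ∑ p ∈ Finset.HasAntidiagonal.antidiagonal n, (t p : M) := by
  have h : (⨆ (p : ℕ × ℕ) (_ : p.1 + p.2 = n), X p)
      = ⨆ p ∈ Finset.HasAntidiagonal.antidiagonal n, X p := by
    simp only [Finset.HasAntidiagonal.mem_antidiagonal]
  rw [h, Submodule.mem_iSup_finset_iff_exists_sum] at hz
  obtain ⟨t, ht⟩ := hz
  exact ⟨t, ht.symm⟩

theorem cls_eq_zero_iff {n : ℕ} (x : F n) : cls F n x = 0 ↔ (x : A) ∈ below F n := by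
  have h : Function.Injective (DirectSum.lof K ℕ (GrPiece F) n) :=
    DirectSum.of_injective (β := GrPiece F) n
  rw [cls, LinearMap.comp_apply, map_eq_zero_iff _ h, Submodule.mkQ_apply,
    Submodule.Quotient.mk_eq_zero]
  rfl

theorem cls_mem_grading (n : ℕ) (x : F n) : cls F n x ∈ grading F n :=
  ⟨Submodule.Quotient.mk x, rfl⟩

theorem exists_cls_of_mem_grading {n : ℕ} {s : Gr F} (hs : s ∈ grading F n) :
    ∃ x, cls F n x = s := by
  obtain ⟨y, rfl⟩ := hs
  obtain ⟨x, rfl⟩ := Submodule.Quotient.mk_surjective _ y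
  exact ⟨x, rfl⟩

theorem isInternal_grading (F : ℕ → Submodule K A) : DirectSum.IsInternal (grading F) := by
  let e : ∀ n, GrPiece F n ≃ₗ[K] grading F n := fun n =>
    LinearEquiv.ofInjective (DirectSum.lof K ℕ (GrPiece F) n)
      (DirectSum.of_injective (β := GrPiece F) n)
  have h : DirectSum.coeLinearMap (grading F) ∘ₗ (DirectSum.congrLinearEquiv e).toLinearMap
      = LinearMap.id := by
    refine DirectSum.linearMap_ext K fun n => LinearMap.ext fun x => ?_
    have h1 : DirectSum.congrLinearEquiv e (DirectSum.lof K ℕ (GrPiece F) n x)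
        = DirectSum.lof K ℕ (fun n => grading F n) n (e n x) :=
      DirectSum.lmap_lof (R := K) (fun n => (e n).toLinearMap) n x
    simp only [LinearMap.comp_apply, LinearEquiv.coe_coe, h1, DirectSum.coeLinearMap_lof]
    rfl
  have h2 : ⇑(DirectSum.coeLinearMap (grading F)) = (DirectSum.congrLinearEquiv e).symm :=
    funext fun x => by
      have := LinearMap.congr_fun h ((DirectSum.congrLinearEquiv e).symm x)
      simpa using this
  change Function.Bijective (DirectSum.coeLinearMap (grading F))
  rw [h2]
  exact LinearEquiv.bijective _

/-- The symbols of a filtration. -/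
def filRel (F : ℕ → Submodule K A) : SymRel K A (Gr F) := fun n =>
  LinearMap.range ((F n).subtype.prod (cls F n))

theorem mem_filRel {n : ℕ} (x : F n) : ((x : A), cls F n x) ∈ filRel F n := ⟨x, rfl⟩

theorem mem_filRel_iff {n : ℕ} {x : A} {s : Gr F} :
    (x, s) ∈ filRel F n ↔ ∃ hx : x ∈ F n, cls F n ⟨x, hx⟩ = s := by
  constructor
  · rintro ⟨y, hy⟩
    obtain ⟨rfl, rfl⟩ := Prod.mk.inj hy
    exact ⟨y.2, rfl⟩
  · rintro ⟨hx, rfl⟩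
    exact ⟨⟨x, hx⟩, rfl⟩

/-- Over a field the class map on F n extends linearly to all of A. The extension in degree m kills
F n for n < m, because F n is contained in F (m - 1). -/
theorem good_filRel (hF : Monotone F) : Good (filRel F) := by
  choose σ hσ using fun n => LinearMap.exists_extend (p := F n) (V' := Gr F) (cls F n)
  refine ⟨σ, fun n x s hx => ?_⟩
  obtain ⟨hx', rfl⟩ := mem_filRel_iff.1 hx
  refine ⟨LinearMap.congr_fun (hσ n) ⟨x, hx'⟩, fun m hm => ?_⟩
  rw [← (cls_eq_zero_iff (F := F) ⟨x, hF hm.le hx'⟩).2 (below_mono hF hm hx')]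
  exact LinearMap.congr_fun (hσ m) ⟨x, _⟩

theorem mono_filRel (hF : Monotone F) : Mono (filRel F) := by
  intro n m x s hnm hx
  obtain ⟨hx', rfl⟩ := mem_filRel_iff.1 hx
  exact mem_filRel_iff.2 ⟨hF hnm.le hx', (cls_eq_zero_iff _).2 (below_mono hF hnm hx')⟩

theorem spans_filRel (F : ℕ → Submodule K A) : Spans (filRel F) := by
  rw [Spans, eq_top_iff, ← (isInternal_grading F).submodule_iSup_eq_top, iSup_le_iff]
  intro n s hs
  obtain ⟨x, rfl⟩ := exists_cls_of_mem_grading hs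
  exact Submodule.subset_span ⟨n, x, mem_filRel x⟩

theorem mem_tensor_filRel {F F' : ℕ → Submodule K A} {i j n : ℕ} (hn : i + j = n)
    (t : F i ⊗[K] F' j) :
    (TensorProduct.mapIncl (F i) (F' j) t, TensorProduct.map (cls F i) (cls F' j) t) ∈
      (filRel F).tensor (filRel F') n := by
  have h : ⊤ ≤ ((filRel F).tensor (filRel F') n).comap
      ((TensorProduct.mapIncl (F i) (F' j)).prod (TensorProduct.map (cls F i) (cls F' j))) := by
    rw [← TensorProduct.span_tmul_eq_top, Submodule.span_le]
    rintro _ ⟨x, y, rfl⟩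
    exact tmul_mem hn (mem_filRel x) (mem_filRel y)
  exact h (Submodule.mem_top (x := t))

theorem map_cls_mem {i j : ℕ} (t : F i ⊗[K] F j) :
    TensorProduct.map (cls F i) (cls F j) t ∈
      tens (A := Gr F) (B := Gr F) (grading F i) (grading F j) := by
  induction t with
  | zero => rw [map_zero]; exact Submodule.zero_mem _
  | tmul x y => exact tmul_mem_tens (cls_mem_grading i x) (cls_mem_grading j y)
  | add a b ha hb => rw [map_add]; exact Submodule.add_mem _ ha hb

namespace IsConnectedFiltered

variable {D : Data K A} (h : IsConnectedFiltered D F)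
include h

theorem gr_mul_cls {i j : ℕ} (x : F i) (y : F j) :
    h.gr.mul (cls F i x ⊗ₜ cls F j y) = cls F (i + j) ⟨_, h.mul_tmul_mem x.2 y.2⟩ := by
  have h1 : h.grMul i j (Submodule.Quotient.mk x ⊗ₜ Submodule.Quotient.mk y)
      = Submodule.Quotient.mk ⟨_, h.mul_tmul_mem x.2 y.2⟩ := by
    apply toQ_injective
    exact induced_apply (TensorProduct.map ((below F i).submoduleOf (F i)).mkQ
      ((below F j).submoduleOf (F j)).mkQ) _ _ _ _ _ _ (x ⊗ₜ y)
  simp only [gr, cls, LinearMap.comp_apply, TensorProduct.lift.tmul, DirectSum.toModule_lof,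
    LinearMap.flip_apply, Submodule.mkQ_apply, TensorProduct.curry_apply, h1]

theorem gr_braid_cls {i j : ℕ} (x : F i) (y : F j) (t : F j ⊗[K] F i)
    (ht : TensorProduct.mapIncl (F j) (F i) t = D.braid ((x : A) ⊗ₜ (y : A))) :
    h.gr.braid (cls F i x ⊗ₜ cls F j y) = TensorProduct.map (cls F j) (cls F i) t := by
  have h1 : h.grBraid i j (Submodule.Quotient.mk x ⊗ₜ Submodule.Quotient.mk y)
      = TensorProduct.map (Submodule.mkQ _) (Submodule.mkQ _) t := by
    apply toQ_map_injective
    refine (induced_apply (TensorProduct.map ((below F i).submoduleOf (F i)).mkQ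
      ((below F j).submoduleOf (F j)).mkQ) _ _ _ _ _ _ (x ⊗ₜ y)).trans ?_
    simp only [LinearMap.comp_apply, TensorProduct.mapIncl, TensorProduct.map_tmul,
      Submodule.subtype_apply]
    rw [← ht, TensorProduct.mapIncl, ← LinearMap.comp_apply, ← LinearMap.comp_apply,
      ← TensorProduct.map_comp, ← TensorProduct.map_comp]
    rfl
  simp only [gr, cls, LinearMap.comp_apply, TensorProduct.lift.tmul, DirectSum.toModule_lof,
    LinearMap.flip_apply, Submodule.mkQ_apply, TensorProduct.curry_apply, h1]
  rw [← LinearMap.comp_apply, ← TensorProduct.map_comp]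

/-- A summand in F a ⊗ F b with a + b = i + j and (a, b) ≠ (i, j) has a < i or b < j, hence vanishes
in A / F (i - 1) ⊗ A / F (j - 1). The component is therefore read off from any decomposition of Δ x.
-/
theorem grComul_mk {i j n : ℕ} (hn : i + j = n) (x : F n)
    (t : ∀ p : ℕ × ℕ, F p.1 ⊗[K] F p.2)
    (ht : D.comul x = ∑ p ∈ Finset.HasAntidiagonal.antidiagonal n,
      TensorProduct.mapIncl (F p.1) (F p.2) (t p)) :
    h.grComul hn (Submodule.Quotient.mk x)
      = TensorProduct.map (Submodule.mkQ _) (Submodule.mkQ _) (t (i, j)) := by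
  apply toQ_map_injective
  refine (induced_apply (Submodule.mkQ _) _ _ _ _ _ _ x).trans ?_
  simp only [LinearMap.comp_apply, Submodule.subtype_apply]
  rw [ht, map_sum, Finset.sum_eq_single_of_mem (i, j) (Finset.HasAntidiagonal.mem_antidiagonal.2 hn)]
  · rw [TensorProduct.mapIncl, ← LinearMap.comp_apply, ← LinearMap.comp_apply,
      ← TensorProduct.map_comp, ← TensorProduct.map_comp]
    rfl
  · rintro ⟨a, b⟩ hab hne
    replace hab := Finset.HasAntidiagonal.mem_antidiagonal.1 hab
    simp only at hab
    refine map_mkQ_tens_eq_zero F i j (F a) (F b) ?_ ⟨_, rfl⟩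
    rcases lt_or_ge a i with ha | ha
    · exact Or.inl (below_mono h.mono ha)
    · refine Or.inr (below_mono h.mono ?_)
      by_contra hb
      exact hne (Prod.ext (by simp; omega) (by simp; omega))

theorem gr_comul_cls {n : ℕ} (x : F n) (t : ∀ p : ℕ × ℕ, F p.1 ⊗[K] F p.2)
    (ht : D.comul x = ∑ p ∈ Finset.HasAntidiagonal.antidiagonal n,
      TensorProduct.mapIncl (F p.1) (F p.2) (t p)) :
    h.gr.comul (cls F n x) = ∑ p ∈ Finset.HasAntidiagonal.antidiagonal n,
      TensorProduct.map (cls F p.1) (cls F p.2) (t p) := by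
  simp only [gr, cls, LinearMap.comp_apply, DirectSum.toModule_lof, LinearMap.sum_apply,
    Submodule.mkQ_apply]
  rw [← Finset.sum_attach (Finset.HasAntidiagonal.antidiagonal n)]
  refine Finset.sum_congr rfl fun p _ => ?_
  rw [h.grComul_mk _ x t ht, ← LinearMap.comp_apply, ← TensorProduct.map_comp]

theorem exists_comul_eq {n : ℕ} (x : F n) : ∃ t : ∀ p : ℕ × ℕ, F p.1 ⊗[K] F p.2,
    D.comul x = ∑ p ∈ Finset.HasAntidiagonal.antidiagonal n,
      TensorProduct.mapIncl (F p.1) (F p.2) (t p) := by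
  obtain ⟨s, hs⟩ := exists_sum_antidiagonal (h.comul_mem n x.2)
  choose t ht using fun p => (s p).2
  exact ⟨t, by simp only [hs, ht]⟩

theorem gr_counit_cls_zero (x : F 0) : h.gr.counit (cls F 0 x) = D.counit x := by
  simp only [gr, cls, LinearMap.comp_apply, DirectSum.component.lof_self]
  rfl

theorem gr_counit_cls {n : ℕ} (hn : n ≠ 0) (x : F n) : h.gr.counit (cls F n x) = 0 := by
  simp only [gr, cls, LinearMap.comp_apply]
  rw [DirectSum.component.of, dif_neg hn]
  simp

/-- The link between the concretely induced structure on the associated graded space and the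
abstract transfer of axioms. -/
theorem symbol : D.Symbol h.gr (filRel F) where
  mul := by
    refine Compat.of_tensor (S := filRel F) (S' := filRel F) (T := filRel F) fun i j x s y t hx hy => ?_
    obtain ⟨hx', rfl⟩ := mem_filRel_iff.1 hx
    obtain ⟨hy', rfl⟩ := mem_filRel_iff.1 hy
    rw [h.gr_mul_cls]
    exact mem_filRel (F := F) ⟨_, h.mul_tmul_mem hx' hy'⟩
  one := mem_filRel (F := F) ⟨D.one, h.one_mem⟩
  comul := by
    intro n x s hx
    obtain ⟨hx', rfl⟩ := mem_filRel_iff.1 hx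
    obtain ⟨t, ht⟩ := h.exists_comul_eq ⟨x, hx'⟩
    rw [h.gr_comul_cls _ t ht, ht]
    have := Submodule.sum_mem ((filRel F).tensor (filRel F) n) fun p hp =>
      mem_tensor_filRel (Finset.HasAntidiagonal.mem_antidiagonal.1 hp) (t p)
    convert this
    · simp [Prod.fst_sum]
    · simp [Prod.snd_sum]
  counit := by
    intro n x s hx
    obtain ⟨hx', rfl⟩ := mem_filRel_iff.1 hx
    cases n with
    | zero =>
      rw [h.gr_counit_cls_zero]
      exact mem_ofMap LinearMap.id _
    | succ n =>
      rw [h.gr_counit_cls (by omega)]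
      -- The counit of x need not vanish, but every scalar has symbol 0 in positive degree.
      exact ⟨D.counit x, rfl⟩
  braid := by
    refine Compat.of_tensor_tensor (S := filRel F) (S' := filRel F) fun i j x s y t hx hy => ?_
    obtain ⟨hx', rfl⟩ := mem_filRel_iff.1 hx
    obtain ⟨hy', rfl⟩ := mem_filRel_iff.1 hy
    obtain ⟨r, hr⟩ := h.braid_tmul_mem hx' hy'
    rw [h.gr_braid_cls _ _ r hr, ← hr]
    exact mem_tensor_filRel (add_comm j i) r

theorem isGradedBraidedBialgebra_gr : h.gr.IsGradedBraidedBialgebra (grading F) where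
  isBraidedBialgebra := h.symbol.isBraidedBialgebra h.isBraidedBialgebra (spans_filRel F)
    (good_filRel h.mono) (mono_filRel h.mono)
  isInternal := isInternal_grading F
  mul_mem i j := tens_le fun s hs t ht => by
    obtain ⟨x, rfl⟩ := exists_cls_of_mem_grading hs
    obtain ⟨y, rfl⟩ := exists_cls_of_mem_grading ht
    rw [Submodule.mem_comap, h.gr_mul_cls]
    exact cls_mem_grading _ _
  one_mem := cls_mem_grading (F := F) 0 ⟨D.one, h.one_mem⟩
  comul_mem n s hs := by
    obtain ⟨x, rfl⟩ := exists_cls_of_mem_grading hs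
    obtain ⟨t, ht⟩ := h.exists_comul_eq x
    rw [Submodule.mem_comap, h.gr_comul_cls _ t ht]
    exact Submodule.sum_mem _ fun p hp => Submodule.mem_iSup_of_mem p
      (Submodule.mem_iSup_of_mem (Finset.HasAntidiagonal.mem_antidiagonal.1 hp)
        (map_cls_mem (t p)))
  counit_eq_zero n hn s hs := by
    obtain ⟨x, rfl⟩ := exists_cls_of_mem_grading hs
    exact h.gr_counit_cls hn x
  braid_mem i j := tens_le fun s hs t ht => by
    obtain ⟨x, rfl⟩ := exists_cls_of_mem_grading hs
    obtain ⟨y, rfl⟩ := exists_cls_of_mem_grading ht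
    obtain ⟨r, hr⟩ := h.braid_tmul_mem x.2 y.2
    rw [Submodule.mem_comap, h.gr_braid_cls x y r hr]
    exact map_cls_mem r

end IsConnectedFiltered

theorem grOfLE_cls {F F' : ℕ → Submodule K A} (hle : ∀ n, F n ≤ F' n) (n : ℕ) (x : F n) :
    grOfLE hle (cls F n x) = cls F' n ⟨x, hle n x.2⟩ := by
  simp only [grOfLE, cls, LinearMap.comp_apply, DirectSum.lmap_lof]
  rfl

theorem isGradedHom_grOfLE {D : Data K A} {F F' : ℕ → Submodule K A}
    (h : IsConnectedFiltered D F) (h' : IsConnectedFiltered D F') (hle : ∀ n, F n ≤ F' n) :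
    h.gr.IsGradedHom (grading F) h'.gr (grading F') (grOfLE hle) where
  isHom := h.symbol.isHom h'.symbol (spans_filRel F) (good_filRel h'.mono) (Data.IsHom.id D) (by
    intro n x s hx
    obtain ⟨hx', rfl⟩ := mem_filRel_iff.1 hx
    rw [grOfLE_cls]
    exact mem_filRel (F := F') ⟨x, hle n hx'⟩)
  map_mem n s hs := by
    obtain ⟨x, rfl⟩ := exists_cls_of_mem_grading hs
    rw [Submodule.mem_comap, grOfLE_cls]
    exact cls_mem_grading _ _

end AssociatedGraded

/-! ### Strand calculus

Operators acting on the first factors of a tensor product `X ⊗ (Y ⊗ (Z ⊗ ⋯ ⊗ M))`, nested to the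
right, whose last factor `M` is arbitrary. -/

section Strands

variable {K : Type u} [Field K]
variable {X Y Z W P Q R S M N : Type*} [AddCommGroup X] [Module K X] [AddCommGroup Y] [Module K Y]
  [AddCommGroup Z] [Module K Z] [AddCommGroup W] [Module K W] [AddCommGroup P] [Module K P]
  [AddCommGroup Q] [Module K Q] [AddCommGroup R] [Module K R] [AddCommGroup S] [Module K S]
  [AddCommGroup M] [Module K M] [AddCommGroup N] [Module K N]

local notation "𝕃" => LinearMap.lTensor _

/-- The action of `f` on the first two factors. -/
def br (f : X ⊗[K] Y →ₗ[K] Z ⊗[K] W) (M : Type*) [AddCommGroup M] [Module K M] :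
    X ⊗[K] (Y ⊗[K] M) →ₗ[K] Z ⊗[K] (W ⊗[K] M) :=
  (TensorProduct.assoc K Z W M).toLinearMap ∘ₗ f.rTensor M ∘ₗ
    (TensorProduct.assoc K X Y M).symm.toLinearMap

/-- The action of `m` on the first two factors. -/
def mu (m : X ⊗[K] Y →ₗ[K] Z) (M : Type*) [AddCommGroup M] [Module K M] :
    X ⊗[K] (Y ⊗[K] M) →ₗ[K] Z ⊗[K] M :=
  m.rTensor M ∘ₗ (TensorProduct.assoc K X Y M).symm.toLinearMap

/-- The action of `d` on the first factor. -/
def de (d : X →ₗ[K] Y ⊗[K] Z) (M : Type*) [AddCommGroup M] [Module K M] :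
    X ⊗[K] M →ₗ[K] Y ⊗[K] (Z ⊗[K] M) :=
  (TensorProduct.assoc K Y Z M).toLinearMap ∘ₗ d.rTensor M

/-- The action of `e` on the first factor. -/
def ep (e : X →ₗ[K] K) (M : Type*) [AddCommGroup M] [Module K M] : X ⊗[K] M →ₗ[K] M :=
  (TensorProduct.lid K M).toLinearMap ∘ₗ e.rTensor M

theorem assoc_tmul_eq (s : X ⊗[K] Y) (m : M) :
    TensorProduct.assoc K X Y M (s ⊗ₜ m) = 𝕃 ((TensorProduct.mk K Y M).flip m) s := by
  induction s with
  | zero => simp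
  | tmul x y => rfl
  | add a b ha hb => rw [TensorProduct.add_tmul, map_add, map_add, ha, hb]

theorem br_tmul (f : X ⊗[K] Y →ₗ[K] Z ⊗[K] W) (x : X) (y : Y) (m : M) :
    br f M (x ⊗ₜ (y ⊗ₜ m)) = 𝕃 ((TensorProduct.mk K W M).flip m) (f (x ⊗ₜ y)) :=
  assoc_tmul_eq _ _

theorem de_tmul (d : X →ₗ[K] Y ⊗[K] Z) (x : X) (m : M) :
    de d M (x ⊗ₜ m) = 𝕃 ((TensorProduct.mk K Z M).flip m) (d x) :=
  assoc_tmul_eq _ _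

theorem ep_tmul (e : X →ₗ[K] K) (x : X) (m : M) : ep e M (x ⊗ₜ m) = e x • m := by
  simp [ep]

theorem mk_flip_comp (g : M →ₗ[K] N) (m : M) :
    g.lTensor X ∘ₗ (TensorProduct.mk K X M).flip m = (TensorProduct.mk K X N).flip (g m) :=
  rfl

/-- The interchange law: an operator on the first strands commutes with any operator on the strands
behind them. Together with `mu_nat`, `de_nat` and `ep_nat` it carries out all slides of distant
strands below. -/
theorem br_nat (f : X ⊗[K] Y →ₗ[K] Z ⊗[K] W) (g : M →ₗ[K] N) (t : X ⊗[K] (Y ⊗[K] M)) :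
    br f N (𝕃 (𝕃 g) t) = 𝕃 (𝕃 g) (br f M t) := by
  have h : br f N ∘ₗ 𝕃 (𝕃 g) = 𝕃 (𝕃 g) ∘ₗ br f M := by
    refine TensorProduct.ext_threefold' fun x y m => ?_
    simp only [LinearMap.comp_apply, LinearMap.lTensor_tmul, br_tmul, ← mk_flip_comp g m,
      LinearMap.lTensor_comp]
  exact LinearMap.congr_fun h t

theorem mu_nat (f : X ⊗[K] Y →ₗ[K] Z) (g : M →ₗ[K] N) (t : X ⊗[K] (Y ⊗[K] M)) :
    mu f N (𝕃 (𝕃 g) t) = 𝕃 g (mu f M t) := by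
  have h : mu f N ∘ₗ 𝕃 (𝕃 g) = 𝕃 g ∘ₗ mu f M := TensorProduct.ext_threefold' fun x y m => rfl
  exact LinearMap.congr_fun h t

theorem de_nat (d : X →ₗ[K] Y ⊗[K] Z) (g : M →ₗ[K] N) (t : X ⊗[K] M) :
    de d N (𝕃 g t) = 𝕃 (𝕃 g) (de d M t) := by
  have h : de d N ∘ₗ 𝕃 g = 𝕃 (𝕃 g) ∘ₗ de d M := by
    refine TensorProduct.ext' fun x m => ?_
    simp only [LinearMap.comp_apply, LinearMap.lTensor_tmul, de_tmul, ← mk_flip_comp g m,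
      LinearMap.lTensor_comp]
  exact LinearMap.congr_fun h t

theorem ep_nat (e : X →ₗ[K] K) (g : M →ₗ[K] N) (t : X ⊗[K] M) :
    ep e N (𝕃 g t) = g (ep e M t) := by
  have h : ep e N ∘ₗ 𝕃 g = g ∘ₗ ep e M := by
    refine TensorProduct.ext' fun x m => ?_
    simp only [LinearMap.comp_apply, LinearMap.lTensor_tmul, ep_tmul, map_smul]
  exact LinearMap.congr_fun h t

variable {A₁ A₂ A₃ A₄ A₅ : Type*} [AddCommGroup A₁] [Module K A₁] [AddCommGroup A₂] [Module K A₂]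
  [AddCommGroup A₃] [Module K A₃] [AddCommGroup A₄] [Module K A₄] [AddCommGroup A₅] [Module K A₅]

/-- An identity between composites of operators persists after a further strand S is placed in
front. The two digits in the names of this family count the operators on the two sides, so that
shifted identities can be used for rewriting. -/
theorem sh21 {f : A₁ →ₗ[K] Y} {g : X →ₗ[K] A₁} {h : X →ₗ[K] Y} (H : ∀ t, f (g t) = h t)
    (t : S ⊗[K] X) : 𝕃 f (𝕃 g t) = 𝕃 h t := by
  rw [← LinearMap.lTensor_comp_apply, show f ∘ₗ g = h from LinearMap.ext H]

theorem sh22 {f : A₁ →ₗ[K] Y} {g : X →ₗ[K] A₁} {h : A₂ →ₗ[K] Y} {k : X →ₗ[K] A₂}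
    (H : ∀ t, f (g t) = h (k t)) (t : S ⊗[K] X) : 𝕃 f (𝕃 g t) = 𝕃 h (𝕃 k t) := by
  rw [sh21 (h := h ∘ₗ k) H, LinearMap.lTensor_comp_apply]

theorem sh23 {f : A₁ →ₗ[K] Y} {g : X →ₗ[K] A₁} {h : A₂ →ₗ[K] Y} {k : A₃ →ₗ[K] A₂}
    {l : X →ₗ[K] A₃} (H : ∀ t, f (g t) = h (k (l t))) (t : S ⊗[K] X) :
    𝕃 f (𝕃 g t) = 𝕃 h (𝕃 k (𝕃 l t)) := by
  rw [sh22 (h := h ∘ₗ k) H, LinearMap.lTensor_comp_apply]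

theorem sh33 {f : A₁ →ₗ[K] Y} {f' : A₄ →ₗ[K] A₁} {g : X →ₗ[K] A₄} {h : A₂ →ₗ[K] Y}
    {k : A₃ →ₗ[K] A₂} {l : X →ₗ[K] A₃} (H : ∀ t, f (f' (g t)) = h (k (l t))) (t : S ⊗[K] X) :
    𝕃 f (𝕃 f' (𝕃 g t)) = 𝕃 h (𝕃 k (𝕃 l t)) := by
  rw [← LinearMap.lTensor_comp_apply, sh23 (f := f ∘ₗ f') H]

theorem sh25 {f : A₁ →ₗ[K] Y} {g : X →ₗ[K] A₁} {h : A₂ →ₗ[K] Y} {k : A₃ →ₗ[K] A₂}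
    {l : A₄ →ₗ[K] A₃} {p : A₅ →ₗ[K] A₄} {q : X →ₗ[K] A₅}
    (H : ∀ t, f (g t) = h (k (l (p (q t))))) (t : S ⊗[K] X) :
    𝕃 f (𝕃 g t) = 𝕃 h (𝕃 k (𝕃 l (𝕃 p (𝕃 q t)))) := by
  rw [sh23 (h := h) (k := k) (l := l ∘ₗ p ∘ₗ q) H, LinearMap.lTensor_comp_apply,
    LinearMap.lTensor_comp_apply]

theorem sh44 {f₁ : A₁ →ₗ[K] Y} {f₂ : A₂ →ₗ[K] A₁} {f₃ : A₃ →ₗ[K] A₂} {f₄ : X →ₗ[K] A₃}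
    {g₁ : A₄ →ₗ[K] Y} {g₂ : A₅ →ₗ[K] A₄} {g₃ : M →ₗ[K] A₅} {g₄ : X →ₗ[K] M}
    (H : ∀ t, f₁ (f₂ (f₃ (f₄ t))) = g₁ (g₂ (g₃ (g₄ t)))) (t : S ⊗[K] X) :
    𝕃 f₁ (𝕃 f₂ (𝕃 f₃ (𝕃 f₄ t))) = 𝕃 g₁ (𝕃 g₂ (𝕃 g₃ (𝕃 g₄ t))) := by
  rw [← LinearMap.lTensor_comp_apply, sh33 (f := f₁ ∘ₗ f₂) (h := g₁) (k := g₂) (l := g₃ ∘ₗ g₄) H,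
    LinearMap.lTensor_comp_apply]

/-- Operators are determined by their action in front of a nonzero tail. -/
theorem lTensor_flip_injective {m : M} (hm : m ≠ 0) :
    Function.Injective ((TensorProduct.mk K X M).flip m) := by
  obtain ⟨e, he⟩ := Module.Projective.exists_dual_eq_one K hm
  refine Function.LeftInverse.injective
    (g := (TensorProduct.rid K X).toLinearMap ∘ₗ e.lTensor X) fun x => ?_
  simp [he]

end Strands

/-! ### The braided tensor algebra -/

section TensorAlg

variable {K : Type u} [Field K] {V : Type v} [AddCommGroup V] [Module K V]
variable (c : V ⊗[K] V →ₗ[K] V ⊗[K] V)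
variable {M N : Type*} [AddCommGroup M] [Module K M] [AddCommGroup N] [Module K N]

local notation "𝕃" => LinearMap.lTensor _
local notation "𝕋" => TensorAlgebra K V
local notation "𝛊" => TensorAlgebra.ι K (M := V)

/-- The multiplication of the tensor algebra on the first two factors. -/
abbrev mT (K : Type u) [Field K] (V : Type v) [AddCommGroup V] [Module K V] (M : Type*)
    [AddCommGroup M] [Module K M] :=
  mu (LinearMap.mul' K (TensorAlgebra K V)) M

abbrev bT (M : Type*) [AddCommGroup M] [Module K M] := br (braidT c) M
abbrev bVT (M : Type*) [AddCommGroup M] [Module K M] := br (braidVT c) M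

theorem mT_tmul (x y : 𝕋) (m : M) : mT K V M (x ⊗ₜ (y ⊗ₜ m)) = (x * y) ⊗ₜ m := rfl

theorem mT_assoc (t : 𝕋 ⊗[K] (𝕋 ⊗[K] (𝕋 ⊗[K] M))) :
    mT K V M (mT K V _ t) = mT K V M (𝕃 (mT K V M) t) := by
  have h : mT K V M ∘ₗ mT K V _ = mT K V M ∘ₗ 𝕃 (mT K V M) := by
    ext x y z m
    simp [mT, mu, mul_assoc]
  exact LinearMap.congr_fun h t

theorem mT_one (t : 𝕋 ⊗[K] M) : mT K V M ((1 : 𝕋) ⊗ₜ t) = t := by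
  have h : mT K V M ∘ₗ TensorProduct.mk K _ _ (1 : 𝕋) = LinearMap.id := by
    refine TensorProduct.ext' fun x m => ?_
    simp [mT_tmul]
  exact LinearMap.congr_fun h t

@[elab_as_elim]
theorem tensor_induction {C : 𝕋 → Prop} (one : C 1) (gen : ∀ v, C (𝛊 v))
    (mul : ∀ a b, C a → C b → C (a * b)) (add : ∀ a b, C a → C b → C (a + b))
    (smul : ∀ (r : K) a, C a → C (r • a)) (a : 𝕋) : C a :=
  TensorAlgebra.induction (fun r => by rw [Algebra.algebraMap_eq_smul_one]; exact smul r 1 one)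
    gen mul add a

/-- The right action of `T(V)` on `T(V) ⊗ V`. -/
def rAct (t : 𝕋) : Module.End K (𝕋 ⊗[K] V) := MulOpposite.unop (braidAct c t)

theorem rAct_one : rAct c 1 = LinearMap.id := by
  rw [rAct, map_one]; rfl

theorem rAct_mul (s t : 𝕋) (q) : rAct c (s * t) q = rAct c t (rAct c s q) := by
  rw [rAct, map_mul, MulOpposite.unop_mul]; rfl

theorem rAct_ι (s : 𝕋) (v w : V) :
    rAct c (𝛊 w) (s ⊗ₜ v) = mT K V V (s ⊗ₜ (TensorAlgebra.ι K).rTensor V (c (v ⊗ₜ w))) := by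
  simp only [rAct, braidAct, TensorAlgebra.lift_ι_apply, LinearMap.comp_apply, LinearEquiv.coe_coe,
    MulOpposite.coe_opLinearEquiv, MulOpposite.unop_op, LinearMap.flip_apply,
    TensorProduct.curry_apply, TensorProduct.assoc_tmul, LinearMap.lTensor_tmul]
  generalize c (v ⊗ₜ w) = z
  induction z with
  | zero => simp
  | tmul x y => simp [mT_tmul]
  | add a b ha hb => simp only [TensorProduct.tmul_add, map_add, ha, hb]

/-- The letters passed by v are appended on the right of the first factor, so they do not interact
with a multiplication from its left. Hence the action is determined by its values on 1 ⊗ v, which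
are the values of `braidVT`. -/
theorem rAct_mT (b : 𝕋) : ∀ q : 𝕋 ⊗[K] (𝕋 ⊗[K] V),
    rAct c b (mT K V V q) = mT K V V (𝕃 (rAct c b) q) := by
  induction b using tensor_induction with
  | one => intro q; rw [rAct_one, LinearMap.lTensor_id]; rfl
  | gen w =>
    intro q
    have h : rAct c (𝛊 w) ∘ₗ mT K V V = mT K V V ∘ₗ 𝕃 (rAct c (𝛊 w)) := by
      refine TensorProduct.ext_threefold' fun x y v => ?_
      simp only [LinearMap.comp_apply, LinearMap.lTensor_tmul, mT_tmul, rAct_ι]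
      generalize (TensorAlgebra.ι K).rTensor V (c (v ⊗ₜ w)) = z
      induction z with
      | zero => simp
      | tmul x y => simp only [mT_tmul, mul_assoc]
      | add a b ha hb => simp only [TensorProduct.tmul_add, map_add, ha, hb]
    exact LinearMap.congr_fun h q
  | mul a b ha hb =>
    intro q
    have h : rAct c (a * b) = rAct c b ∘ₗ rAct c a := LinearMap.ext (rAct_mul c a b)
    rw [h, LinearMap.comp_apply, ha, hb, LinearMap.lTensor_comp_apply]
  | add a b ha hb =>
    intro q
    have h : rAct c (a + b) = rAct c a + rAct c b := by
      rw [rAct, map_add]; rfl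
    rw [h, LinearMap.add_apply, ha, hb, LinearMap.lTensor_add, LinearMap.add_apply, map_add]
  | smul r a ha =>
    intro q
    have h : rAct c (r • a) = r • rAct c a := by
      rw [rAct, map_smul]; rfl
    rw [h, LinearMap.smul_apply, ha, LinearMap.lTensor_smul, LinearMap.smul_apply, map_smul]

theorem braidVT_tmul (v : V) (t : 𝕋) : braidVT c (v ⊗ₜ t) = rAct c t (1 ⊗ₜ v) := rfl

theorem rAct_tmul (s t : 𝕋) (v : V) :
    rAct c t (s ⊗ₜ v) = mT K V V (s ⊗ₜ braidVT c (v ⊗ₜ t)) := by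
  have h : s ⊗ₜ[K] v = mT K V V (s ⊗ₜ (1 ⊗ₜ v)) := by rw [mT_tmul, mul_one]
  rw [h, rAct_mT, LinearMap.lTensor_tmul, braidVT_tmul]

theorem braidVT_one (v : V) : braidVT c (v ⊗ₜ (1 : 𝕋)) = 1 ⊗ₜ v := by
  rw [braidVT_tmul, rAct_one, LinearMap.id_apply]

theorem braidVT_ι (v w : V) :
    braidVT c (v ⊗ₜ 𝛊 w) = (TensorAlgebra.ι K).rTensor V (c (v ⊗ₜ w)) := by
  rw [braidVT_tmul, rAct_ι, mT_one]

/-- A vector passes a product by passing its factors one after the other, because `braidVT` comes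
from a right action of the tensor algebra. -/
theorem bVT_mT (t : V ⊗[K] (𝕋 ⊗[K] (𝕋 ⊗[K] M))) :
    bVT c M (𝕃 (mT K V M) t) = mT K V _ (𝕃 (bVT c M) (bVT c _ t)) := by
  have h : bVT c M ∘ₗ 𝕃 (mT K V M) = mT K V _ ∘ₗ 𝕃 (bVT c M) ∘ₗ bVT c _ := by
    ext v x y m
    have key : ∀ q : 𝕋 ⊗[K] V, 𝕃 ((TensorProduct.mk K V M).flip m) (rAct c y q)
        = mT K V _ (𝕃 (bVT c M) (𝕃 ((TensorProduct.mk K V (𝕋 ⊗[K] M)).flip (y ⊗ₜ m)) q)) := by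
      intro q
      induction q with
      | zero => simp
      | tmul s v =>
        rw [rAct_tmul, ← mu_nat]
        simp only [LinearMap.lTensor_tmul, LinearMap.flip_apply, TensorProduct.mk_apply, br_tmul]
      | add a b ha hb => simp only [map_add, ha, hb]
    simpa [br_tmul, mT_tmul, braidVT_tmul, rAct_mul] using key (braidVT c (v ⊗ₜ x))
  exact LinearMap.congr_fun h t

theorem bVT_one (t : V ⊗[K] M) :
    bVT c M (𝕃 (TensorProduct.mk K 𝕋 M 1) t) = 1 ⊗ₜ t := by
  have h : bVT c M ∘ₗ 𝕃 (TensorProduct.mk K 𝕋 M 1) = TensorProduct.mk K 𝕋 _ 1 :=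
    TensorProduct.ext' fun v m => by simp [br_tmul, braidVT_one]
  exact LinearMap.congr_fun h t

/-- The inclusion of `V` into `T(V)` on the first factor. -/
abbrev gT (K : Type u) [Field K] (V : Type v) [AddCommGroup V] [Module K V] (M : Type*)
    [AddCommGroup M] [Module K M] : V ⊗[K] M →ₗ[K] TensorAlgebra K V ⊗[K] M :=
  (TensorAlgebra.ι K).rTensor M

theorem gT_nat (g : M →ₗ[K] N) (t : V ⊗[K] M) : gT K V N (𝕃 g t) = 𝕃 g (gT K V M t) := by
  have h : gT K V N ∘ₗ 𝕃 g = 𝕃 g ∘ₗ gT K V M := by ext; rfl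
  exact LinearMap.congr_fun h t

theorem bVT_gT (t : V ⊗[K] (V ⊗[K] M)) :
    bVT c M (𝕃 (gT K V M) t) = gT K V _ (br c M t) := by
  have h : bVT c M ∘ₗ 𝕃 (gT K V M) = gT K V _ ∘ₗ br c M := by
    refine TensorProduct.ext_threefold' fun v w m => ?_
    simp only [LinearMap.comp_apply, LinearMap.lTensor_tmul, LinearMap.rTensor_tmul, br_tmul,
      braidVT_ι, gT_nat]
  exact LinearMap.congr_fun h t

/-- The left action of `T(V)` on `T(V) ⊗ T(V)`. -/
abbrev lAct (x : 𝕋) : Module.End K (𝕋 ⊗[K] 𝕋) := braidAct' c x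

theorem braidT_tmul (x z : 𝕋) : braidT c (x ⊗ₜ z) = lAct c x (z ⊗ₜ 1) := rfl

theorem lAct_ι (v : V) (z t : 𝕋) :
    lAct c (𝛊 v) (z ⊗ₜ t) = 𝕃 (LinearMap.mul' K 𝕋 ∘ₗ (TensorAlgebra.ι K).rTensor _)
      (bVT c 𝕋 (v ⊗ₜ (z ⊗ₜ t))) := by
  simp only [lAct, braidAct', TensorAlgebra.lift_ι_apply]
  rfl

/-- The letters of x arrive on the left of the second factor, so multiplication of that factor from
the right commutes with the action. Thus the action is determined by its values on z ⊗ 1, that is,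
by `braidT`. -/
theorem lAct_mul_right (x : 𝕋) : ∀ (q : 𝕋 ⊗[K] 𝕋) (t : 𝕋),
    lAct c x (𝕃 (LinearMap.mulRight K t) q) = 𝕃 (LinearMap.mulRight K t) (lAct c x q) := by
  induction x using tensor_induction with
  | one => intro q t; simp [lAct]
  | gen v =>
    intro q t
    induction q with
    | zero => simp
    | tmul z s =>
      rw [LinearMap.lTensor_tmul, lAct_ι, lAct_ι, br_tmul, br_tmul]
      generalize braidVT c (v ⊗ₜ z) = r
      induction r with
      | zero => simp
      | tmul x y => simp [mul_assoc]
      | add a b ha hb => simp only [map_add, ha, hb]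
    | add a b ha hb => simp only [map_add, ha, hb]
  | mul a b ha hb =>
    intro q t
    rw [lAct, map_mul, Module.End.mul_apply, Module.End.mul_apply, hb, ha]
  | add a b ha hb =>
    intro q t
    rw [lAct, map_add, LinearMap.add_apply, LinearMap.add_apply, ha, hb, map_add]
  | smul r a ha =>
    intro q t
    rw [lAct, map_smul, LinearMap.smul_apply, LinearMap.smul_apply, ha, map_smul]

theorem lAct_eq (x : 𝕋) (q : 𝕋 ⊗[K] 𝕋) :
    lAct c x q = 𝕃 (LinearMap.mul' K 𝕋) (bT c 𝕋 (x ⊗ₜ q)) := by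
  induction q with
  | zero => simp
  | tmul z t =>
    have h := lAct_mul_right c x (z ⊗ₜ 1) t
    rw [LinearMap.lTensor_tmul, LinearMap.mulRight_apply, one_mul] at h
    rw [h, br_tmul, ← braidT_tmul, ← LinearMap.lTensor_comp_apply]
    rfl
  | add a b ha hb => rw [map_add, ha, hb, TensorProduct.tmul_add, map_add, map_add]

theorem bT_one (t : 𝕋 ⊗[K] M) :
    bT c M ((1 : 𝕋) ⊗ₜ t) = 𝕃 (TensorProduct.mk K 𝕋 M 1) t := by
  have h : bT c M ∘ₗ TensorProduct.mk K 𝕋 _ 1 = 𝕃 (TensorProduct.mk K 𝕋 M 1) := by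
    refine TensorProduct.ext' fun z m => ?_
    simp [br_tmul, braidT_tmul, lAct]
  exact LinearMap.congr_fun h t

theorem braidT_ι (v : V) (z : 𝕋) :
    braidT c (𝛊 v ⊗ₜ z) = 𝕃 (TensorAlgebra.ι K) (braidVT c (v ⊗ₜ z)) := by
  rw [braidT_tmul, lAct_ι, br_tmul, ← LinearMap.lTensor_comp_apply]
  congr 2
  ext v
  simp

theorem bT_gT (t : V ⊗[K] (𝕋 ⊗[K] M)) :
    bT c M (gT K V _ t) = 𝕃 (gT K V M) (bVT c M t) := by
  have h : bT c M ∘ₗ gT K V _ = 𝕃 (gT K V M) ∘ₗ bVT c M := by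
    refine TensorProduct.ext_threefold' fun v z m => ?_
    simp only [LinearMap.comp_apply, LinearMap.rTensor_tmul, br_tmul, braidT_ι,
      ← LinearMap.lTensor_comp_apply]
    rfl
  exact LinearMap.congr_fun h t

/-- The braiding of a product in the first factor. -/
theorem bT_mT (t : 𝕋 ⊗[K] (𝕋 ⊗[K] (𝕋 ⊗[K] M))) :
    bT c M (mT K V _ t) = 𝕃 (mT K V M) (bT c _ (𝕃 (bT c M) t)) := by
  have h : bT c M ∘ₗ mT K V _ = 𝕃 (mT K V M) ∘ₗ bT c _ ∘ₗ 𝕃 (bT c M) := by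
    ext x y z m
    have h1 : braidT c ((x * y) ⊗ₜ z) = 𝕃 (LinearMap.mul' K 𝕋) (bT c 𝕋 (x ⊗ₜ braidT c (y ⊗ₜ z))) := by
      rw [braidT_tmul, lAct, map_mul, Module.End.mul_apply, ← lAct_eq, braidT_tmul]
    have h2 : (TensorProduct.mk K 𝕋 M).flip m ∘ₗ LinearMap.mul' K 𝕋
        = mT K V M ∘ₗ 𝕃 ((TensorProduct.mk K 𝕋 M).flip m) := TensorProduct.ext' fun x y => rfl
    have h3 : bT c M ((x * y) ⊗ₜ (z ⊗ₜ m)) =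
        𝕃 (mT K V M) (bT c _ (x ⊗ₜ (bT c M (y ⊗ₜ (z ⊗ₜ m))))) := by
      rw [br_tmul, h1, ← LinearMap.lTensor_comp_apply, h2, LinearMap.lTensor_comp_apply, ← br_nat,
        LinearMap.lTensor_tmul, br_tmul]
    exact h3
  exact LinearMap.congr_fun h t

theorem mT_tmul' {M : Type*} [AddCommGroup M] [Module K M] (a b : 𝕋) (s : M) :
    (a * b) ⊗ₜ[K] s = mT K V M (a ⊗ₜ (b ⊗ₜ s)) := rfl

end TensorAlg

attribute [irreducible] br mu de ep

/-! ### The hexagon and the Yang-Baxter equation for the braiding of the tensor algebra. -/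

section TensorAlgBraiding

variable {K : Type u} [Field K] {V : Type v} [AddCommGroup V] [Module K V]
variable (c : V ⊗[K] V →ₗ[K] V ⊗[K] V)

local notation "𝕃" => LinearMap.lTensor _
local notation "𝕋" => TensorAlgebra K V
local notation "𝛊" => TensorAlgebra.ι K (M := V)
local notation "𝕜" => TensorProduct.mk K _ _

theorem mk_nat {X M N : Type*} [AddCommGroup X] [Module K X] [AddCommGroup M] [Module K M]
    [AddCommGroup N] [Module K N] (g : M →ₗ[K] N) (x : X) (t : M) :
    TensorProduct.mk K X N x (g t) = 𝕃 g (TensorProduct.mk K X M x t) := rfl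

theorem mk_mul {M : Type*} [AddCommGroup M] [Module K M] (a b : 𝕋) :
    TensorProduct.mk K 𝕋 M (a * b) = mT K V M ∘ₗ 𝕜 a ∘ₗ 𝕜 b :=
  LinearMap.ext fun t => mT_tmul' a b t

theorem mk_ι {M : Type*} [AddCommGroup M] [Module K M] (v : V) :
    TensorProduct.mk K 𝕋 M (𝛊 v) = gT K V M ∘ₗ 𝕜 v := rfl

/-- The braiding of a product in the second factor. -/
theorem bT_lTensor_mT_tmul (x : 𝕋) : ∀ (M : Type (max u v)) [AddCommGroup M] [Module K M]
    (t : 𝕋 ⊗[K] (𝕋 ⊗[K] M)),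
    bT c M (x ⊗ₜ mT K V M t) = mT K V _ (𝕃 (bT c M) (bT c _ (x ⊗ₜ t))) := by
  -- The tail M stays general: for a product a * b the two induction hypotheses are applied with the
  -- tails 𝕋 ⊗ M and M. The universe of M is fixed so that it also contains 𝕋 ⊗ M.
  induction x using tensor_induction with
  | one =>
    intro M _ _ t
    rw [bT_one, bT_one, sh21 (h := 𝕃 (𝕜 1)) (bT_one c), mu_nat]
  | gen v =>
    intro M _ _ t
    have h : ∀ (N : Type (max u v)) [AddCommGroup N] [Module K N] (s : N), 𝛊 v ⊗ₜ[K] s = gT K V N (v ⊗ₜ s) :=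
      fun _ _ _ _ => rfl
    rw [h, h, bT_gT, bT_gT, ← LinearMap.lTensor_tmul, bVT_mT, sh22 (bT_gT c), mu_nat]
  | mul a b ha hb =>
    intro M _ _ t
    have h : ∀ (N : Type (max u v)) [AddCommGroup N] [Module K N] (s : N),
        (a * b) ⊗ₜ[K] s = mT K V N (a ⊗ₜ (b ⊗ₜ s)) := fun _ _ _ s => mT_tmul' a b s
    rw [h, h, bT_mT, bT_mT, LinearMap.lTensor_tmul, hb, ha, LinearMap.lTensor_tmul,
      sh23 (bT_mT c), mu_nat, ← br_nat, LinearMap.lTensor_tmul]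
  | add a b ha hb =>
    intro M _ _ t
    simp only [TensorProduct.add_tmul, map_add, ha, hb]
  | smul r a ha =>
    intro M _ _ t
    simp only [← TensorProduct.smul_tmul', map_smul, ha]

theorem bT_lTensor_mT {M : Type (max u v)} [AddCommGroup M] [Module K M]
    (t : 𝕋 ⊗[K] (𝕋 ⊗[K] (𝕋 ⊗[K] M))) :
    bT c M (𝕃 (mT K V M) t) = mT K V _ (𝕃 (bT c M) (bT c _ t)) := by
  induction t with
  | zero => simp
  | tmul x t => exact bT_lTensor_mT_tmul c x M t
  | add a b ha hb => simp only [map_add, ha, hb]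

theorem isBraiding_iff {A : Type*} [AddCommGroup A] [Module K A]
    (c : A ⊗[K] A →ₗ[K] A ⊗[K] A) :
    IsBraiding c ↔ ∀ t, br c A (𝕃 c (br c A t)) = 𝕃 c (br c A (𝕃 c t)) := by
  have h1 : ∀ t, br c A t = TensorProduct.assoc K A A A (c₁ c ((TensorProduct.assoc K A A A).symm t)) :=
    fun _ => by rw [br]; rfl
  have h2 : ∀ t, 𝕃 c t = TensorProduct.assoc K A A A (c₂ c ((TensorProduct.assoc K A A A).symm t)) :=
    fun t => by simp [c₂]
  rw [IsBraiding, LinearMap.ext_iff, (TensorProduct.assoc K A A A).symm.surjective.forall]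
  refine forall_congr' fun t => ?_
  simp only [h1, h2, LinearMap.comp_apply, LinearEquiv.symm_apply_apply, EmbeddingLike.apply_eq_iff_eq]

/-- The braiding of `V` satisfies the Yang-Baxter equation in front of a tail. -/
theorem yb_VVV (hc : IsBraiding c) {M : Type*} [AddCommGroup M] [Module K M]
    (t : V ⊗[K] (V ⊗[K] (V ⊗[K] M))) :
    br c _ (𝕃 (br c M) (br c _ t)) = 𝕃 (br c M) (br c _ (𝕃 (br c M) t)) := by
  have h : br c _ ∘ₗ 𝕃 (br c M) ∘ₗ br c _ = 𝕃 (br c M) ∘ₗ br c _ ∘ₗ 𝕃 (br c M) := by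
    ext x y z m
    have h1 : ∀ s : V ⊗[K] V, br c M (𝕃 ((TensorProduct.mk K V M).flip m) s)
        = 𝕃 ((TensorProduct.mk K V M).flip m) (c s) := fun s => by
      induction s with
      | zero => simp
      | tmul x y => exact br_tmul c x y m
      | add a b ha hb => simp only [map_add, ha, hb]
    have h2 := congrArg (𝕃 (𝕃 ((TensorProduct.mk K V M).flip m)))
      ((isBraiding_iff c).1 hc (x ⊗ₜ (y ⊗ₜ z)))
    rw [← br_nat, ← sh22 h1, ← br_nat, ← sh22 h1, ← br_nat, ← sh22 h1] at h2
    exact h2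
  exact LinearMap.congr_fun h t

/-- The Yang-Baxter equation is extended from V ⊗ V ⊗ V one strand at a time: first the third strand
becomes a tensor, then the second, then the first. Here z is inserted as the third strand by 𝕃 (𝕃 (𝕜
z)), so that induction on z is possible; a product is split by the hexagon. -/
theorem yb_VVT_aux (hc : IsBraiding c) (z : 𝕋) :
    ∀ (M : Type (max u v)) [AddCommGroup M] [Module K M] (s : V ⊗[K] (V ⊗[K] M)),
    bVT c _ (𝕃 (bVT c M) (br c _ (𝕃 (𝕃 (𝕜 z)) s)))
      = 𝕃 (br c M) (bVT c _ (𝕃 (bVT c M) (𝕃 (𝕃 (𝕜 z)) s))) := by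
  induction z using tensor_induction with
  | one =>
    intro M _ _ s
    rw [br_nat, sh21 (h := 𝕜 1) (bVT_one c), sh21 (h := 𝕜 1) (bVT_one c), bVT_one, bVT_one]
    rfl
  | gen w =>
    intro M _ _ s
    rw [mk_ι]
    simp only [LinearMap.lTensor_comp, LinearMap.comp_apply]
    rw [br_nat, sh22 (bVT_gT c), bVT_gT, sh22 (bVT_gT c), bVT_gT, yb_VVV c hc, gT_nat]
  | mul a b ha hb =>
    intro M _ _ s
    rw [mk_mul]
    simp only [LinearMap.lTensor_comp, LinearMap.comp_apply]
    have h1 : 𝕃 (𝕃 (𝕜 a)) (𝕃 (𝕃 (TensorProduct.mk K 𝕋 M b)) s)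
        = 𝕃 (𝕃 (𝕃 (TensorProduct.mk K 𝕋 M b))) (𝕃 (𝕃 (TensorProduct.mk K 𝕋 M a)) s) :=
      sh22 (sh22 (mk_nat _ a)) s
    rw [br_nat, sh23 (bVT_mT c), bVT_mT, br_nat, ha, h1, sh22 (br_nat _ _), br_nat,
      sh44 (hb M), sh23 (bVT_mT c), bVT_mT, br_nat (f := braidVT c) (g := bVT c M), ← mu_nat,
      sh22 (br_nat _ _), br_nat]
  | add a b ha hb =>
    intro M _ _ s
    simp only [map_add, LinearMap.lTensor_add, LinearMap.add_apply, ha, hb]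
  | smul r a ha =>
    intro M _ _ s
    simp only [map_smul, LinearMap.lTensor_smul, LinearMap.smul_apply, ha]

theorem yb_VVT (hc : IsBraiding c) {M : Type (max u v)} [AddCommGroup M] [Module K M]
    (t : V ⊗[K] (V ⊗[K] (𝕋 ⊗[K] M))) :
    bVT c _ (𝕃 (bVT c M) (br c _ t)) = 𝕃 (br c M) (bVT c _ (𝕃 (bVT c M) t)) := by
  have h : bVT c _ ∘ₗ 𝕃 (bVT c M) ∘ₗ br c _ = 𝕃 (br c M) ∘ₗ bVT c _ ∘ₗ 𝕃 (bVT c M) := by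
    refine TensorProduct.ext_threefold' fun x y t => ?_
    induction t with
    | zero => simp
    | tmul z m => exact yb_VVT_aux c hc z M (x ⊗ₜ (y ⊗ₜ m))
    | add a b ha hb => simp only [TensorProduct.tmul_add, map_add, ha, hb]
  exact LinearMap.congr_fun h t

/-- Induction on the second strand; for a letter the equation is `yb_VVT`, for a product the
hexagons reduce it to the factors. -/
theorem yb_VTT_aux (hc : IsBraiding c) (y : 𝕋) :
    ∀ (M : Type (max u v)) [AddCommGroup M] [Module K M] (s : V ⊗[K] (𝕋 ⊗[K] M)),
    bT c _ (𝕃 (bVT c M) (bVT c _ (𝕃 (𝕜 y) s)))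
      = 𝕃 (bVT c M) (bVT c _ (𝕃 (bT c M) (𝕃 (𝕜 y) s))) := by
  induction y using tensor_induction with
  | one =>
    intro M _ _ s
    rw [bVT_one, LinearMap.lTensor_tmul, bT_one, sh21 (h := 𝕃 (𝕜 1)) (bT_one c), br_nat,
      sh21 (h := 𝕜 1) (bVT_one c)]
  | gen w =>
    intro M _ _ s
    rw [mk_ι]
    simp only [LinearMap.lTensor_comp, LinearMap.comp_apply]
    rw [bVT_gT, ← gT_nat, bT_gT, yb_VVT c hc, sh22 (bT_gT c), br_nat, sh22 (bVT_gT c)]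
  | mul a b ha hb =>
    intro M _ _ s
    rw [mk_mul]
    simp only [LinearMap.lTensor_comp, LinearMap.comp_apply]
    have h1 : 𝕃 (𝕜 a) (𝕃 (TensorProduct.mk K 𝕋 _ b) s)
        = 𝕃 (𝕃 (TensorProduct.mk K 𝕋 _ b)) (𝕃 (TensorProduct.mk K 𝕋 _ a) s) :=
      sh22 (mk_nat _ a) s
    have h2 : ∀ r : V ⊗[K] (𝕋 ⊗[K] (𝕋 ⊗[K] M)),
        𝕃 (𝕃 (bT c M)) (𝕃 (TensorProduct.mk K 𝕋 _ a) r)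
        = 𝕃 (TensorProduct.mk K 𝕋 _ a) (𝕃 (bT c M) r) :=
      sh22 fun _ => rfl
    rw [bVT_mT, ← mu_nat, bT_mT, sh23 (bT_mT c), br_nat, sh23 (bVT_mT c)]
    congr 1
    rw [h2, ← ha, ← h2, br_nat (g := bT c M), ← br_nat (g := bVT c M), h1, br_nat (g := 𝕜 b),
      sh44 (hb M)]
  | add a b ha hb =>
    intro M _ _ s
    simp only [map_add, LinearMap.lTensor_add, LinearMap.add_apply, ha, hb]
  | smul r a ha =>
    intro M _ _ s
    simp only [map_smul, LinearMap.lTensor_smul, LinearMap.smul_apply, ha]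

theorem yb_VTT (hc : IsBraiding c) {M : Type (max u v)} [AddCommGroup M] [Module K M]
    (t : V ⊗[K] (𝕋 ⊗[K] (𝕋 ⊗[K] M))) :
    bT c _ (𝕃 (bVT c M) (bVT c _ t)) = 𝕃 (bVT c M) (bVT c _ (𝕃 (bT c M) t)) := by
  have h : bT c _ ∘ₗ 𝕃 (bVT c M) ∘ₗ bVT c _ = 𝕃 (bVT c M) ∘ₗ bVT c _ ∘ₗ 𝕃 (bT c M) := by
    refine TensorProduct.ext_threefold' fun x y t => ?_
    exact yb_VTT_aux c hc y M (x ⊗ₜ t)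
  exact LinearMap.congr_fun h t

/-- Induction on the first strand, starting from `yb_VTT` for a letter. -/
theorem yb_TTT_aux (hc : IsBraiding c) (x : 𝕋) :
    ∀ (M : Type (max u v)) [AddCommGroup M] [Module K M] (s : 𝕋 ⊗[K] (𝕋 ⊗[K] M)),
    bT c _ (𝕃 (bT c M) (bT c _ (x ⊗ₜ s)))
      = 𝕃 (bT c M) (bT c _ (𝕃 (bT c M) (x ⊗ₜ s))) := by
  induction x using tensor_induction with
  | one =>
    intro M _ _ s
    rw [bT_one, sh21 (h := 𝕃 (𝕜 1)) (bT_one c), br_nat, LinearMap.lTensor_tmul, bT_one,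
      sh21 (h := 𝕃 (𝕜 1)) (bT_one c)]
  | gen v =>
    intro M _ _ s
    have h : 𝛊 v ⊗ₜ[K] s = gT K V _ (v ⊗ₜ s) := rfl
    rw [h, bT_gT, sh22 (bT_gT c), br_nat, yb_VTT c hc, ← gT_nat, bT_gT, sh22 (bT_gT c)]
  | mul a b ha hb =>
    intro M _ _ s
    have h : (a * b) ⊗ₜ[K] s = mT K V _ (a ⊗ₜ (b ⊗ₜ s)) := mT_tmul' a b s
    rw [h, bT_mT, sh23 (bT_mT c), br_nat, ← mu_nat, bT_mT, sh23 (bT_mT c)]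
    congr 1
    rw [← br_nat]
    simp only [LinearMap.lTensor_tmul]
    rw [ha]
    simp only [LinearMap.lTensor_tmul]
    have h1 := hb M s
    simp only [LinearMap.lTensor_tmul] at h1
    rw [h1, ← LinearMap.lTensor_tmul, br_nat]
  | add a b ha hb =>
    intro M _ _ s
    simp only [TensorProduct.add_tmul, map_add, ha, hb]
  | smul r a ha =>
    intro M _ _ s
    simp only [← TensorProduct.smul_tmul', map_smul, ha]

theorem yb_TTT (hc : IsBraiding c) {M : Type (max u v)} [AddCommGroup M] [Module K M]
    (t : 𝕋 ⊗[K] (𝕋 ⊗[K] (𝕋 ⊗[K] M))) :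
    bT c _ (𝕃 (bT c M) (bT c _ t)) = 𝕃 (bT c M) (bT c _ (𝕃 (bT c M) t)) := by
  induction t with
  | zero => simp
  | tmul x t => exact yb_TTT_aux c hc x M t
  | add a b ha hb => simp only [map_add, ha, hb]

end TensorAlgBraiding

/-! ### The comultiplication of the tensor algebra: multiplicativity and compatibility with the
braiding. -/

section TensorAlgComul

variable {K : Type u} [Field K] {V : Type v} [AddCommGroup V] [Module K V]
variable (c : V ⊗[K] V →ₗ[K] V ⊗[K] V)

local notation "𝕃" => LinearMap.lTensor _
local notation "𝕋" => TensorAlgebra K V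
local notation "𝛊" => TensorAlgebra.ι K (M := V)
local notation "𝕜" => TensorProduct.mk K _ _

theorem sh34 {X Y S A₁ A₂ A₃ A₄ A₅ : Type*} [AddCommGroup X] [Module K X] [AddCommGroup Y]
    [Module K Y] [AddCommGroup S] [Module K S]
    [AddCommGroup A₁] [Module K A₁] [AddCommGroup A₂] [Module K A₂]
    [AddCommGroup A₃] [Module K A₃] [AddCommGroup A₄] [Module K A₄] [AddCommGroup A₅] [Module K A₅]
    {f₁ : A₁ →ₗ[K] Y} {f₂ : A₂ →ₗ[K] A₁} {f₃ : X →ₗ[K] A₂}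
    {g₁ : A₃ →ₗ[K] Y} {g₂ : A₄ →ₗ[K] A₃} {g₃ : A₅ →ₗ[K] A₄} {g₄ : X →ₗ[K] A₅}
    (H : ∀ t, f₁ (f₂ (f₃ t)) = g₁ (g₂ (g₃ (g₄ t)))) (t : S ⊗[K] X) :
    𝕃 f₁ (𝕃 f₂ (𝕃 f₃ t)) = 𝕃 g₁ (𝕃 g₂ (𝕃 g₃ (𝕃 g₄ t))) := by
  rw [sh33 (h := g₁) (k := g₂) (l := g₃ ∘ₗ g₄) H, LinearMap.lTensor_comp_apply]

/-- The comultiplication of the tensor algebra on the first factor. -/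
abbrev dT (M : Type*) [AddCommGroup M] [Module K M] := de (comulT c) M

theorem mulTT_tmul (p q : 𝕋 ⊗[K] 𝕋) :
    mulTT c (p ⊗ₜ q) = 𝕃 (LinearMap.mul' K 𝕋) (mT K V _ (𝕃 (bT c 𝕋)
      (TensorProduct.assoc K 𝕋 𝕋 _ (p ⊗ₜ q)))) := by
  have h : ∀ z : 𝕋 ⊗[K] (𝕋 ⊗[K] (𝕋 ⊗[K] 𝕋)),
      TensorProduct.map (LinearMap.mul' K 𝕋) (LinearMap.mul' K 𝕋)
        ((TensorProduct.assoc K 𝕋 𝕋 (𝕋 ⊗[K] 𝕋)).symm z)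
      = 𝕃 (LinearMap.mul' K 𝕋) (mT K V _ z) := by
    have : TensorProduct.map (LinearMap.mul' K 𝕋) (LinearMap.mul' K 𝕋) ∘ₗ
        (TensorProduct.assoc K 𝕋 𝕋 (𝕋 ⊗[K] 𝕋)).symm.toLinearMap
        = 𝕃 (LinearMap.mul' K 𝕋) ∘ₗ mT K V _ :=
      TensorProduct.ext_threefold' fun x y z => by
        induction z with
        | zero => simp
        | tmul z w => simp [mT_tmul]
        | add a b ha hb => simp only [TensorProduct.tmul_add, map_add, ha, hb]
    exact LinearMap.congr_fun this
  rw [mulTT, LinearMap.comp_apply, cMid, LinearMap.comp_apply, LinearEquiv.coe_coe, h, bT, br]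
  rfl

theorem comulT_one : comulT c (1 : 𝕋) = 1 ⊗ₜ 1 := by
  rw [comulT, LinearMap.flip_apply, AlgHom.toLinearMap_apply, map_one]
  rfl

theorem comulT_ι_mul (v : V) (y : 𝕋) :
    comulT c (𝛊 v * y) = mulTT c ((𝛊 v ⊗ₜ 1 + 1 ⊗ₜ 𝛊 v) ⊗ₜ comulT c y) := by
  rw [comulT, LinearMap.flip_apply, AlgHom.toLinearMap_apply, map_mul, TensorAlgebra.lift_ι_apply]
  rfl

theorem dT_one {M : Type*} [AddCommGroup M] [Module K M] (t : M) :
    dT c M ((1 : 𝕋) ⊗ₜ t) = 1 ⊗ₜ (1 ⊗ₜ t) := by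
  rw [de_tmul, comulT_one]; rfl

theorem comulT_ι_mul' (v : V) (y : 𝕋) :
    comulT c (𝛊 v * y) = 𝕃 (LinearMap.mul' K 𝕋) (mT K V _ (𝕃 (bT c 𝕋)
      (𝛊 v ⊗ₜ (1 ⊗ₜ comulT c y) + 1 ⊗ₜ (𝛊 v ⊗ₜ comulT c y)))) := by
  rw [comulT_ι_mul, mulTT_tmul, TensorProduct.add_tmul, map_add]
  rfl

theorem comulT_ι (v : V) : comulT c (𝛊 v) = 𝛊 v ⊗ₜ 1 + 1 ⊗ₜ 𝛊 v := by
  have h := comulT_ι_mul' c v 1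
  rw [mul_one] at h
  rw [h, map_add, LinearMap.lTensor_tmul, LinearMap.lTensor_tmul, bT_one, comulT_one, br_tmul,
    braidT_ι, braidVT_one]
  simp [mT_tmul]

theorem dT_gT {M : Type*} [AddCommGroup M] [Module K M] (t : V ⊗[K] M) :
    dT c M (gT K V M t) = gT K V _ (𝕃 (𝕜 1) t) + 1 ⊗ₜ gT K V M t := by
  have h : dT c M ∘ₗ gT K V M = gT K V _ ∘ₗ 𝕃 (TensorProduct.mk K 𝕋 M 1)
      + TensorProduct.mk K 𝕋 _ 1 ∘ₗ gT K V M := by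
    refine TensorProduct.ext' fun v m => ?_
    simp only [LinearMap.comp_apply, LinearMap.rTensor_tmul, de_tmul, comulT_ι, map_add]
    rfl
  exact LinearMap.congr_fun h t

-- This is associativity of the product `mulTT` on 𝕋 ⊗ 𝕋 in front of a tail: three pairs of strands
-- are multiplied with either bracketing. It needs only associativity of 𝕋 and the two hexagons, not
-- the Yang-Baxter equation.
set_option maxHeartbeats 800000 in
theorem mulTT_assoc {M : Type (max u v)} [AddCommGroup M] [Module K M]
    (p : 𝕋 ⊗[K] (𝕋 ⊗[K] (𝕋 ⊗[K] (𝕋 ⊗[K] (𝕋 ⊗[K] (𝕋 ⊗[K] M)))))) :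
    𝕃 (mT K V M) (mT K V (𝕋 ⊗[K] (𝕋 ⊗[K] M)) (𝕃 (bT c (𝕋 ⊗[K] M)) (𝕃 (𝕃 (𝕃 (mT K V M)))
      (𝕃 (𝕃 (mT K V (𝕋 ⊗[K] (𝕋 ⊗[K] M)))) (𝕃 (𝕃 (𝕃 (bT c (𝕋 ⊗[K] M)))) p)))))
    = 𝕃 (mT K V M) (mT K V (𝕋 ⊗[K] (𝕋 ⊗[K] M)) (𝕃 (bT c (𝕋 ⊗[K] M))
      (𝕃 (mT K V (𝕋 ⊗[K] (𝕋 ⊗[K] M))) (mT K V (𝕋 ⊗[K] (𝕋 ⊗[K] (𝕋 ⊗[K] (𝕋 ⊗[K] M))))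
        (𝕃 (bT c (𝕋 ⊗[K] (𝕋 ⊗[K] (𝕋 ⊗[K] M)))) p))))) := by
  have e1 := sh22 (S := 𝕋) (br_nat (braidT c) (mT K V M))
  have e2 := sh23 (S := 𝕋) (bT_lTensor_mT c (M := 𝕋 ⊗[K] (𝕋 ⊗[K] M)))
  have e3 := sh23 (S := 𝕋) (bT_mT c (M := 𝕋 ⊗[K] M))
  have e4 := sh22 (S := 𝕋) (mT_assoc (K := K) (V := V) (M := M))
  have e5 := sh22 (S := 𝕋) (br_nat (braidT c) (bT c (𝕋 ⊗[K] M)))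
  have n1 := mu_nat (LinearMap.mul' K 𝕋) (LinearMap.lTensor 𝕋 (mT K V M))
  have n2 := mu_nat (LinearMap.mul' K 𝕋) (mT K V (𝕋 ⊗[K] M))
  have n3 := mu_nat (LinearMap.mul' K 𝕋) (LinearMap.lTensor 𝕋 (bT c (𝕋 ⊗[K] M)))
  have n4 := mu_nat (LinearMap.mul' K 𝕋) (bT c (𝕋 ⊗[K] (𝕋 ⊗[K] M)))
  rw [e1, e2, n1, ← e4, ← mT_assoc, e5, e3, n2, ← n3, ← n4]

/-- The comultiplication was defined through left multiplications by v ⊗ 1 + 1 ⊗ v, so the case of a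
letter is the definition. The case of a product is associativity of the product of 𝕋 ⊗ 𝕋,
`mulTT_assoc`. -/
theorem dT_mT_tmul (x : 𝕋) : ∀ (M : Type (max u v)) [AddCommGroup M] [Module K M] (s : 𝕋 ⊗[K] M),
    dT c M (mT K V M (x ⊗ₜ s))
      = 𝕃 (mT K V M) (mT K V _ (𝕃 (bT c _) (dT c _ (x ⊗ₜ dT c M s)))) := by
  induction x using tensor_induction with
  | one =>
    intro M _ _ s
    rw [mT_one, dT_one, LinearMap.lTensor_tmul, bT_one, mT_one, sh21 (h := LinearMap.id) mT_one,
      LinearMap.lTensor_id]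
    rfl
  | gen v =>
    intro M _ _ s
    induction s with
    | zero => simp
    | tmul y m =>
      have h0 : (TensorProduct.mk K 𝕋 M).flip m ∘ₗ LinearMap.mul' K 𝕋
        = mT K V M ∘ₗ 𝕃 ((TensorProduct.mk K 𝕋 M).flip m) :=
        TensorProduct.ext' fun x y => (mT_tmul' x y m).symm ▸ rfl
      rw [mT_tmul, de_tmul, comulT_ι_mul', ← LinearMap.lTensor_comp_apply, h0,
        LinearMap.lTensor_comp_apply, ← mu_nat, ← sh22 (br_nat _ _), map_add, de_tmul, de_tmul,
        comulT_ι, map_add]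
      rfl
    | add a b ha hb => simp only [TensorProduct.tmul_add, map_add, ha, hb]
  | mul a b ha hb =>
    intro M _ _ s
    have h : ∀ (N : Type (max u v)) [AddCommGroup N] [Module K N] (s : N),
        (a * b) ⊗ₜ[K] s = mT K V N (a ⊗ₜ (b ⊗ₜ s)) := fun _ _ _ s => mT_tmul' a b s
    rw [h, h, mT_assoc, LinearMap.lTensor_tmul, ha, hb, ha, ← mulTT_assoc]
    simp only [← LinearMap.lTensor_tmul, de_nat]
  | add a b ha hb =>
    intro M _ _ t
    simp only [TensorProduct.add_tmul, map_add, ha, hb]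
  | smul r a ha =>
    intro M _ _ t
    simp only [← TensorProduct.smul_tmul', map_smul, ha]

/-- The comultiplication of a product. -/
theorem dT_mT {M : Type (max u v)} [AddCommGroup M] [Module K M] (t : 𝕋 ⊗[K] (𝕋 ⊗[K] M)) :
    dT c M (mT K V M t) = 𝕃 (mT K V M) (mT K V _ (𝕃 (bT c _) (dT c _ (𝕃 (dT c M) t)))) := by
  induction t with
  | zero => simp
  | tmul x t => exact dT_mT_tmul c x M t
  | add a b ha hb => simp only [map_add, ha, hb]

-- A vector passes z before or after z is comultiplied. For z = a * b the comultiplication contains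
-- a crossing between a part of a and a part of b; sliding the strand of the vector across that
-- crossing is exactly where the Yang-Baxter equation enters.
set_option maxHeartbeats 800000 in
theorem dT_bVT_aux (hc : IsBraiding c) (z : 𝕋) : ∀ (M : Type (max u v)) [AddCommGroup M]
    [Module K M] (s : V ⊗[K] M),
    dT c _ (bVT c M (𝕃 (𝕜 z) s)) = 𝕃 (bVT c M) (bVT c _ (𝕃 (dT c M) (𝕃 (𝕜 z) s))) := by
  induction z using tensor_induction with
  | one =>
    intro M _ _ s
    rw [bVT_one, dT_one, sh22 (h := 𝕜 1) (k := 𝕜 1) (dT_one c), bVT_one, LinearMap.lTensor_tmul,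
      bVT_one]
  | gen w =>
    intro M _ _ s
    rw [mk_ι, LinearMap.lTensor_comp_apply, bVT_gT, dT_gT,
      sh21 (h := gT K V _ ∘ₗ 𝕃 (𝕜 1) + 𝕜 1 ∘ₗ gT K V M) (dT_gT c), LinearMap.lTensor_add,
      LinearMap.add_apply, LinearMap.lTensor_comp_apply, LinearMap.lTensor_comp_apply, map_add,
      map_add, bVT_gT, bVT_one, br_nat, ← gT_nat, sh21 (h := 𝕜 1) (bVT_one c),
      LinearMap.lTensor_tmul, bVT_gT]
  | mul a b ha hb =>
    intro M _ _ s
    rw [mk_mul]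
    simp only [LinearMap.lTensor_comp, LinearMap.comp_apply]
    have h1 : 𝕃 (𝕜 a) (𝕃 (TensorProduct.mk K 𝕋 _ b) s)
        = 𝕃 (𝕃 (TensorProduct.mk K 𝕋 _ b)) (𝕃 (TensorProduct.mk K 𝕋 _ a) s) :=
      sh22 (mk_nat _ a) s
    have h2 : ∀ r : V ⊗[K] (𝕋 ⊗[K] M), 𝕃 (𝕃 (dT c M)) (𝕃 (TensorProduct.mk K 𝕋 _ a) r)
        = 𝕃 (TensorProduct.mk K 𝕋 _ a) (𝕃 (dT c M) r) :=
      fun r => (sh22 (mk_nat _ a) r).symm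
    have h3 : 𝕃 (dT c _) (𝕃 (bVT c M) (bVT c _ (𝕃 (𝕜 a) (𝕃 (𝕜 b) s))))
        = 𝕃 (𝕃 (bVT c M)) (𝕃 (bVT c _) (bVT c _ (𝕃 (𝕃 (dT c M)) (𝕃 (𝕜 a) (𝕃 (𝕜 b) s))))) := by
      rw [h1, br_nat (g := 𝕜 b), sh34 (hb M), ← br_nat (g := 𝕜 b), ← br_nat (g := dT c M)]
    have e1 := sh25 (S := V) (dT_mT c (M := M))
    have e2 := sh22 (S := 𝕋) (br_nat (braidT c) (bVT c M))
    have e3 := sh33 (S := 𝕋) (yb_VTT c hc (M := 𝕋 ⊗[K] M))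
    have e4 := br_nat (braidVT c) (mT K V M)
    have e5 := sh23 (S := 𝕋) (bVT_mT c (M := M))
    have e6 := br_nat (braidVT c) (bT c (𝕋 ⊗[K] M))
    have n1 := mu_nat (LinearMap.mul' K 𝕋) (LinearMap.lTensor 𝕋 (bVT c M))
    have n2 := mu_nat (LinearMap.mul' K 𝕋) (bVT c (𝕋 ⊗[K] M))
    have d1 := de_nat (comulT c) (LinearMap.lTensor 𝕋 (bVT c M))
    have d2 := de_nat (comulT c) (bVT c (𝕋 ⊗[K] M))
    rw [bVT_mT, dT_mT, h3, d1, d2, h2, ha, ← h2, e2, e3, e1, e4, bVT_mT, e5, e6, n1, n2]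
  | add a b ha hb =>
    intro M _ _ s
    simp only [map_add, LinearMap.lTensor_add, LinearMap.add_apply, ha, hb]
  | smul r a ha =>
    intro M _ _ s
    simp only [map_smul, LinearMap.lTensor_smul, LinearMap.smul_apply, ha]

theorem dT_bVT (hc : IsBraiding c) {M : Type (max u v)} [AddCommGroup M] [Module K M]
    (t : V ⊗[K] (𝕋 ⊗[K] M)) :
    dT c _ (bVT c M t) = 𝕃 (bVT c M) (bVT c _ (𝕃 (dT c M) t)) := by
  have h : dT c _ ∘ₗ bVT c M = 𝕃 (bVT c M) ∘ₗ bVT c _ ∘ₗ 𝕃 (dT c M) :=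
    TensorProduct.ext_threefold' fun x y m => dT_bVT_aux c hc y M (x ⊗ₜ m)
  exact LinearMap.congr_fun h t

theorem dT_bT_tmul (hc : IsBraiding c) (x : 𝕋) : ∀ (M : Type (max u v)) [AddCommGroup M]
    [Module K M] (s : 𝕋 ⊗[K] M),
    dT c _ (bT c M (x ⊗ₜ s)) = 𝕃 (bT c M) (bT c _ (x ⊗ₜ dT c M s)) := by
  induction x using tensor_induction with
  | one =>
    intro M _ _ s
    rw [bT_one, de_nat, bT_one, sh21 (h := 𝕃 (𝕜 1)) (bT_one c)]
  | gen v =>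
    intro M _ _ s
    have h : ∀ (N : Type (max u v)) [AddCommGroup N] [Module K N] (s : N),
      𝛊 v ⊗ₜ[K] s = gT K V N (v ⊗ₜ s) := fun _ _ _ _ => rfl
    rw [h, h, bT_gT, de_nat, dT_bVT c hc, bT_gT, sh22 (bT_gT c), LinearMap.lTensor_tmul]
  | mul a b ha hb =>
    intro M _ _ s
    have h : ∀ (N : Type (max u v)) [AddCommGroup N] [Module K N] (s : N),
        (a * b) ⊗ₜ[K] s = mT K V N (a ⊗ₜ (b ⊗ₜ s)) := fun _ _ _ s => mT_tmul' a b s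
    rw [h, h, bT_mT, de_nat, LinearMap.lTensor_tmul, ha, hb, bT_mT, sh23 (bT_mT c),
      LinearMap.lTensor_tmul, ← br_nat, LinearMap.lTensor_tmul]
  | add a b ha hb =>
    intro M _ _ t
    simp only [TensorProduct.add_tmul, map_add, ha, hb]
  | smul r a ha =>
    intro M _ _ t
    simp only [← TensorProduct.smul_tmul', map_smul, ha]

theorem dT_bT (hc : IsBraiding c) {M : Type (max u v)} [AddCommGroup M] [Module K M]
    (t : 𝕋 ⊗[K] (𝕋 ⊗[K] M)) :
    dT c _ (bT c M t) = 𝕃 (bT c M) (bT c _ (𝕃 (dT c M) t)) := by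
  induction t with
  | zero => simp
  | tmul x t => exact dT_bT_tmul c hc x M t
  | add a b ha hb => simp only [map_add, ha, hb]

-- The strand that is comultiplied is now the one which moves to the right. For x = a * b the
-- crossing inside the comultiplication is moved past the other strand by `yb_TTT`.
set_option maxHeartbeats 800000 in
theorem lTensor_dT_bT_tmul (hc : IsBraiding c) (x : 𝕋) : ∀ (M : Type (max u v)) [AddCommGroup M]
    [Module K M] (s : 𝕋 ⊗[K] M),
    𝕃 (dT c M) (bT c M (x ⊗ₜ s)) = bT c _ (𝕃 (bT c _) (dT c _ (x ⊗ₜ s))) := by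
  induction x using tensor_induction with
  | one =>
    intro M _ _ s
    rw [bT_one, dT_one, sh22 (h := 𝕜 1) (k := 𝕜 1) (dT_one c), LinearMap.lTensor_tmul, bT_one,
      bT_one]
  | gen v =>
    intro M _ _ s
    have h : ∀ (N : Type (max u v)) [AddCommGroup N] [Module K N] (s : N),
      𝛊 v ⊗ₜ[K] s = gT K V N (v ⊗ₜ s) := fun _ _ _ _ => rfl
    have e1 := sh21 (S := V) (f := bT c M) (g := TensorProduct.mk K 𝕋 (𝕋 ⊗[K] M) 1)
      (h := LinearMap.lTensor 𝕋 (TensorProduct.mk K 𝕋 M 1)) (bT_one c (M := M))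
    rw [h, bT_gT, dT_gT, sh21 (h := gT K V _ ∘ₗ 𝕃 (𝕜 1) + 𝕜 1 ∘ₗ gT K V M) (dT_gT c),
      LinearMap.lTensor_add, LinearMap.add_apply, LinearMap.lTensor_comp_apply,
      LinearMap.lTensor_comp_apply, map_add, map_add, LinearMap.lTensor_tmul 𝕋, bT_gT,
      bT_one, ← gT_nat, bT_gT, e1, br_nat]
  | mul a b ha hb =>
    intro M _ _ s
    have h : (a * b) ⊗ₜ[K] s = mT K V _ (a ⊗ₜ (b ⊗ₜ s)) := mT_tmul' a b s
    have a1 := sh25 (S := 𝕋) (dT_mT c (M := M))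
    have a2 := br_nat (braidT c) (dT c M)
    have r2 := sh23 (S := 𝕋) (bT_mT c (M := M))
    have r3 := br_nat (braidT c) (mT K V M)
    have n1 := mu_nat (LinearMap.mul' K 𝕋) (LinearMap.lTensor 𝕋 (bT c M))
    have n2 := mu_nat (LinearMap.mul' K 𝕋) (bT c (𝕋 ⊗[K] M))
    have y1 := br_nat (braidT c) (bT c (𝕋 ⊗[K] M))
    have y2 := sh33 (S := 𝕋) (yb_TTT c hc (M := 𝕋 ⊗[K] M))
    have y3 := sh22 (S := 𝕋) (br_nat (braidT c) (bT c M))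
    have d1 := de_nat (comulT c) (bT c (𝕋 ⊗[K] M))
    have d2 := de_nat (comulT c) (LinearMap.lTensor 𝕋 (bT c M))
    rw [h, bT_mT, a1, ← a2, LinearMap.lTensor_tmul, LinearMap.lTensor_tmul, hb, ha, dT_mT,
      LinearMap.lTensor_tmul, r2, r3, ← n1, ← n2, bT_mT c (M := 𝕋 ⊗[K] (𝕋 ⊗[K] M)),
      ← LinearMap.lTensor_tmul, d1, ← LinearMap.lTensor_tmul, d2, ← y1, ← y2, y3]
  | add a b ha hb =>
    intro M _ _ t
    simp only [TensorProduct.add_tmul, map_add, ha, hb]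
  | smul r a ha =>
    intro M _ _ t
    simp only [← TensorProduct.smul_tmul', map_smul, ha]

theorem lTensor_dT_bT (hc : IsBraiding c) {M : Type (max u v)} [AddCommGroup M] [Module K M]
    (t : 𝕋 ⊗[K] (𝕋 ⊗[K] M)) :
    𝕃 (dT c M) (bT c M t) = bT c _ (𝕃 (bT c _) (dT c _ t)) := by
  induction t with
  | zero => simp
  | tmul x t => exact lTensor_dT_bT_tmul c hc x M t
  | add a b ha hb => simp only [map_add, ha, hb]

end TensorAlgComul

/-! ### Coassociativity and counit of the tensor algebra. -/

section TensorAlgCoalg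

variable {K : Type u} [Field K] {V : Type v} [AddCommGroup V] [Module K V]
variable (c : V ⊗[K] V →ₗ[K] V ⊗[K] V)

local notation "𝕃" => LinearMap.lTensor _
local notation "𝕋" => TensorAlgebra K V
local notation "𝛊" => TensorAlgebra.ι K (M := V)
local notation "𝕜" => TensorProduct.mk K _ _

-- Both iterated comultiplications are multiplicative, so agreement on letters suffices. In the case
-- of a product the comultiplication has to be moved through the crossing of `dT_mT`, from either
-- strand: `dT_bT` on one side of the equation and `lTensor_dT_bT` on the other.
set_option maxHeartbeats 800000 in
theorem dT_dT_tmul (hc : IsBraiding c) (x : 𝕋) : ∀ (M : Type (max u v)) [AddCommGroup M]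
    [Module K M] (s : M), dT c _ (dT c M (x ⊗ₜ s)) = 𝕃 (dT c M) (dT c M (x ⊗ₜ s)) := by
  induction x using tensor_induction with
  | one =>
    intro M _ _ s
    rw [dT_one, dT_one, LinearMap.lTensor_tmul, dT_one]
  | gen v =>
    intro M _ _ s
    have h : 𝛊 v ⊗ₜ[K] s = gT K V _ (v ⊗ₜ s) := rfl
    have e1 := sh22 (S := V) (f := dT c M) (g := TensorProduct.mk K 𝕋 M 1)
      (h := TensorProduct.mk K 𝕋 (𝕋 ⊗[K] M) 1) (k := TensorProduct.mk K 𝕋 M 1) (dT_one c)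
    rw [h, dT_gT, map_add, map_add, dT_gT, dT_one, ← gT_nat, e1, LinearMap.lTensor_tmul 𝕋, dT_gT,
      TensorProduct.tmul_add, ← add_assoc]
  | mul a b ha hb =>
    intro M _ _ s
    have h : (a * b) ⊗ₜ[K] s = mT K V _ (a ⊗ₜ (b ⊗ₜ s)) := mT_tmul' a b s
    have d1 := de_nat (comulT c) (mT K V M)
    have d2 := de_nat (comulT c) (LinearMap.lTensor 𝕋 (bT c (𝕋 ⊗[K] M)))
    have d3 := de_nat (comulT c) (bT c (𝕋 ⊗[K] (𝕋 ⊗[K] M)))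
    have d5 := de_nat (comulT c) (dT c (𝕋 ⊗[K] M))
    have a1 := sh23 (S := 𝕋) (dT_bT c hc (M := 𝕋 ⊗[K] M))
    have a2 := sh25 (S := 𝕋) (dT_mT c (M := M))
    have n1 := mu_nat (LinearMap.mul' K 𝕋) (dT c (𝕋 ⊗[K] (𝕋 ⊗[K] M)))
    have n2 := mu_nat (LinearMap.mul' K 𝕋) (LinearMap.lTensor 𝕋 (dT c M))
    have n3 := mu_nat (LinearMap.mul' K 𝕋) (LinearMap.lTensor 𝕋 (bT c (𝕋 ⊗[K] M)))
    have r1 := sh22 (S := 𝕋) (br_nat (braidT c) (dT c M))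
    have r2 := sh23 (S := 𝕋) (lTensor_dT_bT c hc (M := 𝕋 ⊗[K] (𝕋 ⊗[K] M)))
    have r3 := sh22 (S := 𝕋) (br_nat (braidT c) (bT c (𝕋 ⊗[K] M)))
    have d6 := de_nat (comulT c) (LinearMap.lTensor 𝕋 (dT c M))
    rw [h, dT_mT, a2, d1, dT_mT, a1, d2, d3, ← d5, ← n2, ← n1, ← n3, ← r1, r2, ← r3, ← d6]
    simp only [LinearMap.lTensor_tmul, ha, hb]
  | add a b ha hb =>
    intro M _ _ t
    simp only [TensorProduct.add_tmul, map_add, ha, hb]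
  | smul r a ha =>
    intro M _ _ t
    simp only [← TensorProduct.smul_tmul', map_smul, ha]

theorem dT_dT (hc : IsBraiding c) {M : Type (max u v)} [AddCommGroup M] [Module K M]
    (t : 𝕋 ⊗[K] M) : dT c _ (dT c M t) = 𝕃 (dT c M) (dT c M t) := by
  induction t with
  | zero => simp
  | tmul x t => exact dT_dT_tmul c hc x M t
  | add a b ha hb => simp only [map_add, ha, hb]

/-! ### The counit -/

/-- The counit of the tensor algebra. -/
abbrev counitT (K : Type u) [Field K] (V : Type v) [AddCommGroup V] [Module K V] :
    TensorAlgebra K V →ₐ[K] K :=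
  TensorAlgebra.lift K (0 : V →ₗ[K] K)

/-- The counit of the tensor algebra on the first factor. -/
abbrev eT (K : Type u) [Field K] (V : Type v) [AddCommGroup V] [Module K V] (M : Type*)
    [AddCommGroup M] [Module K M] :=
  ep (counitT K V).toLinearMap M

section

variable {M : Type*} [AddCommGroup M] [Module K M]

theorem eT_tmul (x : 𝕋) (t : M) : eT K V M (x ⊗ₜ t) = counitT K V x • t := ep_tmul _ _ _

theorem eT_one (t : M) : eT K V M ((1 : 𝕋) ⊗ₜ t) = t := by
  rw [eT_tmul, map_one, one_smul]

theorem eT_gT (t : V ⊗[K] M) : eT K V M (gT K V M t) = 0 := by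
  induction t with
  | zero => simp
  | tmul v m => rw [LinearMap.rTensor_tmul, eT_tmul, TensorAlgebra.lift_ι_apply,
      LinearMap.zero_apply, zero_smul]
  | add a b ha hb => rw [map_add, map_add, ha, hb, add_zero]

theorem eT_mT (t : 𝕋 ⊗[K] (𝕋 ⊗[K] M)) : eT K V M (mT K V M t) = eT K V M (eT K V _ t) := by
  have h : eT K V M ∘ₗ mT K V M = eT K V M ∘ₗ eT K V _ :=
    TensorProduct.ext_threefold' fun x y m => by
      simp only [LinearMap.comp_apply, mT_tmul, eT_tmul, map_mul, map_smul, mul_smul]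
  exact LinearMap.congr_fun h t

theorem eT_bVT_aux (z : 𝕋) : ∀ s : V ⊗[K] M,
    eT K V _ (bVT c M (𝕃 (TensorProduct.mk K 𝕋 M z) s)) = counitT K V z • s := by
  induction z using tensor_induction with
  | one => intro s; rw [bVT_one, eT_one, map_one, one_smul]
  | gen w =>
    intro s
    rw [mk_ι, LinearMap.lTensor_comp_apply, bVT_gT, eT_gT, TensorAlgebra.lift_ι_apply,
      LinearMap.zero_apply, zero_smul]
  | mul a b ha hb =>
    intro s
    have h1 : 𝕃 (𝕜 a) (𝕃 (TensorProduct.mk K 𝕋 _ b) s)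
        = 𝕃 (𝕃 (TensorProduct.mk K 𝕋 _ b)) (𝕃 (TensorProduct.mk K 𝕋 _ a) s) :=
      sh22 (mk_nat _ a) s
    rw [mk_mul]
    simp only [LinearMap.lTensor_comp, LinearMap.comp_apply]
    rw [bVT_mT, eT_mT, ep_nat, h1, br_nat, ep_nat, ha, map_smul, map_smul, map_smul, hb, map_mul,
      mul_smul]
  | add a b ha hb =>
    intro s
    simp only [map_add, LinearMap.lTensor_add, LinearMap.add_apply, ha, hb, add_smul]
  | smul r a ha =>
    intro s
    simp only [map_smul, LinearMap.lTensor_smul, LinearMap.smul_apply, ha, smul_assoc]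

theorem eT_bVT (t : V ⊗[K] (𝕋 ⊗[K] M)) : eT K V _ (bVT c M t) = 𝕃 (eT K V M) t := by
  have h : eT K V _ ∘ₗ bVT c M = 𝕃 (eT K V M) := TensorProduct.ext_threefold' fun v z m => by
    have := eT_bVT_aux c z (v ⊗ₜ[K] m)
    rw [LinearMap.comp_apply, LinearMap.lTensor_tmul, eT_tmul, TensorProduct.tmul_smul]
    exact this
  exact LinearMap.congr_fun h t

theorem eT_bT_tmul (x : 𝕋) : ∀ (M : Type (max u v)) [AddCommGroup M]
    [Module K M] (s : 𝕋 ⊗[K] M),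
    eT K V _ (bT c M (x ⊗ₜ s)) = x ⊗ₜ eT K V M s := by
  induction x using tensor_induction with
  | one =>
    intro M _ _ s
    rw [bT_one, ep_nat]; rfl
  | gen v =>
    intro M _ _ s
    have h : 𝛊 v ⊗ₜ[K] s = gT K V _ (v ⊗ₜ s) := rfl
    rw [h, bT_gT, ep_nat, eT_bVT]; rfl
  | mul a b ha hb =>
    intro M _ _ s
    have h : (a * b) ⊗ₜ[K] s = mT K V _ (a ⊗ₜ (b ⊗ₜ s)) := mT_tmul' a b s
    rw [h, bT_mT, ep_nat, LinearMap.lTensor_tmul, ha, hb, ← mT_tmul']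
  | add a b ha hb =>
    intro M _ _ t
    simp only [TensorProduct.add_tmul, map_add, ha, hb]
  | smul r a ha =>
    intro M _ _ t
    simp only [← TensorProduct.smul_tmul', map_smul, ha]

theorem lTensor_eT_bT_tmul (x : 𝕋) : ∀ (M : Type (max u v)) [AddCommGroup M]
    [Module K M] (s : 𝕋 ⊗[K] M),
    𝕃 (eT K V M) (bT c M (x ⊗ₜ s)) = counitT K V x • s := by
  induction x using tensor_induction with
  | one =>
    intro M _ _ s
    rw [bT_one, sh21 (h := LinearMap.id) eT_one, LinearMap.lTensor_id, map_one, one_smul]; rfl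
  | gen v =>
    intro M _ _ s
    have h : 𝛊 v ⊗ₜ[K] s = gT K V _ (v ⊗ₜ s) := rfl
    rw [h, bT_gT, sh21 (h := 0) eT_gT, LinearMap.lTensor_zero, TensorAlgebra.lift_ι_apply]
    simp
  | mul a b ha hb =>
    intro M _ _ s
    have h : (a * b) ⊗ₜ[K] s = mT K V _ (a ⊗ₜ (b ⊗ₜ s)) := mT_tmul' a b s
    have e1 := sh22 (S := 𝕋) (eT_mT (K := K) (V := V) (M := M))
    rw [h, bT_mT, e1, LinearMap.lTensor_tmul, ha, map_smul, hb, map_mul, mul_smul]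
  | add a b ha hb =>
    intro M _ _ t
    simp only [TensorProduct.add_tmul, map_add, ha, hb, add_smul]
  | smul r a ha =>
    intro M _ _ t
    simp only [← TensorProduct.smul_tmul', map_smul, ha, smul_assoc]

theorem lTensor_eT_bT {M : Type (max u v)} [AddCommGroup M] [Module K M] (t : 𝕋 ⊗[K] (𝕋 ⊗[K] M)) :
    𝕃 (eT K V M) (bT c M t) = eT K V _ t := by
  induction t with
  | zero => simp
  | tmul x s => rw [lTensor_eT_bT_tmul, eT_tmul]
  | add a b ha hb => simp only [map_add, ha, hb]

end

theorem eT_dT_tmul (x : 𝕋) : ∀ (M : Type (max u v)) [AddCommGroup M] [Module K M] (s : M),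
    eT K V _ (dT c M (x ⊗ₜ s)) = x ⊗ₜ s := by
  induction x using tensor_induction with
  | one => intro M _ _ s; rw [dT_one, eT_one]
  | gen v =>
    intro M _ _ s
    have h : 𝛊 v ⊗ₜ[K] s = gT K V _ (v ⊗ₜ s) := rfl
    rw [h, dT_gT, map_add, eT_gT, eT_one, zero_add]
  | mul a b ha hb =>
    intro M _ _ s
    have h : (a * b) ⊗ₜ[K] s = mT K V _ (a ⊗ₜ (b ⊗ₜ s)) := mT_tmul' a b s
    rw [h, dT_mT, ep_nat, eT_mT, ep_nat, LinearMap.lTensor_tmul, ha, eT_bT_tmul, hb]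
  | add a b ha hb =>
    intro M _ _ t
    simp only [TensorProduct.add_tmul, map_add, ha, hb]
  | smul r a ha =>
    intro M _ _ t
    simp only [← TensorProduct.smul_tmul', map_smul, ha]

theorem lTensor_eT_dT_tmul (x : 𝕋) : ∀ (M : Type (max u v)) [AddCommGroup M] [Module K M] (s : M),
    𝕃 (eT K V M) (dT c M (x ⊗ₜ s)) = x ⊗ₜ s := by
  induction x using tensor_induction with
  | one => intro M _ _ s; rw [dT_one, LinearMap.lTensor_tmul, eT_one]
  | gen v =>
    intro M _ _ s
    have h : 𝛊 v ⊗ₜ[K] s = gT K V _ (v ⊗ₜ s) := rfl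
    rw [h, dT_gT, map_add, ← gT_nat, LinearMap.lTensor_tmul 𝕋, eT_gT, TensorProduct.tmul_zero,
      add_zero, sh21 (h := LinearMap.id) eT_one, LinearMap.lTensor_id, LinearMap.id_apply]
  | mul a b ha hb =>
    intro M _ _ s
    have h : (a * b) ⊗ₜ[K] s = mT K V _ (a ⊗ₜ (b ⊗ₜ s)) := mT_tmul' a b s
    have e1 := sh22 (S := 𝕋) (eT_mT (K := K) (V := V) (M := M))
    have e2 := sh21 (S := 𝕋) (lTensor_eT_bT c (M := 𝕋 ⊗[K] M))
    rw [h, dT_mT, e1, ← mu_nat, ← mu_nat, e2, LinearMap.lTensor_tmul, ha]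
    simp only [LinearMap.lTensor_tmul, hb]
  | add a b ha hb =>
    intro M _ _ t
    simp only [TensorProduct.add_tmul, map_add, ha, hb]
  | smul r a ha =>
    intro M _ _ t
    simp only [← TensorProduct.smul_tmul', map_smul, ha]

end TensorAlgCoalg

/-! ### Passage from operators with a tail to the operators themselves. -/

section Tails

variable {K : Type u} [Field K]
variable {X Y Z W M : Type*} [AddCommGroup X] [Module K X] [AddCommGroup Y] [Module K Y]
  [AddCommGroup Z] [Module K Z] [AddCommGroup W] [Module K W] [AddCommGroup M] [Module K M]

local notation "𝕃" => LinearMap.lTensor _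

theorem br_flip (f : X ⊗[K] Y →ₗ[K] Z ⊗[K] W) (m : M) (s : X ⊗[K] Y) :
    br f M (𝕃 ((TensorProduct.mk K Y M).flip m) s) = 𝕃 ((TensorProduct.mk K W M).flip m) (f s) := by
  induction s with
  | zero => simp
  | tmul x y => exact br_tmul f x y m
  | add a b ha hb => simp only [map_add, ha, hb]

theorem mu_flip (f : X ⊗[K] Y →ₗ[K] Z) (m : M) (s : X ⊗[K] Y) :
    mu f M (𝕃 ((TensorProduct.mk K Y M).flip m) s) = (TensorProduct.mk K Z M).flip m (f s) := by
  induction s with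
  | zero => simp
  | tmul x y => rw [mu]; rfl
  | add a b ha hb => simp only [map_add, ha, hb]

theorem de_flip (d : X →ₗ[K] Y ⊗[K] Z) (m : M) (x : X) :
    de d M ((TensorProduct.mk K X M).flip m x) = 𝕃 ((TensorProduct.mk K Z M).flip m) (d x) :=
  de_tmul d x m

theorem rTensor_assoc_symm (f : X ⊗[K] Y →ₗ[K] Z) (t : X ⊗[K] (Y ⊗[K] M)) :
    f.rTensor M ((TensorProduct.assoc K X Y M).symm t) = mu f M t := by
  rw [mu]; rfl

theorem assoc_rTensor (d : X →ₗ[K] Y ⊗[K] Z) (t : X ⊗[K] M) :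
    TensorProduct.assoc K Y Z M (d.rTensor M t) = de d M t := by
  rw [de]; rfl

theorem lid_rTensor (e : X →ₗ[K] K) (t : X ⊗[K] M) :
    TensorProduct.lid K M (e.rTensor M t) = ep e M t := by
  rw [ep]; rfl

theorem assoc_c₁ (f : X ⊗[K] X →ₗ[K] X ⊗[K] X) (t : (X ⊗[K] X) ⊗[K] X) :
    TensorProduct.assoc K X X X (c₁ f t) = br f X (TensorProduct.assoc K X X X t) := by
  rw [br]; simp [c₁]

theorem assoc_c₂ (f : X ⊗[K] X →ₗ[K] X ⊗[K] X) (t : (X ⊗[K] X) ⊗[K] X) :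
    TensorProduct.assoc K X X X (c₂ f t) = 𝕃 f (TensorProduct.assoc K X X X t) := by
  simp [c₂]

end Tails

/-! ### The tensor algebra as a braided bialgebra. -/

section TensorAlgBialg

variable {K : Type u} [Field K] {V : Type v} [AddCommGroup V] [Module K V]
variable (c : V ⊗[K] V →ₗ[K] V ⊗[K] V)

local notation "𝕃" => LinearMap.lTensor _
local notation "𝕋" => TensorAlgebra K V

/-- Identities were proved with an arbitrary tail. Taking the tail 𝕋 with the vector 1 in it and
cancelling this vector gives the identity without a tail. -/
theorem mk_flip_one_injective {X : Type*} [AddCommGroup X] [Module K X] :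
    Function.Injective ((TensorProduct.mk K X 𝕋).flip 1) :=
  lTensor_flip_injective one_ne_zero

theorem lTensor_mk_flip_one_injective {X Y : Type*} [AddCommGroup X] [Module K X]
    [AddCommGroup Y] [Module K Y] :
    Function.Injective (((TensorProduct.mk K X 𝕋).flip 1).lTensor Y) :=
  Module.Flat.lTensor_preserves_injective_linearMap _ mk_flip_one_injective

theorem lTensor_lTensor_mk_flip_one_injective {X Y Z : Type*} [AddCommGroup X] [Module K X]
    [AddCommGroup Y] [Module K Y] [AddCommGroup Z] [Module K Z] :
    Function.Injective ((((TensorProduct.mk K X 𝕋).flip 1).lTensor Y).lTensor Z) :=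
  Module.Flat.lTensor_preserves_injective_linearMap _ lTensor_mk_flip_one_injective

theorem braidT_mul_left (t : 𝕋 ⊗[K] (𝕋 ⊗[K] 𝕋)) : braidT c (mT K V 𝕋 t)
    = 𝕃 (LinearMap.mul' K 𝕋) (bT c 𝕋 (𝕃 (braidT c) t)) := by
  apply lTensor_mk_flip_one_injective (K := K) (V := V)
  rw [← br_flip, ← mu_nat, bT_mT, sh22 (br_flip _ _), br_nat, sh22 (mu_flip _ _)]

theorem braidT_mul_right (t : 𝕋 ⊗[K] (𝕋 ⊗[K] 𝕋)) : braidT c (𝕃 (LinearMap.mul' K 𝕋) t)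
    = mT K V 𝕋 (𝕃 (braidT c) (bT c 𝕋 t)) := by
  apply lTensor_mk_flip_one_injective (K := K) (V := V)
  rw [← br_flip, ← sh22 (mu_flip _ _), bT_lTensor_mT, br_nat, sh22 (br_flip _ _), mu_nat]

theorem comulT_braidT_left (hc : IsBraiding c) (t : 𝕋 ⊗[K] 𝕋) : dT c 𝕋 (braidT c t)
    = 𝕃 (braidT c) (bT c 𝕋 (𝕃 (comulT c) t)) := by
  apply lTensor_lTensor_mk_flip_one_injective (K := K) (V := V)
  rw [← de_nat, ← br_flip, dT_bT c hc, sh22 (de_flip _ _), br_nat, sh22 (br_flip _ _)]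

theorem comulT_braidT_right (hc : IsBraiding c) (t : 𝕋 ⊗[K] 𝕋) : 𝕃 (comulT c) (braidT c t)
    = bT c 𝕋 (𝕃 (braidT c) (dT c 𝕋 t)) := by
  apply lTensor_lTensor_mk_flip_one_injective (K := K) (V := V)
  rw [← sh22 (de_flip _ _), ← br_flip, lTensor_dT_bT c hc, de_nat, sh22 (br_flip _ _), br_nat]

theorem braidT_yb (hc : IsBraiding c) (t : 𝕋 ⊗[K] (𝕋 ⊗[K] 𝕋)) :
    bT c 𝕋 (𝕃 (braidT c) (bT c 𝕋 t)) = 𝕃 (braidT c) (bT c 𝕋 (𝕃 (braidT c) t)) := by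
  apply lTensor_lTensor_mk_flip_one_injective (K := K) (V := V)
  have h := yb_TTT c hc (𝕃 (𝕃 ((TensorProduct.mk K 𝕋 𝕋).flip 1)) t)
  simpa only [br_nat, sh22 (br_flip (braidT c) (1 : 𝕋))] using h

theorem comulT_comulT (hc : IsBraiding c) (x : 𝕋) :
    dT c 𝕋 (comulT c x) = 𝕃 (comulT c) (comulT c x) := by
  apply lTensor_lTensor_mk_flip_one_injective (K := K) (V := V)
  have h := dT_dT c hc ((TensorProduct.mk K 𝕋 𝕋).flip 1 x)
  rwa [de_flip, de_nat, sh22 (de_flip _ _)] at h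

theorem lTensor_eT_flip (s : 𝕋 ⊗[K] 𝕋) :
    𝕃 (eT K V 𝕋) (𝕃 ((TensorProduct.mk K 𝕋 𝕋).flip 1) s) = (TensorProduct.mk K 𝕋 𝕋).flip 1
      (TensorProduct.rid K 𝕋 (𝕃 (counitT K V).toLinearMap s)) := by
  induction s with
  | zero => simp
  | tmul x y => simp [eT_tmul, TensorProduct.tmul_smul, TensorProduct.smul_tmul']
  | add a b ha hb => simp only [map_add, ha, hb]

theorem comulT_mul (x y : 𝕋) : comulT c (x * y) = mulTT c (comulT c x ⊗ₜ comulT c y) := by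
  apply lTensor_mk_flip_one_injective (K := K) (V := V)
  have h := dT_mT_tmul c x 𝕋 (y ⊗ₜ 1)
  have h1 : dT c 𝕋 (y ⊗ₜ 1) = _ := de_flip (comulT c) (1 : 𝕋) y
  have h2 : TensorProduct.assoc K 𝕋 𝕋 (𝕋 ⊗[K] 𝕋) (comulT c x ⊗ₜ comulT c y) = dT c _ (x ⊗ₜ comulT c y) :=
    assoc_rTensor (comulT c) (x ⊗ₜ comulT c y)
  have e1 := sh22 (S := 𝕋) (br_nat (braidT c) ((TensorProduct.mk K 𝕋 𝕋).flip 1))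
  have e2 := sh22 (S := 𝕋) (mu_flip (LinearMap.mul' K 𝕋) (1 : 𝕋))
  have h3 : dT c 𝕋 ((x * y) ⊗ₜ 1) = _ := de_flip (comulT c) (1 : 𝕋) (x * y)
  rw [h1, ← LinearMap.lTensor_tmul, de_nat, e1, mu_nat, e2, mT_tmul, h3] at h
  rw [h, mulTT_tmul, h2]

theorem bT_tmul_one (x : 𝕋) : ∀ (M : Type (max u v)) [AddCommGroup M] [Module K M] (s : M),
    bT c M (x ⊗ₜ ((1 : 𝕋) ⊗ₜ s)) = 1 ⊗ₜ (x ⊗ₜ s) := by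
  induction x using tensor_induction with
  | one => intro M _ _ s; rw [bT_one]; rfl
  | gen v =>
    intro M _ _ s
    have h : ∀ (N : Type (max u v)) [AddCommGroup N] [Module K N] (s : N),
      TensorAlgebra.ι K v ⊗ₜ[K] s = gT K V N (v ⊗ₜ s) := fun _ _ _ _ => rfl
    have h1 : bVT c M (v ⊗ₜ (1 ⊗ₜ s)) = _ := bVT_one c (v ⊗ₜ s)
    rw [h, h, bT_gT, h1, LinearMap.lTensor_tmul]
  | mul a b ha hb =>
    intro M _ _ s
    have h : ∀ (N : Type (max u v)) [AddCommGroup N] [Module K N] (s : N),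
        (a * b) ⊗ₜ[K] s = mT K V N (a ⊗ₜ (b ⊗ₜ s)) := fun _ _ _ s => mT_tmul' a b s
    rw [h, h, bT_mT, LinearMap.lTensor_tmul, hb, ha, LinearMap.lTensor_tmul]
  | add a b ha hb =>
    intro M _ _ t
    simp only [TensorProduct.add_tmul, TensorProduct.tmul_add, map_add, ha, hb]
  | smul r a ha =>
    intro M _ _ t
    simp only [← TensorProduct.smul_tmul', map_smul, ha, TensorProduct.tmul_smul]

/-- The braided tensor algebra is a braided bialgebra. -/
theorem isBraidedBialgebra_tensorData (hc : IsBraiding c) :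
    (tensorData c).IsBraidedBialgebra where
  mul_assoc := by
    ext x y z
    exact mul_assoc x y z
  one_mul x := one_mul x
  mul_one x := mul_one x
  coassoc := LinearMap.ext fun x => (assoc_rTensor _ _).trans (comulT_comulT c hc x)
  counit_comul := by
    refine LinearMap.ext fun x => (lid_rTensor _ _).trans (mk_flip_one_injective (K := K) (V := V) ?_)
    refine (ep_nat _ _ _).symm.trans ?_
    have h := eT_dT_tmul c x 𝕋 1
    rwa [show dT c 𝕋 (x ⊗ₜ 1) = _ from de_flip (comulT c) (1 : 𝕋) x] at h
  comul_counit := by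
    refine LinearMap.ext fun x => mk_flip_one_injective (K := K) (V := V)
      ((lTensor_eT_flip _).symm.trans ?_)
    have h := lTensor_eT_dT_tmul c x 𝕋 1
    rwa [show dT c 𝕋 (x ⊗ₜ 1) = _ from de_flip (comulT c) (1 : 𝕋) x] at h
  braiding := by
    rw [isBraiding_iff]
    exact braidT_yb c hc
  braid_mul_left := by
    refine LinearMap.ext fun t => ?_
    obtain ⟨t, rfl⟩ := (TensorProduct.assoc K 𝕋 𝕋 𝕋).symm.surjective t
    simp only [LinearMap.comp_apply, LinearEquiv.coe_coe, assoc_c₁, assoc_c₂, rTensor_assoc_symm,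
      LinearEquiv.apply_symm_apply]
    exact braidT_mul_left c t
  braid_mul_right := by
    refine LinearMap.ext fun t => ?_
    obtain ⟨t, rfl⟩ := (TensorProduct.assoc K 𝕋 𝕋 𝕋).symm.surjective t
    refine Eq.trans ?_ ((braidT_mul_right c t).trans ?_)
    · simp only [LinearMap.comp_apply, LinearEquiv.coe_coe, LinearEquiv.apply_symm_apply]
      rfl
    · rw [← rTensor_assoc_symm, ← LinearEquiv.apply_symm_apply (TensorProduct.assoc K 𝕋 𝕋 𝕋) t,
        ← assoc_c₁, ← assoc_c₂, LinearEquiv.symm_apply_apply, LinearEquiv.apply_symm_apply]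
      rfl
  braid_one_left x := by
    apply lTensor_mk_flip_one_injective (K := K) (V := V)
    refine (br_flip (braidT c) (1 : 𝕋) (1 ⊗ₜ x)).symm.trans ?_
    rw [LinearMap.lTensor_tmul, bT_one]
    rfl
  braid_one_right x := by
    apply lTensor_mk_flip_one_injective (K := K) (V := V)
    exact (br_flip (braidT c) (1 : 𝕋) (x ⊗ₜ 1)).symm.trans (bT_tmul_one c x 𝕋 1)
  comul_braid_left := by
    refine LinearMap.ext fun t => (TensorProduct.assoc K 𝕋 𝕋 𝕋).injective ?_
    simp only [LinearMap.comp_apply, LinearEquiv.coe_coe, assoc_c₁, assoc_c₂, assoc_rTensor,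
      LinearEquiv.apply_symm_apply]
    exact comulT_braidT_left c hc t
  comul_braid_right := by
    refine LinearMap.ext fun t => (TensorProduct.assoc K 𝕋 𝕋 𝕋).injective ?_
    simp only [LinearMap.comp_apply, LinearEquiv.coe_coe, assoc_c₁, assoc_c₂, assoc_rTensor,
      LinearEquiv.apply_symm_apply]
    exact comulT_braidT_right c hc t
  counit_braid_left := by
    refine TensorProduct.ext' fun x y => (lid_rTensor _ _).trans
      (mk_flip_one_injective (K := K) (V := V) ?_)
    have h := eT_bT_tmul c x 𝕋 (y ⊗ₜ 1)
    rw [show bT c 𝕋 (x ⊗ₜ (y ⊗ₜ 1)) = _ from br_flip (braidT c) (1 : 𝕋) (x ⊗ₜ y), ep_nat,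
      eT_tmul] at h
    refine h.trans ?_
    simp [tensorData, TensorProduct.smul_tmul']
  counit_braid_right := by
    refine TensorProduct.ext' fun x y => Eq.trans ?_
      (lid_rTensor (counitT K V).toLinearMap (x ⊗ₜ[K] y)).symm
    apply mk_flip_one_injective (K := K) (V := V)
    refine (lTensor_eT_flip _).symm.trans ?_
    have h := lTensor_eT_bT_tmul c x 𝕋 (y ⊗ₜ 1)
    rw [show bT c 𝕋 (x ⊗ₜ (y ⊗ₜ 1)) = _ from br_flip (braidT c) (1 : 𝕋) (x ⊗ₜ y)] at h
    refine h.trans ?_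
    rw [ep_tmul, map_smul]
    rfl
  comul_mul := by
    exact TensorProduct.ext' fun x y => comulT_mul c x y
  comul_one := comulT_one c
  counit_mul x y := map_mul (counitT K V) x y
  counit_one := map_one (counitT K V)

end TensorAlgBialg

/-! ### The grading of the tensor algebra. -/

section TensorAlgGraded

variable {K : Type u} [Field K] {V : Type v} [AddCommGroup V] [Module K V]
variable (c : V ⊗[K] V →ₗ[K] V ⊗[K] V)

local notation "𝕃" => LinearMap.lTensor _
local notation "𝕋" => TensorAlgebra K V

theorem isInternal_tPow : DirectSum.IsInternal (tPow K V) :=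
  DirectSum.Decomposition.isInternal
    ((LinearMap.range (TensorAlgebra.ι K : V →ₗ[K] TensorAlgebra K V) ^ ·) :
      ℕ → Submodule K (TensorAlgebra K V))

theorem ι_mem_tPow (v : V) : TensorAlgebra.ι K v ∈ tPow K V 1 := by
  rw [tPow, pow_one]
  exact LinearMap.mem_range_self _ v

theorem one_mem_tPow : (1 : 𝕋) ∈ tPow K V 0 := by
  rw [tPow, pow_zero]
  exact Submodule.one_le.1 le_rfl

theorem mul_mem_tPow {i j : ℕ} {x y : 𝕋} (hx : x ∈ tPow K V i) (hy : y ∈ tPow K V j) :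
    x * y ∈ tPow K V (i + j) := by
  rw [tPow, pow_add]
  exact Submodule.mul_mem_mul hx hy

theorem tPow_zero_le {W : Submodule K 𝕋} (h : 1 ∈ W) : tPow K V 0 ≤ W := by
  rw [tPow, pow_zero]
  exact Submodule.one_le.2 h

theorem tPow_succ_le {n : ℕ} {W : Submodule K 𝕋}
    (h : ∀ v, ∀ y ∈ tPow K V n, TensorAlgebra.ι K v * y ∈ W) : tPow K V (n + 1) ≤ W := by
  rw [tPow, pow_succ', Submodule.mul_le]
  rintro _ ⟨v, rfl⟩ y hy
  exact h v y hy

@[elab_as_elim]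
theorem tPow_succ_induction {n : ℕ} {C : 𝕋 → Prop}
    (h : ∀ v, ∀ y ∈ tPow K V n, C (TensorAlgebra.ι K v * y)) (ha : ∀ x y, C x → C y → C (x + y))
    {x : 𝕋} (hx : x ∈ tPow K V (n + 1)) : C x := by
  rw [tPow, pow_succ'] at hx
  refine Submodule.mul_induction_on hx ?_ ha
  rintro _ ⟨v, rfl⟩ y hy
  exact h v y hy

theorem lTensor_mem_tens {X Y Z : Type*} [AddCommGroup X] [Module K X] [AddCommGroup Y]
    [Module K Y] [AddCommGroup Z] [Module K Z] {A : Submodule K X} {B : Submodule K Y}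
    {C : Submodule K Z} (f : Y →ₗ[K] Z) (hf : ∀ y ∈ B, f y ∈ C) {t : X ⊗[K] Y}
    (ht : t ∈ tens A B) : 𝕃 f t ∈ tens A C :=
  (tens_le fun _ hx y hy => tmul_mem_tens hx (hf y hy) : tens A B ≤ (tens A C).comap (𝕃 f)) ht

/-- Each letter passed by the vector raises the degree of the first factor by one. The initial
degree i is kept free, since after the first letter the hypothesis is used for i + 1. -/
theorem rAct_mem (j : ℕ) : ∀ {t : 𝕋}, t ∈ tPow K V j → ∀ (i : ℕ) (q : 𝕋 ⊗[K] V),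
    q ∈ tens (tPow K V i) ⊤ → rAct c t q ∈ tens (tPow K V (i + j)) ⊤ := by
  induction j with
  | zero =>
    intro t ht i q hq
    obtain ⟨r, rfl⟩ : ∃ r : K, t = r • 1 := by
      have h := (tPow_zero_le (Submodule.mem_span_singleton_self (1 : 𝕋)) ht)
      obtain ⟨r, hr⟩ := Submodule.mem_span_singleton.1 h
      exact ⟨r, hr.symm⟩
    have h : rAct c (r • 1) = r • rAct c 1 := by
      rw [rAct, map_smul]; rfl
    rw [h, rAct_one]
    exact Submodule.smul_mem _ r hq
  | succ j ih =>
    intro t ht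
    refine tPow_succ_induction (fun w y hy i q hq => ?_) (fun x y hx hy i q hq => ?_) ht
    · rw [rAct_mul, add_comm j, ← add_assoc]
      refine ih hy _ _ ?_
      refine (tens_le fun s hs v _ => ?_ : tens (tPow K V i) ⊤ ≤
        (tens (tPow K V (i + 1)) ⊤).comap (rAct c (TensorAlgebra.ι K w))) hq
      rw [Submodule.mem_comap, rAct_ι]
      generalize c (v ⊗ₜ w) = z
      induction z with
      | zero => simp
      | tmul x y =>
        rw [LinearMap.rTensor_tmul, mT_tmul]
        exact tmul_mem_tens (mul_mem_tPow hs (ι_mem_tPow x)) trivial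
      | add a b ha hb =>
        simp only [map_add, TensorProduct.tmul_add]
        exact Submodule.add_mem _ ha hb
    · have h : rAct c (x + y) = rAct c x + rAct c y := by
        rw [rAct, map_add]; rfl
      rw [h]
      exact Submodule.add_mem _ (hx _ _ hq) (hy _ _ hq)

theorem braidVT_mem {j : ℕ} {t : 𝕋} (ht : t ∈ tPow K V j) (v : V) :
    braidVT c (v ⊗ₜ t) ∈ tens (tPow K V j) ⊤ := by
  have h := rAct_mem c j ht 0 (1 ⊗ₜ v) (tmul_mem_tens one_mem_tPow trivial)
  rwa [zero_add] at h

theorem lAct_mem (i : ℕ) : ∀ {x : 𝕋}, x ∈ tPow K V i → ∀ (j k : ℕ) (q : 𝕋 ⊗[K] 𝕋),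
    q ∈ tens (tPow K V j) (tPow K V k) → lAct c x q ∈ tens (tPow K V j) (tPow K V (i + k)) := by
  induction i with
  | zero =>
    intro x hx j k q hq
    obtain ⟨r, rfl⟩ : ∃ r : K, x = r • 1 := by
      have h := (tPow_zero_le (Submodule.mem_span_singleton_self (1 : 𝕋)) hx)
      obtain ⟨r, hr⟩ := Submodule.mem_span_singleton.1 h
      exact ⟨r, hr.symm⟩
    rw [lAct, map_smul, map_one, zero_add]
    exact Submodule.smul_mem _ r hq
  | succ i ih =>
    intro x hx
    refine tPow_succ_induction (fun w y hy j k q hq => ?_) (fun x y hx hy j k q hq => ?_) hx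
    · rw [lAct, map_mul, Module.End.mul_apply, add_comm i, add_assoc]
      refine (tens_le fun z hz s hs => ?_ : tens (tPow K V j) (tPow K V (i + k)) ≤
        (tens (tPow K V j) (tPow K V (1 + (i + k)))).comap (lAct c (TensorAlgebra.ι K w))) (ih hy _ _ _ hq)
      rw [Submodule.mem_comap, lAct_ι, br_tmul, ← LinearMap.lTensor_comp_apply]
      exact lTensor_mem_tens _ (fun v _ => mul_mem_tPow (ι_mem_tPow v) hs) (braidVT_mem c hz w)
    · rw [lAct, map_add]
      exact Submodule.add_mem _ (hx _ _ _ hq) (hy _ _ _ hq)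

theorem braidT_mem {i j : ℕ} {x y : 𝕋} (hx : x ∈ tPow K V i) (hy : y ∈ tPow K V j) :
    braidT c (x ⊗ₜ y) ∈ tens (tPow K V j) (tPow K V i) :=
  lAct_mem c i hx _ 0 _ (tmul_mem_tens hy one_mem_tPow)

theorem mulTT_mem {i j k l : ℕ} {p q : 𝕋 ⊗[K] 𝕋} (hp : p ∈ tens (tPow K V i) (tPow K V j))
    (hq : q ∈ tens (tPow K V k) (tPow K V l)) :
    mulTT c (p ⊗ₜ q) ∈ tens (tPow K V (i + k)) (tPow K V (j + l)) := by
  refine (tens_le fun x hx y hy => ?_ : tens (tPow K V i) (tPow K V j) ≤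
    (tens (tPow K V (i + k)) (tPow K V (j + l))).comap
      (mulTT c ∘ₗ (TensorProduct.mk K _ _).flip q)) hp
  refine (tens_le fun z hz w hw => ?_ : tens (tPow K V k) (tPow K V l) ≤
    (tens (tPow K V (i + k)) (tPow K V (j + l))).comap
      (mulTT c ∘ₗ TensorProduct.mk K _ _ (x ⊗ₜ y))) hq
  rw [Submodule.mem_comap, LinearMap.comp_apply, TensorProduct.mk_apply, mulTT_tmul,
    TensorProduct.assoc_tmul, LinearMap.lTensor_tmul, br_tmul]
  refine (tens_le fun z' hz' y' hy' => ?_ : tens (tPow K V k) (tPow K V j) ≤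
    (tens (tPow K V (i + k)) (tPow K V (j + l))).comap
      (𝕃 (LinearMap.mul' K 𝕋) ∘ₗ mT K V (𝕋 ⊗[K] 𝕋) ∘ₗ TensorProduct.mk K _ _ x ∘ₗ
        𝕃 ((TensorProduct.mk K 𝕋 𝕋).flip w))) (braidT_mem c hy hz)
  simp only [Submodule.mem_comap, LinearMap.comp_apply, TensorProduct.mk_apply,
    LinearMap.lTensor_tmul, LinearMap.flip_apply, mT_tmul, LinearMap.mul'_apply]
  exact tmul_mem_tens (mul_mem_tPow hx hz') (mul_mem_tPow hy' hw)

theorem tens_le_iSup {A : Type*} [AddCommGroup A] [Module K A] (F : ℕ → Submodule K A)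
    {i j n : ℕ} (h : i + j = n) :
    tens (F i) (F j) ≤ ⨆ (p : ℕ × ℕ) (_ : p.1 + p.2 = n), tens (F p.1) (F p.2) :=
  le_iSup₂ (f := fun (p : ℕ × ℕ) (_ : p.1 + p.2 = n) => tens (F p.1) (F p.2)) (i, j) h

theorem comulT_mem (n : ℕ) : ∀ {x : 𝕋}, x ∈ tPow K V n → comulT c x ∈
    ⨆ (p : ℕ × ℕ) (_ : p.1 + p.2 = n), tens (tPow K V p.1) (tPow K V p.2) := by
  induction n with
  | zero =>
    intro x hx
    refine tPow_zero_le (W := (⨆ (p : ℕ × ℕ) (_ : p.1 + p.2 = 0),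
      tens (tPow K V p.1) (tPow K V p.2)).comap (comulT c)) ?_ hx
    rw [Submodule.mem_comap, comulT_one]
    exact tens_le_iSup (tPow K V) (add_zero 0) (tmul_mem_tens one_mem_tPow one_mem_tPow)
  | succ n ih =>
    intro x hx
    refine tPow_succ_le (W := (⨆ (p : ℕ × ℕ) (_ : p.1 + p.2 = n + 1),
      tens (tPow K V p.1) (tPow K V p.2)).comap (comulT c)) (fun v y hy => ?_) hx
    rw [Submodule.mem_comap, comulT_ι_mul]
    refine (iSup₂_le fun p hp r hr => ?_ : (⨆ (p : ℕ × ℕ) (_ : p.1 + p.2 = n),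
      tens (tPow K V p.1) (tPow K V p.2)) ≤ (⨆ (p : ℕ × ℕ) (_ : p.1 + p.2 = n + 1),
        tens (tPow K V p.1) (tPow K V p.2)).comap (mulTT c ∘ₗ TensorProduct.mk K _ _ _)) (ih hy)
    rw [Submodule.mem_comap, LinearMap.comp_apply, TensorProduct.mk_apply, TensorProduct.add_tmul,
      map_add]
    exact Submodule.add_mem _
      (tens_le_iSup (tPow K V) (by omega) (mulTT_mem c (tmul_mem_tens (ι_mem_tPow v) one_mem_tPow) hr))
      (tens_le_iSup (tPow K V) (by omega) (mulTT_mem c (tmul_mem_tens one_mem_tPow (ι_mem_tPow v)) hr))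

/-- The braided tensor algebra is a graded braided bialgebra. -/
theorem isGradedBraidedBialgebra_tensorData (hc : IsBraiding c) :
    (tensorData c).IsGradedBraidedBialgebra (tPow K V) where
  isBraidedBialgebra := isBraidedBialgebra_tensorData c hc
  isInternal := isInternal_tPow
  mul_mem _ _ := tens_le fun _ hx _ hy => mul_mem_tPow hx hy
  one_mem := one_mem_tPow
  comul_mem n _ hx := comulT_mem c n hx
  counit_eq_zero n hn := by
    obtain ⟨n, rfl⟩ := Nat.exists_eq_succ_of_ne_zero hn
    refine tPow_succ_le fun v y _ => ?_
    exact (map_mul (counitT K V) _ y).trans (by rw [TensorAlgebra.lift_ι_apply]; simp)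
  braid_mem _ _ := tens_le fun _ hx _ hy => braidT_mem c hx hy

end TensorAlgGraded

/-! ### Tensor products of subspaces -/

section TensSubspaces

variable {K : Type u} [Field K] {A B C M : Type*} [AddCommGroup A] [Module K A]
  [AddCommGroup B] [Module K B] [AddCommGroup C] [Module K C] [AddCommGroup M] [Module K M]

/-- Surjectivity of f is not required: over a field the injection of A / ker f into B has a left
inverse. -/
theorem exists_comp_eq_of_ker_le {f : A →ₗ[K] B} {g : A →ₗ[K] C}
    (h : LinearMap.ker f ≤ LinearMap.ker g) : ∃ g' : B →ₗ[K] C, g = g' ∘ₗ f := by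
  obtain ⟨r, hr⟩ := ((LinearMap.ker f).liftQ f le_rfl).exists_leftInverse_of_injective
    (Submodule.ker_liftQ_eq_bot _ _ _ le_rfl)
  refine ⟨(LinearMap.ker f).liftQ g h ∘ₗ r, LinearMap.ext fun x => ?_⟩
  have hx : r (f x) = Submodule.Quotient.mk x :=
    LinearMap.congr_fun hr (Submodule.Quotient.mk x)
  simp only [LinearMap.comp_apply, hx]
  rfl

/-- This allows testing membership in M ⊗ ker f by f itself instead of the quotient map. It is used
for f the composite of Δ with A ⊗ A → A / A₀ ⊗ A / Aₙ, whose kernel is Aₙ₊₁. -/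
theorem lTensor_eq_zero_of_ker_le {f : A →ₗ[K] B} {g : A →ₗ[K] C}
    (h : LinearMap.ker f ≤ LinearMap.ker g) {t : M ⊗[K] A} (ht : f.lTensor M t = 0) :
    g.lTensor M t = 0 := by
  obtain ⟨g', rfl⟩ := exists_comp_eq_of_ker_le h
  rw [LinearMap.lTensor_comp_apply, ht, map_zero]

theorem rTensor_eq_zero_of_ker_le {f : A →ₗ[K] B} {g : A →ₗ[K] C}
    (h : LinearMap.ker f ≤ LinearMap.ker g) {t : A ⊗[K] M} (ht : f.rTensor M t = 0) :
    g.rTensor M t = 0 := by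
  obtain ⟨g', rfl⟩ := exists_comp_eq_of_ker_le h
  rw [LinearMap.rTensor_comp_apply, ht, map_zero]

theorem ker_map_mkQ (p : Submodule K A) (q : Submodule K B) :
    LinearMap.ker (TensorProduct.map p.mkQ q.mkQ) = tens p ⊤ ⊔ tens ⊤ q := by
  apply le_antisymm
  · have := ker_map_mkQ_le p q (tens p ⊤ ⊔ tens ⊤ q).mkQ
      (fun x hx y => by
        rw [Submodule.mkQ_apply, Submodule.Quotient.mk_eq_zero]
        exact Submodule.mem_sup_left (tmul_mem_tens hx trivial))
      (fun x y hy => by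
        rw [Submodule.mkQ_apply, Submodule.Quotient.mk_eq_zero]
        exact Submodule.mem_sup_right (tmul_mem_tens trivial hy))
    rwa [Submodule.ker_mkQ] at this
  · refine sup_le (tens_le fun x hx y _ => ?_) (tens_le fun x _ y hy => ?_)
    · rw [LinearMap.mem_ker, TensorProduct.map_tmul, Submodule.mkQ_apply p x,
        (Submodule.Quotient.mk_eq_zero p).2 hx,
        TensorProduct.zero_tmul]
    · rw [LinearMap.mem_ker, TensorProduct.map_tmul, Submodule.mkQ_apply q y,
        (Submodule.Quotient.mk_eq_zero q).2 hy,
        TensorProduct.tmul_zero]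

theorem tens_bot_left (q : Submodule K B) : tens (⊥ : Submodule K A) q = ⊥ :=
  le_bot_iff.1 (tens_le fun x hx y _ => by
    rw [(Submodule.mem_bot K).1 hx, TensorProduct.zero_tmul]; exact Submodule.zero_mem _)

theorem tens_bot_right (p : Submodule K A) : tens p (⊥ : Submodule K B) = ⊥ :=
  le_bot_iff.1 (tens_le fun x _ y hy => by
    rw [(Submodule.mem_bot K).1 hy, TensorProduct.tmul_zero]; exact Submodule.zero_mem _)

theorem exists_projection (p : Submodule K A) :
    ∃ f : A →ₗ[K] A, (∀ x, f x ∈ p) ∧ ∀ x ∈ p, f x = x := by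
  obtain ⟨r, hr⟩ := p.subtype.exists_leftInverse_of_injective p.ker_subtype
  refine ⟨p.subtype ∘ₗ r, fun x => (r x).2, fun x hx => ?_⟩
  exact congrArg Subtype.val (LinearMap.congr_fun hr ⟨x, hx⟩)

/-- An element of the intersection is fixed by f ⊗ id and by id ⊗ g for linear projections f and g
onto the two subspaces, hence by f ⊗ g, whose values lie in the tensor product of the subspaces. -/
theorem tens_top_inf_top_tens (p : Submodule K A) (q : Submodule K B) :
    tens p ⊤ ⊓ tens ⊤ q = tens p q := by
  refine le_antisymm ?_ (le_inf (tens_mono le_rfl le_top) (tens_mono le_top le_rfl))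
  rintro z ⟨h1, h2⟩
  obtain ⟨f, hf, hf'⟩ := exists_projection p
  obtain ⟨g, hg, hg'⟩ := exists_projection q
  have e1 : f.rTensor B z = z :=
    (tens_le fun x hx y _ => by
      simp [hf' x hx] : tens p ⊤ ≤ LinearMap.eqLocus (f.rTensor B) LinearMap.id) h1
  have e2 : g.lTensor A z = z :=
    (tens_le fun x _ y hy => by
      simp [hg' y hy] : tens ⊤ q ≤ LinearMap.eqLocus (g.lTensor A) LinearMap.id) h2
  rw [← e1, ← e2]
  generalize z = t
  induction t with
  | zero => simp
  | tmul x y => exact tmul_mem_tens (hf x) (hg y)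
  | add a b ha hb => simpa only [map_add] using Submodule.add_mem _ ha hb

theorem mem_tens_top_iff {p : Submodule K A} {t : A ⊗[K] B} :
    t ∈ tens p ⊤ ↔ p.mkQ.rTensor B t = 0 := by
  constructor
  · intro h
    refine (tens_le fun x hx y _ => ?_ : tens p ⊤ ≤ LinearMap.ker (p.mkQ.rTensor B)) h
    rw [LinearMap.mem_ker, LinearMap.rTensor_tmul, Submodule.mkQ_apply,
      (Submodule.Quotient.mk_eq_zero p).2 hx, TensorProduct.zero_tmul]
  · intro h
    have h1 : t ∈ LinearMap.ker (TensorProduct.map p.mkQ (⊥ : Submodule K B).mkQ) := by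
      rw [LinearMap.mem_ker, ← LinearMap.lTensor_comp_rTensor, LinearMap.comp_apply, h, map_zero]
    rwa [ker_map_mkQ, tens_bot_right, sup_bot_eq] at h1

theorem mem_top_tens_iff {q : Submodule K B} {t : A ⊗[K] B} :
    t ∈ tens ⊤ q ↔ q.mkQ.lTensor A t = 0 := by
  constructor
  · intro h
    refine (tens_le fun x _ y hy => ?_ : tens ⊤ q ≤ LinearMap.ker (q.mkQ.lTensor A)) h
    rw [LinearMap.mem_ker, LinearMap.lTensor_tmul, Submodule.mkQ_apply,
      (Submodule.Quotient.mk_eq_zero q).2 hy, TensorProduct.tmul_zero]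
  · intro h
    have h1 : t ∈ LinearMap.ker (TensorProduct.map (⊥ : Submodule K A).mkQ q.mkQ) := by
      rw [LinearMap.mem_ker, ← LinearMap.rTensor_comp_lTensor, LinearMap.comp_apply, h, map_zero]
    rwa [ker_map_mkQ, tens_bot_left, bot_sup_eq] at h1

/-- An element of `A ⊗ A` lies in the `n`-th step of the tensor product filtration if it vanishes
in `A / F (i - 1) ⊗ A / F (j - 1)` whenever `i + j = n + 1`. -/
theorem mem_iSup_tens_of_map_mkQ_eq_zero {F : ℕ → Submodule K A} (hF : Monotone F) {n : ℕ}
    {z : A ⊗[K] A}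
    (hz : ∀ i j, i + j = n + 1 → TensorProduct.map (below F i).mkQ (below F j).mkQ z = 0) :
    z ∈ ⨆ (p : ℕ × ℕ) (_ : p.1 + p.2 = n), tens (F p.1) (F p.2) := by
  have hz' : ∀ i j, i + j = n + 1 → z ∈ tens (below F i) ⊤ ⊔ tens ⊤ (below F j) := by
    intro i j hij
    rw [← ker_map_mkQ]
    exact hz i j hij
  -- Write z as an element of the n-th step lying in F (k - 1) ⊗ A, plus a remainder in A ⊗ F (j -
  -- 1), and let k grow. For k = 0 this is the hypothesis; for j = 0 the remainder is zero.
  have key : ∀ k j, k + j = n + 1 → z ∈ ((⨆ (p : ℕ × ℕ) (_ : p.1 + p.2 = n), tens (F p.1) (F p.2)) ⊓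
      tens (below F k) ⊤) ⊔ tens ⊤ (below F j) := by
    intro k
    induction k with
    | zero =>
      intro j hj
      have h := hz' 0 j hj
      rw [below, tens_bot_left, bot_sup_eq] at h
      exact Submodule.mem_sup_right h
    | succ k ih =>
      intro j hj
      obtain ⟨s, ⟨hs1, hs2⟩, b, hb, hsb⟩ := Submodule.mem_sup.1 (ih (j + 1) (by omega))
      obtain ⟨a, ha, b', hb', hab⟩ := Submodule.mem_sup.1 (hz' (k + 1) j hj)
      have hs3 : s ∈ tens (F k) ⊤ :=
        tens_mono (by cases k with | zero => exact bot_le | succ k => exact hF (Nat.le_succ k))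
          le_rfl hs2
      have hb3 : b' ∈ tens (⊤ : Submodule K A) (F j) :=
        tens_mono le_rfl (by cases j with | zero => exact bot_le | succ j => exact hF (Nat.le_succ j))
          hb'
      -- There are two decompositions z = s + b = a + b'. The difference of the remainders lies in A
      -- ⊗ F j by the left side and in F k ⊗ A by the right side, hence in F k ⊗ F j, and k + j = n.
      -- It is moved to the first summand.
      have e : b - b' = a - s := by
        rw [sub_eq_sub_iff_add_eq_add, add_comm b, hsb, hab]
      have hd : b - b' ∈ tens (F k) (F j) := by
        rw [← tens_top_inf_top_tens]
        refine ⟨?_, Submodule.sub_mem _ hb hb3⟩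
        rw [e]
        exact Submodule.sub_mem _ ha hs3
      refine Submodule.mem_sup.2 ⟨s + (b - b'), ⟨Submodule.add_mem _ hs1
        (tens_le_iSup F (by omega) hd), Submodule.add_mem _ hs3 (tens_mono le_rfl le_top hd)⟩,
        b', hb', by rw [← hsb]; abel⟩
  have h := key (n + 1) 0 (by omega)
  rw [below, tens_bot_right, sup_bot_eq] at h
  exact h.1

end TensSubspaces

/-! ### The coradical filtration -/

section Coradical

variable {K : Type u} [Field K] {A : Type*} [AddCommGroup A] [Module K A] {D : Data K A}

theorem Data.IsBraidedBialgebra.one_ne_zero (hD : D.IsBraidedBialgebra) : D.one ≠ 0 := by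
  intro h
  have := hD.counit_one
  rw [h, map_zero] at this
  exact zero_ne_one this

theorem Data.IsBraidedBialgebra.eq_zero_of_comul (hD : D.IsBraidedBialgebra) {x : A}
    (hx : D.comul x = 0) : x = 0 := by
  have h := LinearMap.congr_fun hD.counit_comul x
  rw [LinearMap.comp_apply, LinearMap.comp_apply, hx, map_zero, map_zero] at h
  exact h.symm

/-- Take a nonzero x in X of least filtration degree. In degree 0 it is a multiple of 1. In degree n
+ 1, minimality says that X meets F 0 and F n trivially, so X ⊗ X embeds into A / F 0 ⊗ A / F n. But
Δ x vanishes there, since F i ⊗ F j with i + j = n + 1 has i = 0 or j ≤ n. Hence Δ x = 0, and x = 0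
by the counit, a contradiction. -/
theorem IsConnectedFiltered.one_mem_of_isSubcoalgebra {F : ℕ → Submodule K A}
    (h : IsConnectedFiltered D F) {X : Submodule K A} (hX : D.IsSubcoalgebra X) (hX0 : X ≠ ⊥) :
    D.one ∈ X := by
  have hD := h.isBraidedBialgebra
  obtain ⟨x, hx, hx0⟩ := Submodule.exists_mem_ne_zero_of_ne_bot hX0
  have hex : ∃ n, ∃ x ∈ X, x ≠ 0 ∧ x ∈ F n := by
    have h1 : x ∈ ⨆ n, F n := by rw [h.exhaustive]; trivial
    obtain ⟨n, hn⟩ := (Submodule.mem_iSup_of_directed _ h.mono.directed_le).1 h1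
    exact ⟨n, x, hx, hx0, hn⟩
  classical
  obtain ⟨x, hx, hx0, hxn⟩ := Nat.find_spec hex
  have hmin := fun m => Nat.find_min hex (m := m)
  generalize Nat.find hex = n at hxn hmin
  cases n with
  | zero =>
    rw [h.zero_eq] at hxn
    obtain ⟨r, rfl⟩ := Submodule.mem_span_singleton.1 hxn
    have hr : r ≠ 0 := by
      rintro rfl
      exact hx0 (zero_smul _ _)
    exact (Submodule.smul_mem_iff X hr).1 hx
  | succ n =>
    refine absurd (hD.eq_zero_of_comul ?_) hx0
    have hinj : ∀ m ≤ n, Function.Injective ((F m).mkQ ∘ₗ X.subtype) := by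
      intro m hm
      rw [← LinearMap.ker_eq_bot, LinearMap.ker_eq_bot']
      intro y hy
      have hyF : (y : A) ∈ F m := (Submodule.Quotient.mk_eq_zero _).1 hy
      by_contra hy0
      exact hmin m (by omega) ⟨y, y.2, fun h0 => hy0 (Subtype.ext h0), hyF⟩
    obtain ⟨t, ht⟩ := hX hx
    have h1 : TensorProduct.map (F 0).mkQ (F n).mkQ (D.comul x) = 0 := by
      refine (iSup₂_le ?_ : _ ≤ LinearMap.ker
        (TensorProduct.map (F 0).mkQ (F n).mkQ)) (h.comul_mem (n + 1) hxn)
      rintro ⟨i, j⟩ hij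
      simp only at hij
      rw [ker_map_mkQ]
      rcases Nat.eq_zero_or_pos i with rfl | hi
      · exact (tens_mono le_rfl le_top).trans le_sup_left
      · exact (tens_mono le_top (h.mono (by omega))).trans le_sup_right
    have h2 : t = 0 := by
      refine (map_eq_zero_iff _ (TensorProduct.map_injective_of_flat_flat _ _
        (hinj 0 (Nat.zero_le n)) (hinj n le_rfl))).1 ?_
      rw [TensorProduct.map_comp, LinearMap.comp_apply]
      exact (congrArg _ ht).trans h1
    rw [← ht, h2, map_zero]

/-- The coradical of a connected filtered braided bialgebra. -/
theorem IsConnectedFiltered.coradical_eq {F : ℕ → Submodule K A} (h : IsConnectedFiltered D F) :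
    D.coradical = K ∙ D.one := by
  have hD := h.isBraidedBialgebra
  have hs : D.IsSubcoalgebra (K ∙ D.one) := by
    rw [Data.IsSubcoalgebra, Submodule.span_singleton_le_iff_mem, Submodule.mem_comap, hD.comul_one]
    exact tmul_mem_tens (Submodule.mem_span_singleton_self _) (Submodule.mem_span_singleton_self _)
  refine le_antisymm (sSup_le fun X hX => ?_) (le_sSup ⟨hs, ?_, fun Y _ hYle => ?_⟩)
  · have h1 := h.one_mem_of_isSubcoalgebra hX.1 hX.2.1
    rcases hX.2.2 _ hs ((Submodule.span_singleton_le_iff_mem _ _).2 h1) with h2 | h2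
    · exact absurd (Submodule.span_singleton_eq_bot.1 h2) hD.one_ne_zero
    · exact h2.ge
  · exact fun h2 => hD.one_ne_zero (Submodule.span_singleton_eq_bot.1 h2)
  · exact (nonzero_span_atom D.one hD.one_ne_zero).le_iff.1 hYle

/-- Among the summands F i ⊗ F j of the coproduct in degree n + 1, the one with i = 0 has its first
factor in the coradical, and the others have j ≤ n. -/
theorem IsConnectedFiltered.le_coradFil {F : ℕ → Submodule K A} (h : IsConnectedFiltered D F)
    (n : ℕ) : F n ≤ D.coradFil n := by
  induction n with
  | zero => rw [Data.coradFil, h.coradical_eq, h.zero_eq]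
  | succ n ih =>
    refine (h.comul_mem (n + 1)).trans (Submodule.comap_mono (iSup₂_le ?_))
    rintro ⟨i, j⟩ hij
    simp only at hij
    rcases Nat.eq_zero_or_pos i with rfl | hi
    · rw [h.coradical_eq, ← h.zero_eq]
      exact (tens_mono le_rfl le_top).trans le_sup_right
    · exact (tens_mono le_top ((h.mono (by omega)).trans ih)).trans le_sup_left

end Coradical

/-! ### The comultiplication and the coradical filtration when the coradical is K. -/

section CoradicalFiltration

variable {K : Type u} [Field K] {A : Type*} [AddCommGroup A] [Module K A] {D : Data K A}

/-- Written as a kernel, a step of the filtration can be tested inside a tensor product, and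
coassociativity becomes applicable. -/
theorem coradFil_succ_eq_ker (n : ℕ) : D.coradFil (n + 1) = LinearMap.ker
    (TensorProduct.map (D.coradFil 0).mkQ (D.coradFil n).mkQ ∘ₗ D.comul) := by
  rw [LinearMap.ker_comp, ker_map_mkQ, sup_comm]
  rfl

theorem mem_coradFil_zero (h0 : D.coradical = K ∙ D.one) {x : A} :
    x ∈ D.coradFil 0 ↔ ∃ r : K, r • D.one = x := by
  rw [Data.coradFil, h0, Submodule.mem_span_singleton]

theorem one_mem_coradFil_zero (h0 : D.coradical = K ∙ D.one) : D.one ∈ D.coradFil 0 :=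
  (mem_coradFil_zero h0).2 ⟨1, one_smul _ _⟩

/-- To check a property of the comultiplications of elements of `A_{n+1}`. -/
theorem comul_mem_of_mem_coradFil_succ (h0 : D.coradical = K ∙ D.one) {n : ℕ}
    {W : Submodule K (A ⊗[K] A)} (h1 : ∀ a, ∀ u ∈ D.coradFil n, a ⊗ₜ u ∈ W)
    (h2 : ∀ z, D.one ⊗ₜ z ∈ W) {x : A} (hx : x ∈ D.coradFil (n + 1)) : D.comul x ∈ W := by
  refine (sup_le (tens_le fun a _ u hu => h1 a u hu) (tens_le fun y hy z _ => ?_) :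
    tens ⊤ (D.coradFil n) ⊔ tens D.coradical ⊤ ≤ W) hx
  rw [h0] at hy
  obtain ⟨r, rfl⟩ := Submodule.mem_span_singleton.1 hy
  rw [← TensorProduct.smul_tmul']
  exact W.smul_mem r (h2 z)

theorem coradFil_le_succ (hD : D.IsBraidedBialgebra) (h0 : D.coradical = K ∙ D.one) (n : ℕ) :
    D.coradFil n ≤ D.coradFil (n + 1) := by
  induction n with
  | zero =>
    intro x hx
    obtain ⟨r, rfl⟩ := (mem_coradFil_zero h0).1 hx
    refine Submodule.smul_mem _ r ?_
    change D.comul D.one ∈ tens ⊤ (D.coradFil 0) ⊔ tens D.coradical ⊤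
    rw [hD.comul_one]
    exact Submodule.mem_sup_left (tmul_mem_tens trivial (one_mem_coradFil_zero h0))
  | succ n ih =>
    exact Submodule.comap_mono (sup_le_sup_right (tens_mono le_rfl ih) _)

theorem monotone_coradFil (hD : D.IsBraidedBialgebra) (h0 : D.coradical = K ∙ D.one) :
    Monotone D.coradFil :=
  monotone_nat_of_le_succ (coradFil_le_succ hD h0)

theorem lTensor_tmul_eq_zero {A B C M : Type*} [AddCommGroup A] [Module K A] [AddCommGroup B] [Module K B]
    [AddCommGroup C] [Module K C] [AddCommGroup M] [Module K M] (f : A →ₗ[K] B) (g : C →ₗ[K] M)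
    (s : A ⊗[K] A) {y : C} (hy : g y = 0) {X : Type*} [AddCommGroup X] [Module K X]
    (f' : A →ₗ[K] X) :
    TensorProduct.map f' (TensorProduct.map f g) (TensorProduct.assoc K A A C (s ⊗ₜ y)) = 0 := by
  induction s with
  | zero => simp
  | tmul a b => simp [hy]
  | add a b ha hb => rw [TensorProduct.add_tmul, map_add, map_add, ha, hb, add_zero]

theorem coassoc_apply (hD : D.IsBraidedBialgebra) (x : A) :
    D.comul.lTensor A (D.comul x) = TensorProduct.assoc K A A A (D.comul.rTensor A (D.comul x)) :=
  (LinearMap.congr_fun hD.coassoc x).symm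

/-- By the kernel description one applies Δ to the second factor of Δ x, or equivalently to the
first. Now Δ x is made of terms a ⊗ u with u in Aₙ and 1 ⊗ z. The former vanish in the last factor A
/ Aₙ; the latter become 1 ⊗ 1 ⊗ z, which vanishes in the middle factor A / A₀. -/
theorem comul_mem_top_tens (hD : D.IsBraidedBialgebra) (h0 : D.coradical = K ∙ D.one) {n : ℕ}
    {x : A} (hx : x ∈ D.coradFil n) : D.comul x ∈ tens ⊤ (D.coradFil n) := by
  cases n with
  | zero =>
    obtain ⟨r, rfl⟩ := (mem_coradFil_zero h0).1 hx
    rw [map_smul, hD.comul_one]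
    exact Submodule.smul_mem _ r (tmul_mem_tens trivial (one_mem_coradFil_zero h0))
  | succ n =>
    rw [mem_top_tens_iff]
    refine lTensor_eq_zero_of_ker_le (f := TensorProduct.map (D.coradFil 0).mkQ
      (D.coradFil n).mkQ ∘ₗ D.comul) (by rw [Submodule.ker_mkQ, ← coradFil_succ_eq_ker]) ?_
    rw [LinearMap.lTensor_comp_apply, coassoc_apply hD]
    refine comul_mem_of_mem_coradFil_succ h0 (W := LinearMap.ker
      ((TensorProduct.map (D.coradFil 0).mkQ (D.coradFil n).mkQ).lTensor A ∘ₗ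
        (TensorProduct.assoc K A A A).toLinearMap ∘ₗ D.comul.rTensor A)) ?_ ?_ hx
    · intro a u hu
      exact lTensor_tmul_eq_zero _ _ _ ((Submodule.Quotient.mk_eq_zero _).2 hu) LinearMap.id
    · intro z
      have h : (Submodule.Quotient.mk D.one : A ⧸ D.coradFil 0) = 0 :=
        (Submodule.Quotient.mk_eq_zero _).2 (one_mem_coradFil_zero h0)
      simp [hD.comul_one, h]

/-- Induction on i. For i = 0 the claim is Δ(Aₙ) ⊆ A ⊗ Aₙ; for i = 1 and n > 0 it is the definition
of Aₙ. Beyond that, A_{i-1} is itself a kernel, and coassociativity moves the second Δ to the right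
factor of Δ x: terms a ⊗ u with u in A_{n-1} vanish by the hypothesis for i - 1, terms 1 ⊗ z vanish
in A / A₀. -/
theorem map_mkQ_comul_eq_zero (hD : D.IsBraidedBialgebra) (h0 : D.coradical = K ∙ D.one) (i : ℕ) :
    ∀ {j n : ℕ}, i + j = n + 1 → ∀ {x : A}, x ∈ D.coradFil n →
      TensorProduct.map (below D.coradFil i).mkQ (below D.coradFil j).mkQ (D.comul x) = 0 := by
  induction i with
  | zero =>
    intro j n hn x hx
    obtain rfl : j = n + 1 := by omega
    rw [← LinearMap.mem_ker, ker_map_mkQ]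
    exact Submodule.mem_sup_right (comul_mem_top_tens hD h0 hx)
  | succ i ih =>
    intro j n hn x hx
    cases n with
    | zero =>
      obtain ⟨rfl, rfl⟩ : i = 0 ∧ j = 0 := by omega
      obtain ⟨r, rfl⟩ := (mem_coradFil_zero h0).1 hx
      rw [map_smul, hD.comul_one, ← LinearMap.mem_ker, ker_map_mkQ]
      exact Submodule.smul_mem _ r
        (Submodule.mem_sup_left (tmul_mem_tens (one_mem_coradFil_zero h0) trivial))
    | succ n =>
      cases i with
      | zero =>
        obtain rfl : j = n + 1 := by omega
        rw [coradFil_succ_eq_ker] at hx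
        exact hx
      | succ i =>
        rw [← LinearMap.rTensor_comp_lTensor, LinearMap.comp_apply]
        refine rTensor_eq_zero_of_ker_le (f := TensorProduct.map (D.coradFil 0).mkQ
          (D.coradFil i).mkQ ∘ₗ D.comul)
          (by rw [← coradFil_succ_eq_ker, Submodule.ker_mkQ]; rfl) ?_
        apply (TensorProduct.assoc K (A ⧸ D.coradFil 0) (A ⧸ D.coradFil i) _).injective
        rw [map_zero, ← LinearMap.comp_apply, LinearMap.rTensor_comp_lTensor]
        have e : ∀ t : A ⊗[K] A,
            TensorProduct.assoc K (A ⧸ D.coradFil 0) (A ⧸ D.coradFil i) _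
              (TensorProduct.map (TensorProduct.map (D.coradFil 0).mkQ (D.coradFil i).mkQ ∘ₗ
                D.comul) (below D.coradFil j).mkQ t)
            = TensorProduct.map (D.coradFil 0).mkQ (TensorProduct.map (D.coradFil i).mkQ
                (below D.coradFil j).mkQ)
              (TensorProduct.assoc K A A A (D.comul.rTensor A t)) := by
          intro t
          induction t with
          | zero => simp
          | tmul a b =>
            rw [LinearMap.rTensor_tmul, TensorProduct.map_tmul, LinearMap.comp_apply]
            generalize D.comul a = s
            induction s with
            | zero => simp
            | tmul p q => rfl
            | add p q hp hq => simp only [map_add, TensorProduct.add_tmul, hp, hq]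
          | add p q hp hq => simp only [map_add, hp, hq]
        rw [e, ← coassoc_apply hD]
        refine comul_mem_of_mem_coradFil_succ h0 (W := LinearMap.ker
          (TensorProduct.map (D.coradFil 0).mkQ (TensorProduct.map (D.coradFil i).mkQ
            (below D.coradFil j).mkQ) ∘ₗ D.comul.lTensor A)) ?_ ?_ hx
        · intro a u hu
          rw [LinearMap.mem_ker, LinearMap.comp_apply, LinearMap.lTensor_tmul,
            TensorProduct.map_tmul]
          have := ih (j := j) (n := n) (by omega : i + 1 + j = n + 1) hu
          rw [show TensorProduct.map (D.coradFil i).mkQ (below D.coradFil j).mkQ (D.comul u) = 0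
            from this, TensorProduct.tmul_zero]
        · intro z
          have h : (Submodule.Quotient.mk D.one : A ⧸ D.coradFil 0) = 0 :=
            (Submodule.Quotient.mk_eq_zero _).2 (one_mem_coradFil_zero h0)
          simp [h]

theorem comul_mem_coradFil (hD : D.IsBraidedBialgebra) (h0 : D.coradical = K ∙ D.one) {n : ℕ}
    {x : A} (hx : x ∈ D.coradFil n) : D.comul x ∈
      ⨆ (p : ℕ × ℕ) (_ : p.1 + p.2 = n), tens (D.coradFil p.1) (D.coradFil p.2) :=
  mem_iSup_tens_of_map_mkQ_eq_zero (monotone_coradFil hD h0) fun i _ hij =>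
    map_mkQ_comul_eq_zero hD h0 i hij hx

end CoradicalFiltration

/-! ### The braiding, the multiplication and the coradical filtration. -/

section CoradicalBraiding

variable {K : Type u} [Field K] {A : Type*} [AddCommGroup A] [Module K A] {D : Data K A}

/-- Applying Δ to the strand of x after the braiding is the same as braiding both parts of Δ x past
y. In terms a ⊗ u with u in Aₙ the last factor stays in Aₙ by induction; in terms 1 ⊗ z the 1 passes
unchanged and dies in A / A₀. -/
theorem braid_mem_top_tens (hD : D.IsBraidedBialgebra) (h0 : D.coradical = K ∙ D.one) (n : ℕ) :
    ∀ {x : A}, x ∈ D.coradFil n → ∀ y, D.braid (x ⊗ₜ y) ∈ tens ⊤ (D.coradFil n) := by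
  induction n with
  | zero =>
    intro x hx y
    obtain ⟨r, rfl⟩ := (mem_coradFil_zero h0).1 hx
    rw [← TensorProduct.smul_tmul', map_smul, hD.braid_one_left]
    exact Submodule.smul_mem _ r (tmul_mem_tens trivial (one_mem_coradFil_zero h0))
  | succ n ih =>
    intro x hx y
    rw [mem_top_tens_iff]
    refine lTensor_eq_zero_of_ker_le (f := TensorProduct.map (D.coradFil 0).mkQ
      (D.coradFil n).mkQ ∘ₗ D.comul) (by rw [Submodule.ker_mkQ, ← coradFil_succ_eq_ker]) ?_
    have h := congrArg (TensorProduct.assoc K A A A)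
      (LinearMap.congr_fun hD.comul_braid_right (x ⊗ₜ y))
    simp only [LinearMap.comp_apply, LinearEquiv.coe_coe, LinearEquiv.apply_symm_apply] at h
    rw [LinearMap.lTensor_comp_apply, h]
    refine comul_mem_of_mem_coradFil_succ h0 (W := LinearMap.ker
      ((TensorProduct.map (D.coradFil 0).mkQ (D.coradFil n).mkQ).lTensor A ∘ₗ
        (TensorProduct.assoc K A A A).toLinearMap ∘ₗ c₁ D.braid ∘ₗ c₂ D.braid ∘ₗ
        (TensorProduct.mk K (A ⊗[K] A) A).flip y)) ?_ ?_ hx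
    · intro a u hu
      refine (tens_le fun y' _ u' hu' => ?_ : tens ⊤ (D.coradFil n) ≤ LinearMap.ker
        ((TensorProduct.map (D.coradFil 0).mkQ (D.coradFil n).mkQ).lTensor A ∘ₗ
        (TensorProduct.assoc K A A A).toLinearMap ∘ₗ c₁ D.braid ∘ₗ
        (TensorProduct.assoc K A A A).symm.toLinearMap ∘ₗ TensorProduct.mk K A (A ⊗[K] A) a))
        (ih hu y)
      exact lTensor_tmul_eq_zero _ _ _ ((Submodule.Quotient.mk_eq_zero _).2 hu') LinearMap.id
    · intro z
      have h1 : (Submodule.Quotient.mk D.one : A ⧸ D.coradFil 0) = 0 :=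
        (Submodule.Quotient.mk_eq_zero _).2 (one_mem_coradFil_zero h0)
      simp only [LinearMap.mem_ker, LinearMap.comp_apply, c₂, LinearMap.flip_apply,
        TensorProduct.mk_apply, LinearEquiv.coe_coe, TensorProduct.assoc_tmul,
        LinearMap.lTensor_tmul]
      generalize D.braid (z ⊗ₜ y) = t
      induction t with
      | zero => simp
      | tmul p q => simp [c₁, hD.braid_one_left, h1]
      | add p q hp hq => simp only [map_add, TensorProduct.tmul_add, hp, hq, add_zero]

/-- The mirror image of `braid_mem_top_tens`, with Δ on the strand of y. The two inclusions together
give the compatibility of the braiding, by intersecting. -/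
theorem braid_mem_tens_top (hD : D.IsBraidedBialgebra) (h0 : D.coradical = K ∙ D.one) (n : ℕ) :
    ∀ {y : A}, y ∈ D.coradFil n → ∀ x, D.braid (x ⊗ₜ y) ∈ tens (D.coradFil n) ⊤ := by
  induction n with
  | zero =>
    intro y hy x
    obtain ⟨r, rfl⟩ := (mem_coradFil_zero h0).1 hy
    rw [TensorProduct.tmul_smul, map_smul, hD.braid_one_right]
    exact Submodule.smul_mem _ r (tmul_mem_tens (one_mem_coradFil_zero h0) trivial)
  | succ n ih =>
    intro y hy x
    rw [mem_tens_top_iff]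
    refine rTensor_eq_zero_of_ker_le (f := TensorProduct.map (D.coradFil 0).mkQ
      (D.coradFil n).mkQ ∘ₗ D.comul) (by rw [Submodule.ker_mkQ, ← coradFil_succ_eq_ker]) ?_
    have h := LinearMap.congr_fun hD.comul_braid_left (x ⊗ₜ y)
    simp only [LinearMap.comp_apply, LinearEquiv.coe_coe, LinearMap.lTensor_tmul] at h
    rw [LinearMap.rTensor_comp_apply, h]
    refine comul_mem_of_mem_coradFil_succ h0 (W := LinearMap.ker
      ((TensorProduct.map (D.coradFil 0).mkQ (D.coradFil n).mkQ).rTensor A ∘ₗ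
        c₂ D.braid ∘ₗ c₁ D.braid ∘ₗ (TensorProduct.assoc K A A A).symm.toLinearMap ∘ₗ
        TensorProduct.mk K A (A ⊗[K] A) x)) ?_ ?_ hy
    · intro a u hu
      simp only [LinearMap.mem_ker, LinearMap.comp_apply, c₁, LinearEquiv.coe_coe,
        TensorProduct.mk_apply, TensorProduct.assoc_symm_tmul, LinearMap.rTensor_tmul]
      generalize D.braid (x ⊗ₜ a) = t
      induction t with
      | zero => simp
      | tmul p q =>
        refine (tens_le fun u' hu' q' _ => ?_ : tens (D.coradFil n) ⊤ ≤ LinearMap.ker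
          ((TensorProduct.map (D.coradFil 0).mkQ (D.coradFil n).mkQ).rTensor A ∘ₗ
          (TensorProduct.assoc K A A A).symm.toLinearMap ∘ₗ TensorProduct.mk K A (A ⊗[K] A) p))
          (ih hu q)
        have h1 : (Submodule.Quotient.mk u' : A ⧸ D.coradFil n) = 0 :=
          (Submodule.Quotient.mk_eq_zero _).2 hu'
        simp [h1]
      | add p q hp hq => simp only [map_add, TensorProduct.add_tmul, hp, hq, add_zero]
    · intro z
      have h1 : (Submodule.Quotient.mk D.one : A ⧸ D.coradFil 0) = 0 :=
        (Submodule.Quotient.mk_eq_zero _).2 (one_mem_coradFil_zero h0)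
      simp only [LinearMap.mem_ker, LinearMap.comp_apply, c₁, c₂, LinearEquiv.coe_coe,
        TensorProduct.mk_apply, TensorProduct.assoc_symm_tmul, LinearMap.rTensor_tmul,
        hD.braid_one_right, TensorProduct.assoc_tmul, LinearMap.lTensor_tmul]
      generalize D.braid (x ⊗ₜ z) = t
      induction t with
      | zero => simp
      | tmul p q => simp [h1]
      | add p q hp hq => simp only [map_add, TensorProduct.tmul_add, hp, hq, add_zero]

theorem braid_mem_coradFil (hD : D.IsBraidedBialgebra) (h0 : D.coradical = K ∙ D.one) {i j : ℕ}
    {x y : A} (hx : x ∈ D.coradFil i) (hy : y ∈ D.coradFil j) :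
    D.braid (x ⊗ₜ y) ∈ tens (D.coradFil j) (D.coradFil i) := by
  rw [← tens_top_inf_top_tens]
  exact ⟨braid_mem_tens_top hD h0 j hy x, braid_mem_top_tens hD h0 i hx y⟩

/-- To check a property of the comultiplication of a product. -/
theorem comul_mul_mem (hD : D.IsBraidedBialgebra)
    {i j : ℕ} {F : ℕ → Submodule K A}
    (hb : ∀ i j, ∀ x ∈ F i, ∀ y ∈ F j, D.braid (x ⊗ₜ y) ∈ tens (F j) (F i))
    (hc : ∀ i, ∀ x ∈ F i, D.comul x ∈ ⨆ (p : ℕ × ℕ) (_ : p.1 + p.2 = i), tens (F p.1) (F p.2))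
    {W : Submodule K (A ⊗[K] A)}
    (h : ∀ a b a' b', a + b = i → a' + b' = j → ∀ p ∈ F a, ∀ r ∈ F a', ∀ q ∈ F b, ∀ s ∈ F b',
      D.mul (p ⊗ₜ r) ⊗ₜ D.mul (q ⊗ₜ s) ∈ W)
    {x y : A} (hx : x ∈ F i) (hy : y ∈ F j) : D.comul (D.mul (x ⊗ₜ y)) ∈ W := by
  have e := LinearMap.congr_fun hD.comul_mul (x ⊗ₜ y)
  simp only [LinearMap.comp_apply, TensorProduct.map_tmul] at e
  rw [e]
  refine (iSup₂_le fun ab hab => tens_le fun p hp q hq => ?_ :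
    (⨆ (p : ℕ × ℕ) (_ : p.1 + p.2 = i), tens (F p.1) (F p.2)) ≤ W.comap
      (TensorProduct.map D.mul D.mul ∘ₗ cMid D.braid ∘ₗ
        (TensorProduct.mk K (A ⊗[K] A) (A ⊗[K] A)).flip (D.comul y))) (hc i x hx)
  refine (iSup₂_le fun cd hcd => tens_le fun r hr s hs => ?_ :
    (⨆ (p : ℕ × ℕ) (_ : p.1 + p.2 = j), tens (F p.1) (F p.2)) ≤ W.comap
      (TensorProduct.map D.mul D.mul ∘ₗ cMid D.braid ∘ₗ
        TensorProduct.mk K (A ⊗[K] A) (A ⊗[K] A) (p ⊗ₜ q))) (hc j y hy)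
  refine (tens_le fun r' hr' q' hq' => ?_ : tens (F cd.1) (F ab.2) ≤ W.comap
    (TensorProduct.map D.mul D.mul ∘ₗ (TensorProduct.assoc K A A (A ⊗[K] A)).symm.toLinearMap ∘ₗ
      TensorProduct.mk K A _ p ∘ₗ (TensorProduct.assoc K A A A).toLinearMap ∘ₗ
      (TensorProduct.mk K (A ⊗[K] A) A).flip s)) (hb _ _ q hq r hr)
  exact h _ _ _ _ hab hcd p hp r' hr' q' hq' s hs

/-- Induction on the total degree m + 1. The coproduct of xy is a sum of terms pr ⊗ qs with p, r, q,
s in degrees a, a', b, b' of total sum m + 1. If a = a' = 0 then pr lies in the coradical; otherwise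
b + b' ≤ m and qs lies in A_m by induction. Both kinds are allowed in the definition of the next
step. -/
theorem mul_mem_coradFil (hD : D.IsBraidedBialgebra) (h0 : D.coradical = K ∙ D.one) (m : ℕ) :
    ∀ {i j : ℕ}, i + j = m → ∀ {x y : A}, x ∈ D.coradFil i → y ∈ D.coradFil j →
      D.mul (x ⊗ₜ y) ∈ D.coradFil m := by
  induction m using Nat.strong_induction_on with
  | _ m ih =>
    intro i j hij x y hx hy
    have hmul0 : ∀ {x y : A} {j : ℕ}, x ∈ D.coradFil 0 → y ∈ D.coradFil j →
        D.mul (x ⊗ₜ y) ∈ D.coradFil j := by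
      intro x y j hx hy
      obtain ⟨r, rfl⟩ := (mem_coradFil_zero h0).1 hx
      rw [← TensorProduct.smul_tmul', map_smul, hD.one_mul]
      exact Submodule.smul_mem _ r hy
    cases m with
    | zero =>
      obtain ⟨rfl, rfl⟩ : i = 0 ∧ j = 0 := by omega
      exact hmul0 hx hy
    | succ m =>
      change _ ∈ tens ⊤ (D.coradFil m) ⊔ tens D.coradical ⊤
      refine comul_mul_mem hD (F := D.coradFil)
        (fun i j x hx y hy => braid_mem_coradFil hD h0 hx hy)
        (fun i x hx => comul_mem_coradFil hD h0 hx) ?_ hx hy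
      intro a b a' b' hab hab' p hp r hr q hq s hs
      by_cases h : a = 0 ∧ a' = 0
      · obtain ⟨rfl, rfl⟩ := h
        exact Submodule.mem_sup_right (tmul_mem_tens (hmul0 hp hr) trivial)
      · refine Submodule.mem_sup_left (tmul_mem_tens trivial ?_)
        exact monotone_coradFil hD h0 (by omega : b + b' ≤ m) (ih (b + b') (by omega) rfl hq hs)

/-- The coradical filtration of a connected filtered braided bialgebra. -/
theorem IsConnectedFiltered.isConnectedFiltered_coradFil {F : ℕ → Submodule K A}
    (h : IsConnectedFiltered D F) : IsConnectedFiltered D D.coradFil where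
  isBraidedBialgebra := h.isBraidedBialgebra
  mono := monotone_coradFil h.isBraidedBialgebra h.coradical_eq
  exhaustive := top_le_iff.1 (h.exhaustive.ge.trans (iSup_mono h.le_coradFil))
  zero_eq := h.coradical_eq
  mul_mem i j := tens_le fun _ hx _ hy =>
    mul_mem_coradFil h.isBraidedBialgebra h.coradical_eq (i + j) rfl hx hy
  comul_mem _ _ hx := comul_mem_coradFil h.isBraidedBialgebra h.coradical_eq hx
  braid_mem _ _ := tens_le fun _ hx _ hy =>
    braid_mem_coradFil h.isBraidedBialgebra h.coradical_eq hx hy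

end CoradicalBraiding

/-! ### The filtration induced by the degree of tensors -/

section Standard

variable {K : Type u} [Field K] {V : Type v} [AddCommGroup V] [Module K V]
variable {c : V ⊗[K] V →ₗ[K] V ⊗[K] V}
variable {A : Type*} [AddCommGroup A] [Module K A] {D : Data K A}

local notation "𝕋" => TensorAlgebra K V

/-- The tensors of degree at most `n`. -/
def tLE (K : Type u) [Field K] (V : Type v) [AddCommGroup V] [Module K V] (n : ℕ) :
    Submodule K (TensorAlgebra K V) :=
  ⨆ (i : ℕ) (_ : i ≤ n), tPow K V i

theorem tPow_le_tLE {i n : ℕ} (h : i ≤ n) : tPow K V i ≤ tLE K V n :=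
  le_iSup₂ (f := fun (i : ℕ) (_ : i ≤ n) => tPow K V i) i h

theorem tLE_le {n : ℕ} {W : Submodule K 𝕋} (h : ∀ i ≤ n, tPow K V i ≤ W) : tLE K V n ≤ W :=
  iSup₂_le h

theorem tPow_zero_eq : tPow K V 0 = K ∙ (1 : 𝕋) :=
  le_antisymm (tPow_zero_le (Submodule.mem_span_singleton_self _))
    ((Submodule.span_singleton_le_iff_mem _ _).2 one_mem_tPow)

/-- The images of the tensors of bounded degree form a filtration. -/
theorem isConnectedFiltered_map (hc : IsBraiding c) (hD : D.IsBraidedBialgebra) {p : 𝕋 →ₗ[K] A}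
    (hp : (tensorData c).IsHom D p) (hs : Function.Surjective p) :
    IsConnectedFiltered D fun n => (tLE K V n).map p := by
  have hT := isGradedBraidedBialgebra_tensorData c hc
  have hmono : Monotone fun n => (tLE K V n).map p := fun m n h =>
    Submodule.map_mono (tLE_le fun i hi => tPow_le_tLE (hi.trans h))
  have hle : ∀ {n : ℕ} {W : Submodule K A}, (∀ i ≤ n, ∀ x ∈ tPow K V i, p x ∈ W) →
      (tLE K V n).map p ≤ W := fun h => Submodule.map_le_iff_le_comap.2 (tLE_le h)
  have hmem : ∀ {i n : ℕ}, i ≤ n → ∀ {x : 𝕋}, x ∈ tPow K V i → p x ∈ (tLE K V n).map p :=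
    fun hi x hx => Submodule.mem_map_of_mem (tPow_le_tLE hi hx)
  have htens : ∀ {i j m n : ℕ}, i ≤ m → j ≤ n → tens (tPow K V i) (tPow K V j) ≤
      (tens ((tLE K V m).map p) ((tLE K V n).map p)).comap (TensorProduct.map p p) :=
    fun hi hj => tens_le fun x hx y hy => tmul_mem_tens (hmem hi hx) (hmem hj hy)
  have hle2 : ∀ {i j : ℕ} {B : Type _} [AddCommGroup B] [Module K B] (g : A ⊗[K] A →ₗ[K] B)
      {W : Submodule K B}, (∀ a ≤ i, ∀ b ≤ j, ∀ x ∈ tPow K V a, ∀ y ∈ tPow K V b,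
        g (p x ⊗ₜ p y) ∈ W) → tens ((tLE K V i).map p) ((tLE K V j).map p) ≤ W.comap g := by
    intro i j B _ _ g W h
    refine tens_le fun x hx y hy => ?_
    refine (hle (W := W.comap (g ∘ₗ (TensorProduct.mk K A A).flip y)) fun a ha x hx => ?_) hx
    exact (hle (W := W.comap (g ∘ₗ TensorProduct.mk K A A (p x))) fun b hb y hy =>
      h a ha b hb x hx y hy) hy
  refine ⟨hD, hmono, ?_, ?_, fun i j => ?_, fun n => ?_, fun i j => ?_⟩
  · rw [← Submodule.map_iSup, eq_top_iff, ← LinearMap.range_eq_top.2 hs, LinearMap.range_eq_map]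
    refine Submodule.map_mono ?_
    rw [← isInternal_tPow.submodule_iSup_eq_top]
    exact iSup_mono fun n => tPow_le_tLE le_rfl
  · have h : tLE K V 0 = K ∙ (1 : 𝕋) := by
      rw [← tPow_zero_eq]
      exact le_antisymm (tLE_le fun i hi => by rw [Nat.le_zero.1 hi]) (tPow_le_tLE le_rfl)
    rw [h, Submodule.map_span, Set.image_singleton]
    exact congrArg _ (congrArg _ hp.map_one)
  · refine hle2 _ fun a ha b hb x hx y hy => ?_
    have h := LinearMap.congr_fun hp.map_mul (x ⊗ₜ y)
    exact (show D.mul (p x ⊗ₜ p y) = p (x * y) from h.symm) ▸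
      hmem (Nat.add_le_add ha hb) (mul_mem_tPow hx hy)
  · refine hle fun i hi x hx => ?_
    have e := LinearMap.congr_fun hp.map_comul x
    rw [LinearMap.comp_apply, LinearMap.comp_apply] at e
    rw [Submodule.mem_comap, ← e]
    refine (iSup₂_le fun ab hab => ?_ : (⨆ (p : ℕ × ℕ) (_ : p.1 + p.2 = i),
      tens (tPow K V p.1) (tPow K V p.2)) ≤ Submodule.comap (TensorProduct.map p p)
        (⨆ (q : ℕ × ℕ) (_ : q.1 + q.2 = n), tens ((tLE K V q.1).map p) ((tLE K V q.2).map p)))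
      (hT.comul_mem i hx)
    -- The tensor x has degree i ≤ n, so its bidegree may sum to less than n; the first index is
    -- raised to n - ab.2.
    exact (htens (by omega : ab.1 ≤ n - ab.2) le_rfl).trans (Submodule.comap_mono
      (tens_le_iSup (fun n => (tLE K V n).map p) (by omega : n - ab.2 + ab.2 = n)))
  · refine hle2 _ fun a ha b hb x hx y hy => ?_
    have h := LinearMap.congr_fun hp.map_braid (x ⊗ₜ y)
    exact (show D.braid (p x ⊗ₜ p y) = TensorProduct.map p p (braidT c (x ⊗ₜ y)) from h.symm) ▸
      htens hb ha (braidT_mem c hx hy)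

end Standard

/-! ### The symbol map -/

section SymbolMap

open SymRel

variable {K : Type u} [Field K] {V : Type v} [AddCommGroup V] [Module K V]
variable {c : V ⊗[K] V →ₗ[K] V ⊗[K] V}
variable {A : Type*} [AddCommGroup A] [Module K A] {D : Data K A}

local notation "𝕋" => TensorAlgebra K V

theorem bijective_coeLinearMap_tPow :
    Function.Bijective (DirectSum.coeLinearMap (tPow K V)) :=
  isInternal_tPow

/-- The map to the associated graded space which sends a homogeneous tensor `x` of degree `n` to the
class of `p x` in degree `n`. -/
def symbolMap (F : ℕ → Submodule K A) (p : 𝕋 →ₗ[K] A) (hp : ∀ n, ∀ x ∈ tPow K V n, p x ∈ F n) :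
    𝕋 →ₗ[K] Gr F :=
  DirectSum.toModule K ℕ (Gr F) (fun n => cls F n ∘ₗ p.restrict (hp n)) ∘ₗ
    (LinearEquiv.ofBijective _ (bijective_coeLinearMap_tPow (K := K) (V := V))).symm.toLinearMap

variable {F : ℕ → Submodule K A} {p : TensorAlgebra K V →ₗ[K] A}

theorem symbolMap_apply {hp : ∀ n, ∀ x ∈ tPow K V n, p x ∈ F n} {n : ℕ} {x : 𝕋} (hx : x ∈ tPow K V n) :
    symbolMap F p hp x = cls F n ⟨p x, hp n x hx⟩ := by
  have h : (LinearEquiv.ofBijective _ (bijective_coeLinearMap_tPow (K := K) (V := V))).symm x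
      = DirectSum.lof K ℕ (fun n => tPow K V n) n ⟨x, hx⟩ := by
    rw [LinearEquiv.symm_apply_eq, LinearEquiv.ofBijective_apply]
    exact (DirectSum.coeLinearMap_lof (tPow K V) n ⟨x, hx⟩).symm
  rw [symbolMap, LinearMap.comp_apply, LinearEquiv.coe_coe, h, DirectSum.toModule_lof]
  rfl

/-- The relation between homogeneous elements and themselves. -/
def SymRel.ofGrading (𝒜 : ℕ → Submodule K A) : SymRel K A A := fun n =>
  (𝒜 n).map (LinearMap.id.prod LinearMap.id)

theorem SymRel.mem_ofGrading {𝒜 : ℕ → Submodule K A} {n : ℕ} {x y : A} :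
    (x, y) ∈ ofGrading 𝒜 n ↔ x ∈ 𝒜 n ∧ x = y := by
  constructor
  · rintro ⟨z, hz, h⟩
    obtain ⟨rfl, rfl⟩ := Prod.mk.inj h
    exact ⟨hz, rfl⟩
  · rintro ⟨h, rfl⟩
    exact ⟨x, h, rfl⟩

theorem SymRel.mem_tensor_ofGrading {𝒜 : ℕ → Submodule K A} {i j n : ℕ} (hn : i + j = n)
    {t : A ⊗[K] A} (ht : t ∈ tens (𝒜 i) (𝒜 j)) :
    (t, t) ∈ (ofGrading 𝒜).tensor (ofGrading 𝒜) n :=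
  (tens_le fun _ hx _ hy => tmul_mem hn (mem_ofGrading.2 ⟨hx, rfl⟩) (mem_ofGrading.2 ⟨hy, rfl⟩) :
    tens (𝒜 i) (𝒜 j) ≤ ((ofGrading 𝒜).tensor (ofGrading 𝒜) n).comap
      (LinearMap.id.prod LinearMap.id)) ht

theorem SymRel.spans_ofGrading {𝒜 : ℕ → Submodule K A} (h : DirectSum.IsInternal 𝒜) :
    Spans (ofGrading 𝒜) := by
  rw [Spans, eq_top_iff, ← h.submodule_iSup_eq_top]
  exact iSup_le fun n x hx => Submodule.subset_span ⟨n, x, mem_ofGrading.2 ⟨hx, rfl⟩⟩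

/-- A graded structure consists of its own symbols, a homogeneous element being its own symbol. This
puts T(V, c) on the same footing as a filtered bialgebra, so that the symbol map is the transfer of
p. -/
theorem Data.IsGradedBraidedBialgebra.symbol {𝒜 : ℕ → Submodule K A}
    (h : D.IsGradedBraidedBialgebra 𝒜) : D.Symbol D (SymRel.ofGrading 𝒜) where
  mul := Compat.of_tensor fun i j x s y t hx hy => by
    obtain ⟨hx', rfl⟩ := mem_ofGrading.1 hx
    obtain ⟨hy', rfl⟩ := mem_ofGrading.1 hy
    exact mem_ofGrading.2 ⟨h.mul_mem i j (tmul_mem_tens hx' hy'), rfl⟩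
  one := mem_ofGrading.2 ⟨h.one_mem, rfl⟩
  comul n x s hx := by
    obtain ⟨hx', rfl⟩ := mem_ofGrading.1 hx
    exact (iSup₂_le fun _ hab _ ht => mem_tensor_ofGrading hab ht :
      (⨆ (p : ℕ × ℕ) (_ : p.1 + p.2 = n), tens (𝒜 p.1) (𝒜 p.2)) ≤
        ((ofGrading 𝒜).tensor (ofGrading 𝒜) n).comap (LinearMap.id.prod LinearMap.id))
      (h.comul_mem n hx')
  counit n x s hx := by
    obtain ⟨hx', rfl⟩ := mem_ofGrading.1 hx
    cases n with
    | zero => exact mem_ofMap LinearMap.id _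
    -- In positive degree the counit is 0 on both sides.
    | succ n => exact ⟨0, by rw [h.counit_eq_zero _ n.succ_ne_zero hx']; rfl⟩
  braid := Compat.of_tensor_tensor fun i j x s y t hx hy => by
    obtain ⟨hx', rfl⟩ := mem_ofGrading.1 hx
    obtain ⟨hy', rfl⟩ := mem_ofGrading.1 hy
    exact mem_tensor_ofGrading (add_comm j i) (h.braid_mem i j (tmul_mem_tens hx' hy'))

/-- The symbol map is a morphism of graded braided bialgebras. -/
theorem isGradedHom_symbolMap (hc : IsBraiding c) (h : IsConnectedFiltered D F)
    (hpD : (tensorData c).IsHom D p) (hp : ∀ n, ∀ x ∈ tPow K V n, p x ∈ F n) :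
    (tensorData c).IsGradedHom (tPow K V) h.gr (grading F) (symbolMap F p hp) where
  isHom := (isGradedBraidedBialgebra_tensorData c hc).symbol.isHom h.symbol
    (SymRel.spans_ofGrading isInternal_tPow) (good_filRel h.mono) hpD (by
      intro n x s hx
      obtain ⟨hx', rfl⟩ := SymRel.mem_ofGrading.1 hx
      rw [symbolMap_apply hx']
      exact mem_filRel (F := F) ⟨p x, hp n x hx'⟩)
  map_mem n x hx := by
    rw [Submodule.mem_comap, symbolMap_apply hx]
    exact cls_mem_grading _ _

theorem lifts_symbolMap {hp : ∀ n, ∀ x ∈ tPow K V n, p x ∈ F n} :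
    Lifts F p (symbolMap F p hp) := fun v =>
  ⟨hp 1 _ (ι_mem_tPow v), symbolMap_apply (ι_mem_tPow v)⟩

theorem eq_of_lifts {E : Data K (Gr F)} {f f' : 𝕋 →ₗ[K] Gr F} (hf : (tensorData c).IsHom E f)
    (hf' : (tensorData c).IsHom E f') (h : Lifts F p f) (h' : Lifts F p f') : f = f' := by
  refine LinearMap.ext fun x => ?_
  induction x using tensor_induction with
  | one => exact hf.map_one.trans hf'.map_one.symm
  | gen v =>
    obtain ⟨_, h⟩ := h v
    obtain ⟨_, h'⟩ := h' v
    rw [h, h']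
  | mul a b ha hb =>
    have e := LinearMap.congr_fun hf.map_mul (a ⊗ₜ b)
    have e' := LinearMap.congr_fun hf'.map_mul (a ⊗ₜ b)
    simp only [LinearMap.comp_apply, TensorProduct.map_tmul, ha, hb] at e e'
    exact e.trans e'.symm
  | add a b ha hb => rw [map_add, map_add, ha, hb]
  | smul r a ha => rw [map_smul, map_smul, ha]

theorem grOfLE_comp_symbolMap {hp : ∀ n, ∀ x ∈ tPow K V n, p x ∈ F n} {F' : ℕ → Submodule K A}
    (hle : ∀ n, F n ≤ F' n) :
    grOfLE hle ∘ₗ symbolMap F p hp = symbolMap F' p fun n x hx => hle n (hp n x hx) := by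
  refine LinearMap.ext fun x => ?_
  have hx : x ∈ ⨆ n, tPow K V n := by rw [isInternal_tPow.submodule_iSup_eq_top]; trivial
  refine (iSup_le fun n x hx => ?_ : ⨆ n, tPow K V n ≤ LinearMap.eqLocus _ _) hx
  rw [LinearMap.mem_eqLocus, LinearMap.comp_apply, symbolMap_apply hx, symbolMap_apply hx,
    grOfLE_cls]

/-- A class in degree n is represented by p(a) with a of degree at most n. The components of a of
lower degree map into the preceding step, so the class is the symbol of the component of degree n.
-/
theorem symbolMap_surjective {hp : ∀ n, ∀ x ∈ tPow K V n, p x ∈ (tLE K V n).map p} :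
    Function.Surjective (symbolMap (fun n => (tLE K V n).map p) p hp) := by
  rw [← LinearMap.range_eq_top, eq_top_iff, ← (isInternal_grading _).submodule_iSup_eq_top]
  refine iSup_le fun n s hs => ?_
  obtain ⟨⟨_, a, ha, rfl⟩, rfl⟩ := exists_cls_of_mem_grading hs
  have key : tLE K V n ≤ (((LinearMap.range (symbolMap (fun n => (tLE K V n).map p) p hp)).comap
      (cls (fun n => (tLE K V n).map p) n)).comap (p.submoduleMap (tLE K V n))).map
        (tLE K V n).subtype := by
    refine tLE_le fun i hi x hx => ⟨⟨x, tPow_le_tLE hi hx⟩, ?_, rfl⟩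
    rcases hi.lt_or_eq with hi | rfl
    · have h0 : cls (fun n => (tLE K V n).map p) n
          (p.submoduleMap (tLE K V n) ⟨x, tPow_le_tLE hi.le hx⟩) = 0 := by
        rw [cls_eq_zero_iff]
        cases n with
        | zero => omega
        | succ n => exact Submodule.mem_map_of_mem (tPow_le_tLE (Nat.lt_succ_iff.1 hi) hx)
      refine ⟨0, ?_⟩
      rw [map_zero, h0]
    · exact ⟨x, symbolMap_apply hx⟩
  obtain ⟨a', ha', h⟩ := key ha
  obtain rfl : a'.1 = a := h
  exact ha'

end SymbolMap

/-! ### Kernels of morphisms and graded quotients -/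

section Kernel

variable {K : Type u} [Field K]
variable {A : Type*} [AddCommGroup A] [Module K A] {B : Type*} [AddCommGroup B] [Module K B]
variable {D : Data K A} {E : Data K B} {f : A →ₗ[K] B}

theorem ker_map_self (f : A →ₗ[K] B) : LinearMap.ker (TensorProduct.map f f)
    = tens (LinearMap.ker f) ⊤ ⊔ tens ⊤ (LinearMap.ker f) := by
  rw [← ker_map_mkQ]
  apply le_antisymm
  · obtain ⟨g, hg⟩ := exists_comp_eq_of_ker_le (Submodule.ker_mkQ (LinearMap.ker f)).ge
    rw [hg, TensorProduct.map_comp]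
    exact LinearMap.ker_le_ker_comp _ _
  · obtain ⟨g, hg⟩ := exists_comp_eq_of_ker_le (Submodule.ker_mkQ (LinearMap.ker f)).le
    rw [hg, TensorProduct.map_comp, ← hg]
    exact LinearMap.ker_le_ker_comp _ _

theorem Data.IsHom.apply_mul (hf : D.IsHom E f) (x y : A) :
    f (D.mul (x ⊗ₜ y)) = E.mul (f x ⊗ₜ f y) :=
  LinearMap.congr_fun hf.map_mul (x ⊗ₜ y)

theorem Data.IsHom.apply_comul (hf : D.IsHom E f) (x : A) :
    TensorProduct.map f f (D.comul x) = E.comul (f x) :=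
  LinearMap.congr_fun hf.map_comul x

theorem Data.IsHom.apply_counit (hf : D.IsHom E f) (x : A) : E.counit (f x) = D.counit x :=
  LinearMap.congr_fun hf.map_counit x

theorem Data.IsHom.apply_braid (hf : D.IsHom E f) (t : A ⊗[K] A) :
    TensorProduct.map f f (D.braid t) = E.braid (TensorProduct.map f f t) :=
  LinearMap.congr_fun hf.map_braid t

theorem Data.IsHom.mul_eq_zero (hf : D.IsHom E f) {x y : A} (h : f x = 0 ∨ f y = 0) :
    f (D.mul (x ⊗ₜ y)) = 0 := by
  rw [hf.apply_mul]
  rcases h with h | h <;> simp [h]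

theorem Data.IsHom.isBiideal_ker (hf : D.IsHom E f) : D.IsBiideal (LinearMap.ker f) where
  mul_mem := sup_le (tens_le fun _ hx _ _ => hf.mul_eq_zero (Or.inl hx))
    (tens_le fun _ _ _ hy => hf.mul_eq_zero (Or.inr hy))
  comul_mem x hx := by
    rw [Submodule.mem_comap, ← ker_map_self, LinearMap.mem_ker, hf.apply_comul,
      LinearMap.mem_ker.1 hx, map_zero]
  counit_mem x hx := by
    rw [LinearMap.mem_ker, ← hf.apply_counit, LinearMap.mem_ker.1 hx, map_zero]
  braid_mem t ht := by
    rw [← ker_map_self] at ht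
    rw [Submodule.mem_comap, ← ker_map_self, LinearMap.mem_ker, hf.apply_braid,
      LinearMap.mem_ker.1 ht, map_zero]

theorem Data.IsHom.idealSpan_le_ker (hf : D.IsHom E f) {S : Set A} (hS : ∀ x ∈ S, f x = 0) :
    D.idealSpan S ≤ LinearMap.ker f :=
  sInf_le ⟨hS, fun _ _ hx => ⟨hf.mul_eq_zero (Or.inr hx), hf.mul_eq_zero (Or.inl hx)⟩⟩

theorem Data.subset_idealSpan {S : Set A} : S ⊆ D.idealSpan S := fun _ hx =>
  (Submodule.mem_sInf).2 fun _ hI => hI.1 hx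

theorem tens_map_le {X Y : Submodule K A} {W : Submodule K (B ⊗[K] B)}
    (h : ∀ x ∈ X, ∀ y ∈ Y, f x ⊗ₜ f y ∈ W) : tens (X.map f) (Y.map f) ≤ W := by
  refine tens_le ?_
  rintro _ ⟨x, hx, rfl⟩ _ ⟨y, hy, rfl⟩
  exact h x hx y hy

theorem map_mem_tens_map {X Y : Submodule K A} {t : A ⊗[K] A} (ht : t ∈ tens X Y) :
    TensorProduct.map f f t ∈ tens (X.map f) (Y.map f) :=
  (tens_le fun _ hx _ hy => tmul_mem_tens (Submodule.mem_map_of_mem hx)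
    (Submodule.mem_map_of_mem hy) :
    tens X Y ≤ (tens (X.map f) (Y.map f)).comap (TensorProduct.map f f)) ht

theorem Data.IsGradedBraidedBialgebra.map {𝒜 : ℕ → Submodule K A}
    (h : D.IsGradedBraidedBialgebra 𝒜) (hE : E.IsBraidedBialgebra) (hf : D.IsHom E f)
    (hi : DirectSum.IsInternal fun n => (𝒜 n).map f) :
    E.IsGradedBraidedBialgebra fun n => (𝒜 n).map f where
  isBraidedBialgebra := hE
  isInternal := hi
  mul_mem i j := tens_map_le fun x hx y hy => by
    rw [Submodule.mem_comap, ← hf.apply_mul]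
    exact Submodule.mem_map_of_mem (h.mul_mem i j (tmul_mem_tens hx hy))
  one_mem := ⟨D.one, h.one_mem, hf.map_one⟩
  comul_mem n := Submodule.map_le_iff_le_comap.2 fun x hx => by
    rw [Submodule.mem_comap, Submodule.mem_comap, ← hf.apply_comul]
    exact (iSup₂_le fun ab hab t ht => le_iSup₂ (f := fun (q : ℕ × ℕ) (_ : q.1 + q.2 = n) =>
        tens ((𝒜 q.1).map f) ((𝒜 q.2).map f)) ab hab (map_mem_tens_map ht) :
      (⨆ (q : ℕ × ℕ) (_ : q.1 + q.2 = n), tens (𝒜 q.1) (𝒜 q.2)) ≤ Submodule.comap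
        (TensorProduct.map f f) (⨆ (q : ℕ × ℕ) (_ : q.1 + q.2 = n),
          tens ((𝒜 q.1).map f) ((𝒜 q.2).map f))) (h.comul_mem n hx)
  counit_eq_zero n hn := Submodule.map_le_iff_le_comap.2 fun x hx => by
    rw [Submodule.mem_comap, LinearMap.mem_ker, hf.apply_counit]
    exact h.counit_eq_zero n hn hx
  braid_mem i j := tens_map_le fun x hx y hy => by
    rw [Submodule.mem_comap, ← TensorProduct.map_tmul, ← hf.apply_braid]
    exact map_mem_tens_map (h.braid_mem i j (tmul_mem_tens hx hy))

theorem isInternal_of_injective {G : ℕ → Submodule K A} {H : ℕ → Submodule K B}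
    (hH : DirectSum.IsInternal H) (hG : ⨆ n, G n = ⊤) (hf : Function.Injective f)
    (hGH : ∀ n, G n ≤ (H n).comap f) : DirectSum.IsInternal G := by
  refine DirectSum.isInternal_submodule_of_iSupIndep_of_iSup_eq_top ?_ hG
  intro n
  rw [Submodule.disjoint_def]
  intro x hx hx'
  have h : (⨆ (j) (_ : j ≠ n), G j) ≤ (⨆ (j) (_ : j ≠ n), H j).comap f :=
    iSup₂_le fun j hj y hy => le_iSup₂ (f := fun (j : ℕ) (_ : j ≠ n) => H j) j hj (hGH j hy)
  exact hf ((Submodule.disjoint_def.1 (hH.submodule_iSupIndep n) _ (hGH n hx) (h hx')).trans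
    (map_zero f).symm)

end Kernel

/-! ### Primitive elements of the graded space of the coradical filtration -/

section Primitive

variable {K : Type u} [Field K] {A : Type*} [AddCommGroup A] [Module K A] {D : Data K A}

theorem component_cls_of_ne {F : ℕ → Submodule K A} {i n : ℕ} (h : n ≠ i) (x : F n) :
    DirectSum.component K ℕ (GrPiece F) i (cls F n x) = 0 := by
  rw [cls, LinearMap.comp_apply, DirectSum.component.of, dif_neg h]

theorem component_comp_cls {F : ℕ → Submodule K A} (n : ℕ) :
    DirectSum.component K ℕ (GrPiece F) n ∘ₗ cls F n = Submodule.mkQ _ :=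
  LinearMap.ext fun x => DirectSum.component.lof_self K (M := GrPiece F) n (Submodule.Quotient.mk x)

/-- The component of the coproduct in bidegree (1, n - 1) vanishes for a primitive element of degree
n ≥ 2. For the coradical filtration this says that Δ x vanishes in A / A₀ ⊗ A / A_{n-2}, which is
the definition of x lying in A_{n-1}. -/
theorem cls_eq_zero_of_primitive (h : IsConnectedFiltered D D.coradFil) {n : ℕ} (hn : 2 ≤ n)
    (x : D.coradFil n) (hx : h.gr.comul (cls D.coradFil n x)
      = cls D.coradFil n x ⊗ₜ h.gr.one + h.gr.one ⊗ₜ cls D.coradFil n x) :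
    cls D.coradFil n x = 0 := by
  obtain ⟨m, rfl⟩ : ∃ m, n = m + 2 := ⟨n - 2, by omega⟩
  obtain ⟨t, ht⟩ := h.exists_comul_eq x
  rw [h.gr_comul_cls x t ht] at hx
  -- Projection to bidegree (1, m + 1). It kills x ⊗ 1, since x has degree m + 2 ≠ 1, and 1 ⊗ x,
  -- since 1 has degree 0.
  have e := congrArg (TensorProduct.map (DirectSum.component K ℕ (GrPiece D.coradFil) 1)
    (DirectSum.component K ℕ (GrPiece D.coradFil) (m + 1))) hx
  have h0 : DirectSum.component K ℕ (GrPiece D.coradFil) 1 h.gr.one = 0 :=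
    component_cls_of_ne (by omega : 0 ≠ 1) _
  rw [map_add, TensorProduct.map_tmul, TensorProduct.map_tmul, h0,
    component_cls_of_ne (by omega : m + 2 ≠ 1), TensorProduct.zero_tmul, TensorProduct.zero_tmul, add_zero,
    map_sum, Finset.sum_eq_single_of_mem (1, m + 1)
      (Finset.HasAntidiagonal.mem_antidiagonal.2 (by omega)), ← LinearMap.comp_apply,
    ← TensorProduct.map_comp, component_comp_cls, component_comp_cls] at e
  · have e' := h.grComul_mk (i := 1) (j := m + 1) (n := m + 2) (by omega) x t ht
    rw [e] at e'
    have e'' : TensorProduct.map (toQ D.coradFil 1) (toQ D.coradFil (m + 1))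
        (h.grComul (by omega : 1 + (m + 1) = m + 2) (Submodule.Quotient.mk x))
        = TensorProduct.map (below D.coradFil 1).mkQ (below D.coradFil (m + 1)).mkQ (D.comul x) :=
      induced_apply (Submodule.mkQ _) _ _ _ _ _ _ x
    rw [cls_eq_zero_iff]
    show (x : A) ∈ D.coradFil (m + 1)
    rw [coradFil_succ_eq_ker]
    refine e''.symm.trans ?_
    exact (congrArg _ e').trans (map_zero _)
  · rintro ⟨i, j⟩ hij hne
    rw [Finset.HasAntidiagonal.mem_antidiagonal] at hij
    have hi : i ≠ 1 := fun hi => hne (by rw [Prod.mk.injEq]; omega)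
    have : DirectSum.component K ℕ (GrPiece D.coradFil) 1 ∘ₗ cls D.coradFil i = 0 :=
      LinearMap.ext fun y => component_cls_of_ne hi y
    rw [← LinearMap.comp_apply, ← TensorProduct.map_comp, this, TensorProduct.map_zero_left,
      LinearMap.zero_apply]

end Primitive

/-! ### The kernel of the projection onto the Nichols algebra -/

section Nichols

variable {K : Type u} [Field K] {V : Type v} [AddCommGroup V] [Module K V]
variable {c : V ⊗[K] V →ₗ[K] V ⊗[K] V}
variable {B : Type*} [AddCommGroup B] [Module K B] {E : Data K B}
variable {f : TensorAlgebra K V →ₗ[K] B}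

local notation "𝕋" => TensorAlgebra K V

theorem symIdeal_mono : Monotone (symIdeal c) :=
  monotone_nat_of_le_succ fun _ _ hx => Data.subset_idealSpan (Or.inl hx)

theorem exists_mem_symIdeal {x : 𝕋} (hx : x ∈ nicholsIdeal c) : ∃ n, x ∈ symIdeal c n :=
  (Submodule.mem_iSup_of_directed _ symIdeal_mono.directed_le).1 hx

theorem symIdeal_le : ∀ n, symIdeal c n ≤ nicholsIdeal c := le_iSup (symIdeal c)

/-- By induction f factors through each stage of the Nichols construction. An element that is
primitive at stage n has a primitive image under f, which is zero by hypothesis, so f kills the next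
ideal as well. -/
theorem nicholsIdeal_le_ker (hf : (tensorData c).IsHom E f)
    (h : ∀ n, 2 ≤ n → ∀ z ∈ tPow K V n,
      E.comul (f z) = f z ⊗ₜ E.one + E.one ⊗ₜ f z → f z = 0) :
    nicholsIdeal c ≤ LinearMap.ker f := by
  refine iSup_le fun n => ?_
  induction n with
  | zero => exact bot_le
  | succ n ih =>
    refine hf.idealSpan_le_ker ?_
    rintro x (hx | ⟨k, hk, hx, e⟩)
    · exact ih hx
    refine h k hk x hx ?_
    obtain ⟨g, rfl⟩ := exists_comp_eq_of_ker_le ((Submodule.ker_mkQ _).le.trans ih)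
    have e' := congrArg (TensorProduct.map g g) e
    rw [← LinearMap.comp_apply, ← TensorProduct.map_comp, hf.apply_comul, map_add,
      TensorProduct.map_tmul, TensorProduct.map_tmul] at e'
    rw [e', ← hf.map_one]
    rfl

/-- The ideals form an increasing sequence and a tensor involves finitely many elements, so a
relation in the limit already holds at a finite stage. -/
theorem exists_mem_symIdeal_tens {t : 𝕋 ⊗[K] 𝕋}
    (ht : t ∈ tens (nicholsIdeal c) ⊤ ⊔ tens ⊤ (nicholsIdeal c)) :
    ∃ n, t ∈ tens (symIdeal c n) ⊤ ⊔ tens ⊤ (symIdeal c n) := by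
  have hm : Monotone fun n => tens (symIdeal c n) ⊤ ⊔ tens ⊤ (symIdeal c n) := fun m n h =>
    sup_le_sup (tens_mono (symIdeal_mono h) le_rfl) (tens_mono le_rfl (symIdeal_mono h))
  rw [← Submodule.mem_iSup_of_directed _ hm.directed_le]
  refine (sup_le (tens_le fun x hx y _ => ?_) (tens_le fun x _ y hy => ?_) :
    tens (nicholsIdeal c) ⊤ ⊔ tens ⊤ (nicholsIdeal c) ≤ _) ht
  · obtain ⟨n, hn⟩ := exists_mem_symIdeal hx
    exact Submodule.mem_iSup_of_mem n
      (Submodule.mem_sup_left (tmul_mem_tens hn Submodule.mem_top))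
  · obtain ⟨n, hn⟩ := exists_mem_symIdeal hy
    exact Submodule.mem_iSup_of_mem n
      (Submodule.mem_sup_right (tmul_mem_tens Submodule.mem_top hn))

/-- The Nichols algebra has no homogeneous primitive elements of degree at least two: primitivity in
the limit is primitivity at some stage m, and stage m + 1 kills the element. -/
theorem mem_nicholsIdeal_of_comul {n : ℕ} (hn : 2 ≤ n) {z : 𝕋} (hz : z ∈ tPow K V n)
    (h : (tensorData c).comul z - z ⊗ₜ 1 - 1 ⊗ₜ z
      ∈ tens (nicholsIdeal c) ⊤ ⊔ tens ⊤ (nicholsIdeal c)) : z ∈ nicholsIdeal c := by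
  obtain ⟨m, hm⟩ := exists_mem_symIdeal_tens h
  refine symIdeal_le (m + 1) (Data.subset_idealSpan (Or.inr ⟨n, hn, hz, ?_⟩))
  rw [← ker_map_mkQ, LinearMap.mem_ker, map_sub, map_sub, TensorProduct.map_tmul,
    TensorProduct.map_tmul, sub_sub, sub_eq_zero] at hm
  exact hm

theorem counit_of_mem_tPow {n : ℕ} (hn : n ≠ 0) (hc : IsBraiding c) {x : 𝕋} (hx : x ∈ tPow K V n) :
    (tensorData c).counit x = 0 :=
  (isGradedBraidedBialgebra_tensorData c hc).counit_eq_zero n hn hx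

/-- The reduced comultiplication of a homogeneous tensor involves only lower degrees. -/
theorem comul_sub_mem (hc : IsBraiding c) {n : ℕ} {z : 𝕋} (hz : z ∈ tPow K V (n + 1)) :
    (tensorData c).comul z - z ⊗ₜ 1 - 1 ⊗ₜ z ∈ tens (tLE K V n) (tLE K V n) := by
  have hT := isGradedBraidedBialgebra_tensorData c hc
  set ε : 𝕋 →ₗ[K] K := (tensorData c).counit with hε
  have hε1 : ε 1 = 1 := hT.isBraidedBialgebra.counit_one
  -- This map subtracts the parts with a factor of degree zero. It vanishes in bidegrees (0, n + 1)
  -- and (n + 1, 0) and is the identity if both degrees are positive; bidegree (0, 0) does not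
  -- occur. By the counit axioms it turns Δ z into the reduced coproduct.
  let L : 𝕋 ⊗[K] 𝕋 →ₗ[K] 𝕋 ⊗[K] 𝕋 := LinearMap.id
    - (TensorProduct.mk K 𝕋 𝕋).flip 1 ∘ₗ (TensorProduct.rid K 𝕋).toLinearMap ∘ₗ ε.lTensor 𝕋
    - TensorProduct.mk K 𝕋 𝕋 1 ∘ₗ (TensorProduct.lid K 𝕋).toLinearMap ∘ₗ ε.rTensor 𝕋
  have hL : ∀ x y, L (x ⊗ₜ y) = x ⊗ₜ y - ε y • x ⊗ₜ[K] (1 : 𝕋) - ε x • (1 : 𝕋) ⊗ₜ[K] y := by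
    intro x y
    simp [L, TensorProduct.smul_tmul']
  have hLz : L ((tensorData c).comul z) = (tensorData c).comul z - z ⊗ₜ 1 - 1 ⊗ₜ z := by
    have e1 := LinearMap.congr_fun hT.isBraidedBialgebra.comul_counit z
    have e2 := LinearMap.congr_fun hT.isBraidedBialgebra.counit_comul z
    simp only [LinearMap.comp_apply, LinearMap.id_apply, ← hε] at e1 e2
    simp only [L, LinearMap.sub_apply, LinearMap.comp_apply, LinearMap.id_apply, e1, e2]
    rfl
  rw [← hLz]
  refine (iSup₂_le fun ab hab => tens_le fun x hx y hy => ?_ :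
    (⨆ (p : ℕ × ℕ) (_ : p.1 + p.2 = n + 1), tens (tPow K V p.1) (tPow K V p.2)) ≤
      (tens (tLE K V n) (tLE K V n)).comap L) (hT.comul_mem (n + 1) hz)
  rw [Submodule.mem_comap, hL]
  obtain ⟨a, b⟩ := ab
  simp only at hab hx hy
  rcases Nat.eq_zero_or_pos a with rfl | ha
  · obtain ⟨r, rfl⟩ := Submodule.mem_span_singleton.1 (tPow_zero_eq (K := K) (V := V) ▸ hx)
    rw [hε, counit_of_mem_tPow (by omega) hc hy, ← hε, map_smul, hε1, zero_smul, sub_zero,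
      smul_eq_mul, mul_one, ← TensorProduct.smul_tmul', sub_self]
    exact Submodule.zero_mem _
  rcases Nat.eq_zero_or_pos b with rfl | hb
  · obtain ⟨r, rfl⟩ := Submodule.mem_span_singleton.1 (tPow_zero_eq (K := K) (V := V) ▸ hy)
    rw [hε, counit_of_mem_tPow (by omega) hc hx, ← hε, map_smul, hε1, zero_smul, sub_zero,
      smul_eq_mul, mul_one, TensorProduct.tmul_smul, sub_self]
    exact Submodule.zero_mem _
  · rw [hε, counit_of_mem_tPow (by omega) hc hx, counit_of_mem_tPow (by omega) hc hy, zero_smul,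
      zero_smul, sub_zero, sub_zero]
    exact tmul_mem_tens (tPow_le_tLE (by omega) hx) (tPow_le_tLE (by omega) hy)

/-- As f(z) = 0, the reduced coproduct of z is killed by f ⊗ f. It involves only tensors of degree
at most n, where the kernel of f is already contained in the Nichols ideal, so on them the
projection Ω factors through f. Hence Ω ⊗ Ω kills it too, and z is primitive modulo the Nichols
ideal. -/
theorem mem_nicholsIdeal_of_apply_eq_zero (hc : IsBraiding c) (hf : (tensorData c).IsHom E f)
    {n : ℕ} (hn : 2 ≤ n + 1)
    (ih : ∀ x ∈ tLE K V n, f x = 0 → x ∈ nicholsIdeal c) {z : 𝕋} (hz : z ∈ tPow K V (n + 1))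
    (h : f z = 0) : z ∈ nicholsIdeal c := by
  refine mem_nicholsIdeal_of_comul hn hz ?_
  obtain ⟨t, ht⟩ := comul_sub_mem hc hz
  have h0 : TensorProduct.map f f ((tensorData c).comul z - z ⊗ₜ 1 - 1 ⊗ₜ z) = 0 := by
    rw [map_sub, map_sub, hf.apply_comul, TensorProduct.map_tmul, TensorProduct.map_tmul, h,
      map_zero, TensorProduct.zero_tmul, TensorProduct.tmul_zero, sub_zero, sub_zero]
  have hk : LinearMap.ker (f ∘ₗ (tLE K V n).subtype) ≤
      LinearMap.ker ((nicholsIdeal c).mkQ ∘ₗ (tLE K V n).subtype) := fun x hx =>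
    (Submodule.Quotient.mk_eq_zero _).2 (ih x x.2 hx)
  obtain ⟨g, hg⟩ := exists_comp_eq_of_ker_le hk
  rw [← ker_map_mkQ, LinearMap.mem_ker, ← ht, TensorProduct.mapIncl, ← LinearMap.comp_apply,
    ← TensorProduct.map_comp, hg, ← LinearMap.comp_assoc, TensorProduct.map_comp,
    TensorProduct.map_comp, LinearMap.comp_apply]
  rw [← ht, TensorProduct.mapIncl] at h0
  rw [LinearMap.comp_apply, h0, map_zero]

theorem tLE_succ (n : ℕ) : tLE K V (n + 1) = tLE K V n ⊔ tPow K V (n + 1) := by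
  refine le_antisymm (tLE_le fun i hi => ?_)
    (sup_le (tLE_le fun i hi => tPow_le_tLE (by omega)) (tPow_le_tLE le_rfl))
  rcases hi.lt_or_eq with hi | rfl
  · exact (tPow_le_tLE (by omega)).trans le_sup_left
  · exact le_sup_right

/-- A graded morphism from `T(V, c)` which is injective on `V` has its kernel in the kernel of the
projection onto the Nichols algebra. -/
theorem ker_le_nicholsIdeal (hc : IsBraiding c) {ℬ : ℕ → Submodule K B}
    (hE : E.IsGradedBraidedBialgebra ℬ) (hf : (tensorData c).IsGradedHom (tPow K V) E ℬ f)
    (hinj : ∀ v, f (TensorAlgebra.ι K v) = 0 → v = 0) :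
    LinearMap.ker f ≤ nicholsIdeal c := by
  have key : ∀ n, ∀ x ∈ tLE K V n, f x = 0 → x ∈ nicholsIdeal c := by
    intro n
    induction n with
    | zero =>
      intro x hx h
      have hx : x ∈ tPow K V 0 := tLE_le (fun i hi => (Nat.le_zero.1 hi) ▸ le_rfl) hx
      obtain ⟨r, rfl⟩ := Submodule.mem_span_singleton.1 (tPow_zero_eq (K := K) (V := V) ▸ hx)
      have e := hf.isHom.apply_counit (r • 1)
      have e1 : (tensorData c).counit (1 : 𝕋) = 1 :=
        (isGradedBraidedBialgebra_tensorData c hc).isBraidedBialgebra.counit_one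
      rw [h, map_zero, map_smul, e1, smul_eq_mul, mul_one] at e
      rw [← e, zero_smul]
      exact Submodule.zero_mem _
    | succ n ih =>
      intro x hx h
      rw [tLE_succ] at hx
      obtain ⟨y, hy, z, hz, rfl⟩ := Submodule.mem_sup.1 hx
      have hy' : f y ∈ ⨆ (j) (_ : j ≠ n + 1), ℬ j :=
        (tLE_le fun i hi x hx => le_iSup₂ (f := fun (j : ℕ) (_ : j ≠ n + 1) => ℬ j) i (by omega)
          (hf.map_mem i hx) : tLE K V n ≤ Submodule.comap f (⨆ (j) (_ : j ≠ n + 1), ℬ j)) hy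
      have hz' : f z ∈ ℬ (n + 1) := hf.map_mem _ hz
      have hyz : f z = - f y := by
        rw [map_add] at h
        exact eq_neg_of_add_eq_zero_right h
      -- Since f is graded, f z has degree n + 1 while f y has no component in that degree; their
      -- sum is zero, so both vanish.
      have hz0 : f z = 0 := Submodule.disjoint_def.1 (hE.isInternal.submodule_iSupIndep (n + 1)) _
        hz' (hyz ▸ Submodule.neg_mem _ hy')
      have hy0 : f y = 0 := by rw [hz0, zero_eq_neg] at hyz; exact hyz
      refine Submodule.add_mem _ (ih y hy hy0) ?_
      cases n with
      | zero =>
        rw [tPow, zero_add, pow_one] at hz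
        obtain ⟨v, rfl⟩ := hz
        rw [hinj v hz0, map_zero]
        exact Submodule.zero_mem _
      | succ n => exact mem_nicholsIdeal_of_apply_eq_zero hc hf.isHom (by omega) ih hz hz0
  intro x hx
  have hm : Monotone (tLE K V) := fun m n h => tLE_le fun i hi => tPow_le_tLE (hi.trans h)
  have hx' : x ∈ ⨆ n, tLE K V n := by
    refine (iSup_mono fun n => tPow_le_tLE le_rfl : ⨆ n, tPow K V n ≤ _) ?_
    rw [isInternal_tPow.submodule_iSup_eq_top]
    trivial
  obtain ⟨n, hn⟩ := (Submodule.mem_iSup_of_directed _ hm.directed_le).1 hx'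
  exact key n x hn hx

/-- A graded morphism from `T(V, c)` with the same kernel as the projection onto the Nichols algebra
factors through it. -/
theorem isGradedBraidedBialgebra_nichols (hc : IsBraiding c) {ℬ : ℕ → Submodule K B}
    (hE : E.IsGradedBraidedBialgebra ℬ) (hf : (tensorData c).IsGradedHom (tPow K V) E ℬ f)
    (hker : LinearMap.ker f = nicholsIdeal c) :
    ∃ hN : (tensorData c).IsBiideal (nicholsIdeal c),
      (Data.quot hN).IsGradedBraidedBialgebra (nicholsGrading c) ∧
      ∃ χ : (𝕋 ⧸ nicholsIdeal c) →ₗ[K] B, χ ∘ₗ omega c = f ∧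
        (Data.quot hN).IsGradedHom (nicholsGrading c) E ℬ χ ∧ Function.Injective χ := by
  -- The ideal inherits compatibility with the structure maps from its description as the kernel of
  -- a morphism; no direct argument with the stages is needed.
  have hN : (tensorData c).IsBiideal (nicholsIdeal c) := hker ▸ hf.isHom.isBiideal_ker
  have hT := isGradedBraidedBialgebra_tensorData c hc
  have hχ : (nicholsIdeal c).liftQ f hker.ge ∘ₗ omega c = f := Submodule.liftQ_mkQ _ _ _
  have hinj : Function.Injective ((nicholsIdeal c).liftQ f hker.ge) :=
    LinearMap.ker_eq_bot.1 (Submodule.ker_liftQ_eq_bot _ _ _ hker.le)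
  have hmem : ∀ n, nicholsGrading c n ≤ (ℬ n).comap ((nicholsIdeal c).liftQ f hker.ge) :=
    fun n => Submodule.map_le_iff_le_comap.2 (hf.map_mem n)
  have hpi := Data.isHom_mkQ hN
  refine ⟨hN, ?_, (nicholsIdeal c).liftQ f hker.ge, hχ,
    ⟨hpi.of_comp_surjective (Submodule.mkQ_surjective _) (by exact hχ.symm ▸ hf.isHom), hmem⟩, hinj⟩
  -- The images of the V^{⊗ n} in the Nichols algebra are independent because the injective map χ
  -- sends them into independent components of B.
  refine hT.map (Data.isBraidedBialgebra_quot hN hT.isBraidedBialgebra) hpi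
    (isInternal_of_injective hE.isInternal ?_ hinj hmem)
  rw [← Submodule.map_iSup, hT.isInternal.submodule_iSup_eq_top, Submodule.map_top]
  exact Submodule.range_mkQ _

end Nichols

/-! ### The kernel of the symbol map of the coradical filtration -/

section SymbolKernel

variable {K : Type u} [Field K] {V : Type v} [AddCommGroup V] [Module K V]
variable {c : V ⊗[K] V →ₗ[K] V ⊗[K] V}
variable {A : Type*} [AddCommGroup A] [Module K A] {D : Data K A}
variable {p : TensorAlgebra K V →ₗ[K] A}

theorem nicholsIdeal_le_ker_symbolMap (hc : IsBraiding c) (h : IsConnectedFiltered D D.coradFil)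
    (hpD : (tensorData c).IsHom D p) (hp : ∀ n, ∀ x ∈ tPow K V n, p x ∈ D.coradFil n) :
    nicholsIdeal c ≤ LinearMap.ker (symbolMap D.coradFil p hp) := by
  refine nicholsIdeal_le_ker (isGradedHom_symbolMap hc h hpD hp).isHom ?_
  intro n hn z hz e
  rw [symbolMap_apply hz] at e ⊢
  exact cls_eq_zero_of_primitive h hn _ e

/-- If the symbol of v vanishes in degree 1, then p(v) lies in the coradical, so p(v) = r · 1. The
counit of v is zero, hence r = 0 and p(v) = 0. -/
theorem eq_zero_of_symbolMap_ι (hc : IsBraiding c) (h : IsConnectedFiltered D D.coradFil)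
    (hpD : (tensorData c).IsHom D p) (hp : ∀ n, ∀ x ∈ tPow K V n, p x ∈ D.coradFil n)
    (hinj : ∀ v, p (TensorAlgebra.ι K v) = 0 → v = 0) (v : V)
    (hv : symbolMap D.coradFil p hp (TensorAlgebra.ι K v) = 0) : v = 0 := by
  rw [symbolMap_apply (ι_mem_tPow v), cls_eq_zero_iff] at hv
  obtain ⟨r, hr⟩ := (mem_coradFil_zero h.zero_eq).1 hv
  have e := hpD.apply_counit (TensorAlgebra.ι K v)
  rw [counit_of_mem_tPow one_ne_zero hc (ι_mem_tPow v)] at e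
  simp only at hr
  rw [← hr, map_smul, h.isBraidedBialgebra.counit_one, smul_eq_mul, mul_one] at e
  rw [e, zero_smul] at hr
  exact hinj v hr.symm

theorem ker_symbolMap_coradFil (hc : IsBraiding c) (h : IsConnectedFiltered D D.coradFil)
    (hpD : (tensorData c).IsHom D p) (hp : ∀ n, ∀ x ∈ tPow K V n, p x ∈ D.coradFil n)
    (hinj : ∀ v, p (TensorAlgebra.ι K v) = 0 → v = 0) :
    LinearMap.ker (symbolMap D.coradFil p hp) = nicholsIdeal c := by
  have h1 := ker_le_nicholsIdeal hc h.isGradedBraidedBialgebra_gr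
    (isGradedHom_symbolMap hc h hpD hp) (eq_zero_of_symbolMap_ι hc h hpD hp hinj)
  have h2 := nicholsIdeal_le_ker_symbolMap hc h hpD hp
  exact le_antisymm h1 h2

end SymbolKernel

end BraidedLie

end

/-! ### The main theorem. -/

open BraidedLie

theorem mainTheorem8 {K : Type*} [Field K] {V : Type*} [AddCommGroup V] [Module K V]
    {c : V ⊗[K] V →ₗ[K] V ⊗[K] V} (b : BraidedBracket c) (hb : b.IsBraidedLieAlgebra) :
    -- the standard and the coradical filtration of `U` and the Nichols ideal are compatible with
    -- the structure maps
    ∃ (hS : IsConnectedFiltered b.dataU b.stdFil) (hR : IsConnectedFiltered b.dataU b.coradFil)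
      (hle : ∀ n, b.stdFil n ≤ b.coradFil n) (hN : (tensorData c).IsBiideal (nicholsIdeal c)),
    -- `T(V, c)`, `𝔊(U)`, `gr U` and `ℬ(V, c)` are graded braided bialgebras
    (tensorData c).IsGradedBraidedBialgebra (tPow K V) ∧
    hS.gr.IsGradedBraidedBialgebra (grading b.stdFil) ∧
    hR.gr.IsGradedBraidedBialgebra (grading b.coradFil) ∧
    (Data.quot hN).IsGradedBraidedBialgebra (nicholsGrading c) ∧
    -- the map `ξ_U : 𝔊(U) → gr U`
    hS.gr.IsGradedHom (grading b.stdFil) hR.gr (grading b.coradFil) (grOfLE hle) ∧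
    -- the map `ϑ_U : T(V, c) → 𝔊(U)`
    ∃ θ : TensorAlgebra K V →ₗ[K] Gr b.stdFil,
      (tensorData c).IsGradedHom (tPow K V) hS.gr (grading b.stdFil) θ ∧
      Lifts b.stdFil b.piU θ ∧
      (∀ θ' : TensorAlgebra K V →ₗ[K] Gr b.stdFil,
        (tensorData c).IsGradedHom (tPow K V) hS.gr (grading b.stdFil) θ' →
        Lifts b.stdFil b.piU θ' → θ' = θ) ∧
      Function.Surjective θ ∧
      -- `ξ_U ϑ_U` is the unique graded morphism lifting `v ↦ π_U(v) + U_0`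
      (tensorData c).IsGradedHom (tPow K V) hR.gr (grading b.coradFil) (grOfLE hle ∘ₗ θ) ∧
      Lifts b.coradFil b.piU (grOfLE hle ∘ₗ θ) ∧
      (∀ f : TensorAlgebra K V →ₗ[K] Gr b.coradFil,
        (tensorData c).IsGradedHom (tPow K V) hR.gr (grading b.coradFil) f →
        Lifts b.coradFil b.piU f → f = grOfLE hle ∘ₗ θ) ∧
      -- it factors through the Nichols algebra as an injective graded morphism `χ_U`
      ∃ χ : (TensorAlgebra K V ⧸ nicholsIdeal c) →ₗ[K] Gr b.coradFil,
        χ ∘ₗ omega c = grOfLE hle ∘ₗ θ ∧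
        (Data.quot hN).IsGradedHom (nicholsGrading c) hR.gr (grading b.coradFil) χ ∧
        Function.Injective χ := by
  have hc := hb.isBraiding
  have hT := isGradedBraidedBialgebra_tensorData c hc
  have hD : b.dataU.IsBraidedBialgebra :=
    Data.isBraidedBialgebra_quot b.isBiideal_limIdeal hT.isBraidedBialgebra
  have hpi : (tensorData c).IsHom b.dataU b.piU := Data.isHom_mkQ b.isBiideal_limIdeal
  have hS : IsConnectedFiltered b.dataU b.stdFil :=
    isConnectedFiltered_map hc hD hpi (Submodule.mkQ_surjective _)
  have hR : IsConnectedFiltered b.dataU b.coradFil := hS.isConnectedFiltered_coradFil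
  have hle : ∀ n, b.stdFil n ≤ b.coradFil n := hS.le_coradFil
  have hpS : ∀ n, ∀ x ∈ tPow K V n, b.piU x ∈ b.stdFil n := fun n x hx =>
    Submodule.mem_map_of_mem (tPow_le_tLE le_rfl hx)
  have hpR : ∀ n, ∀ x ∈ tPow K V n, b.piU x ∈ b.coradFil n := fun n x hx => hle n (hpS n x hx)
  have hθ := isGradedHom_symbolMap hc hS hpi hpS
  have hf := isGradedHom_symbolMap hc hR hpi hpR
  -- Identifies ξ_U ϑ_U with the symbol map of the coradical filtration, so its properties in (b)
  -- and (c) are those of a symbol map.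
  have hcomp : grOfLE hle ∘ₗ symbolMap b.stdFil b.piU hpS = symbolMap b.coradFil b.piU hpR :=
    grOfLE_comp_symbolMap hle
  -- Only here does the injectivity of π_U on V, that is, the braided Lie algebra condition, enter.
  have hker : LinearMap.ker (symbolMap b.coradFil b.piU hpR) = nicholsIdeal c :=
    ker_symbolMap_coradFil hc hR hpi hpR fun v hv => hb.injective (hv.trans (map_zero b.iU).symm)
  obtain ⟨hN, hB, χ, hχ, hχ', hinj⟩ :=
    isGradedBraidedBialgebra_nichols hc hR.isGradedBraidedBialgebra_gr hf hker
  refine ⟨hS, hR, hle, hN, hT, hS.isGradedBraidedBialgebra_gr, hR.isGradedBraidedBialgebra_gr, hB,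
    isGradedHom_grOfLE hS hR hle, symbolMap b.stdFil b.piU hpS, hθ, lifts_symbolMap,
    fun θ' h h' => eq_of_lifts h.isHom hθ.isHom h' lifts_symbolMap, symbolMap_surjective, ?_⟩
  rw [hcomp]
  exact ⟨hf, lifts_symbolMap, fun f h h' => eq_of_lifts h.isHom hf.isHom h' lifts_symbolMap,
    χ, hχ, hχ', hinj⟩
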